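/- **Conventions.** Multigraphs are finite. A multigraph is *2-connected* if it has no loops, has at least two vertices, is connected, and remains connected after the removal of any single vertex (so two vertices joined by $n\ge 1$ edges form a 2-connected multigraph). $C_n$ denotes the $n$-cycle; $C_2$ is two vertices joined by two parallel edges. $G\setminus e$ and $G/e$ denote deletion and contraction of an edge $e$; in $G/e$ the edges parallel to $e$ become loops. For $S\subseteq V$, $E(S)$ is the set of edges with both ends in $S$. A *good flat* of $G=(V,E)$ is a set $S\subsetneq V$ such that both the restriction of $G$ to $S$ and the contraction of $E(S)$ in $G$ are 2-connected. A *weight function* (for $\delta$) on $G=(V,E)$ is a map $w\colon E\to\{1,\delta-1\}$ such that $w(e)=1$ whenever $G\setminus e$ is 2-connected and $w(e)=\delta-1$ whenever $G/e$ is 2-connected. $G$ satisfies the weight equalities $(\spadesuit)_\delta$ if it possesses a weight function $w$ with 1. $\sum_{e\in E}w(e)=\delta(|V|-1)$, and 2. $\sum_{e\in E(S)}w(e)+1=\delta(|S|-1)$ for every good flat $S$. **Constructions.** - *Path construction.* Given 2-connected multigraphs $G_1,G_2$ with edges $e_1,e_2$ of weights $w(e_1)=1$ and $w(e_2)=\delta-1$,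 glue $G_1$ and $G_2$ along $e_1$ and $e_2$ (identifying the ends of $e_1$ with the ends of $e_2$) and delete the glued edge. - *$\delta$-construction.* Given 2-connected multigraphs $G_1,G_2$ with edges $e_1,e_2$ of weights $w(e_1)=w(e_2)=\delta-1$, glue $G_1$ and $G_2$ along $e_1$ and $e_2$ and substitute the glued edge with $\delta-2$ parallel edges. - *Reverse construction.* Given a 2-connected multigraph with a path of $\delta-1$ edges between two distinct vertices, all of whose interior vertices have degree 2, substitute the path by a single edge. A multigraph *can be obtained from a $\delta$-cycle* if it belongs to the smallest class of multigraphs that is closed under isomorphism, contains $C_\delta$, and is closed under the three constructions (both input multigraphs of a gluing being in the class). **Theorem.** Let $\delta>2$ be an integer and let $G$ be a 2-connected multigraph. Then $G$ satisfies $(\spadesuit)_\delta$ if and only if $G$ is not the 2-cycle $C_2$ and $G$ can be obtained from a $\delta$-cycle by the path construction, the $\delta$-construction and the reverse construction. -/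

import Mathlib

universe u v

namespace Graph

variable {α : Type u} {β : Type v}

/-! Multigraphs are Mathlib's `Graph α β`: a vertex set `V(G)` in `α`, an edge set `E(G)` in `β`,
and `G.IsLink e x y` saying that `x` and `y` are the ends of the edge `e`. -/

/-- Connectedness: there is a vertex, and any two vertices are joined by a walk. -/
def IsConn (G : Graph α β) : Prop :=
  V(G).Nonempty ∧ ∀ x ∈ V(G), ∀ y ∈ V(G), Relation.ReflTransGen G.Adj x y

/-- A multigraph is 2-connected if it has no loops, has at least two vertices, is connected, and has
no separating vertex. Parallel edges are allowed; the graph with two vertices joined by `n ≥ 1`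
edges is 2-connected. -/
structure TwoConnected (G : Graph α β) : Prop where
  loopless : G.Loopless
  nontrivial : V(G).Nontrivial
  conn : G.IsConn
  conn_delete : ∀ x ∈ V(G), (G.deleteVerts {x}).IsConn

open Classical in
/-- The map identifying all the elements of `S` with one new point `none`. -/
noncomputable def collapse (S : Set α) (x : α) : Option α := if x ∈ S then none else some x

/-- `G / e`: delete the edge `e` and identify its two ends.
Edges parallel to `e` become loops. -/
noncomputable def contractEdge (G : Graph α β) (e : β) : Graph (Option α) β :=
  (G.deleteEdges {e}).map (collapse {x | G.Inc e x})

/-- The contraction of `E(S)` (the edges with both ends in `S`) in `G`, for a set `S` of vertices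
such that `G` restricted to `S` is connected: delete the edges in `E(S)` and identify the vertices
in `S`. -/
noncomputable def contractVerts (G : Graph α β) (S : Set α) : Graph (Option α) β :=
  (G.deleteEdges E(G.induce S)).map (collapse S)

/-- A good flat: a proper subset `S` of the vertices such that both the restriction of `G` to `S`
and the contraction of `E(S)` in `G` are 2-connected. -/
structure IsGoodFlat (G : Graph α β) (S : Set α) : Prop where
  ssubset : S ⊂ V(G)
  restrict : (G.induce S).TwoConnected
  contract : (G.contractVerts S).TwoConnected

/-- `w : E(G) → {1, δ - 1}` with `w e = 1` if `G \ e` is 2-connected and `w e = δ - 1` if `G / e` is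
2-connected. (Values of `w` outside `E(G)` are irrelevant.) -/
structure IsWeight (G : Graph α β) (δ : ℕ) (w : β → ℕ) : Prop where
  values : ∀ e ∈ E(G), w e = 1 ∨ w e = δ - 1
  of_delete : ∀ e ∈ E(G), (G.deleteEdges {e}).TwoConnected → w e = 1
  of_contract : ∀ e ∈ E(G), (G.contractEdge e).TwoConnected → w e = δ - 1

/-- The weight equalities `(♠)_δ`: `G` possesses a weight function `w` with
`w(E) = δ (|V| - 1)`, and `w(E(S)) + 1 = δ (|S| - 1)` for every good flat `S`. -/
def SatisfiesSpade (G : Graph α β) (δ : ℕ) : Prop :=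
  ∃ w : β → ℕ, G.IsWeight δ w ∧
    ∑ᶠ e ∈ E(G), w e = δ * (V(G).ncard - 1) ∧
    ∀ S : Set α, G.IsGoodFlat S → (∑ᶠ e ∈ E(G.induce S), w e) + 1 = δ * (S.ncard - 1)

/-- The edge `e` of `G` has weight `k`. -/
def EdgeHasWeight (G : Graph α β) (δ : ℕ) (e : β) (k : ℕ) : Prop :=
  ∃ w : β → ℕ, G.IsWeight δ w ∧ w e = k

/-- `G` is the `n`-cycle, for `n ≥ 1`. For `n = 2` this is two vertices joined by two edges. -/
def IsCycleOfLength (G : Graph α β) (n : ℕ) : Prop :=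
  ∃ (c : ZMod n → α) (d : ZMod n → β), c.Injective ∧ d.Injective ∧
    V(G) = Set.range c ∧ E(G) = Set.range d ∧ ∀ i, G.IsLink (d i) (c i) (c (i + 1))

/-- Isomorphism of multigraphs. -/
def IsIsomorphic {α' : Type u} {β' : Type v} (G : Graph α β) (H : Graph α' β') : Prop :=
  ∃ (f : V(G) ≃ V(H)) (g : E(G) ≃ E(H)), ∀ (e : E(G)) (x y : V(G)),
    G.IsLink e x y ↔ H.IsLink (g e) (f x) (f y)

/-- `G` arises by gluing `G₁` and `G₂` along their edges `e₁` and `e₂` and substituting the glued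
edge with `k` parallel edges. The ends of `e₁` and `e₂` are already identified here: `G₁` and `G₂`
have exactly those two vertices and no edges in common (every pair of multigraphs has isomorphic
copies in this position). -/
def IsGluing (G₁ G₂ : Graph α β) (e₁ e₂ : β) (k : ℕ) (G : Graph α β) : Prop :=
  ∃ (x₀ y₀ : α) (P : Set β),
    G₁.IsLink e₁ x₀ y₀ ∧ G₂.IsLink e₂ x₀ y₀ ∧
    V(G₁) ∩ V(G₂) = {x₀, y₀} ∧ Disjoint E(G₁) E(G₂) ∧
    P.encard = k ∧ Disjoint P (E(G₁) ∪ E(G₂)) ∧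
    V(G) = V(G₁) ∪ V(G₂) ∧
    ∀ e x y, G.IsLink e x y ↔
      (G₁.IsLink e x y ∧ e ≠ e₁) ∨ (G₂.IsLink e x y ∧ e ≠ e₂) ∨ (e ∈ P ∧ s(x, y) = s(x₀, y₀))

/-- The path construction: glue `G₁` and `G₂` along edges of weights `1` and `δ - 1`, and delete
the glued edge. -/
def IsPathCon (δ : ℕ) (G₁ G₂ G : Graph α β) : Prop :=
  G₁.TwoConnected ∧ G₂.TwoConnected ∧ ∃ e₁ e₂,
    G₁.EdgeHasWeight δ e₁ 1 ∧ G₂.EdgeHasWeight δ e₂ (δ - 1) ∧ IsGluing G₁ G₂ e₁ e₂ 0 G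

/-- The `δ`-construction: glue `G₁` and `G₂` along edges of weight `δ - 1`, and substitute the glued
edge with `δ - 2` parallel edges. -/
def IsDeltaCon (δ : ℕ) (G₁ G₂ G : Graph α β) : Prop :=
  G₁.TwoConnected ∧ G₂.TwoConnected ∧ ∃ e₁ e₂,
    G₁.EdgeHasWeight δ e₁ (δ - 1) ∧ G₂.EdgeHasWeight δ e₂ (δ - 1) ∧
      IsGluing G₁ G₂ e₁ e₂ (δ - 2) G

/-- The degree of a vertex, loops counting twice. -/
noncomputable def vertexDegree (G : Graph α β) (x : α) : ℕ :=
  (G.incidenceSet x).ncard + (G.loopSet x).ncard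

/-- The reverse construction: `G` has a path `p 0, p 1, …, p (δ - 1)` with the `δ - 1` edges
`q 0, …, q (δ - 2)`, all of whose interior vertices have degree `2`, and `G'` is obtained from `G`
by substituting this path with a single (new) edge `f`. -/
def IsReverseCon (δ : ℕ) (G G' : Graph α β) : Prop :=
  G.TwoConnected ∧ ∃ (p : ℕ → α) (q : ℕ → β) (f : β),
    Set.InjOn p (Set.Iic (δ - 1)) ∧
    (∀ i < δ - 1, G.IsLink (q i) (p i) (p (i + 1))) ∧
    (∀ i, 0 < i → i < δ - 1 → G.vertexDegree (p i) = 2) ∧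
    f ∉ E(G) ∧
    V(G') = V(G) \ p '' Set.Ioo 0 (δ - 1) ∧
    ∀ e x y, G'.IsLink e x y ↔
      (G.IsLink e x y ∧ e ∉ q '' Set.Iio (δ - 1)) ∨ (e = f ∧ s(x, y) = s(p 0, p (δ - 1)))

/-- The multigraphs, up to isomorphism, that can be obtained from `δ`-cycles by the path
construction, the `δ`-construction and the reverse construction. -/
inductive Obtainable (δ : ℕ) : {α : Type u} → {β : Type v} → Graph α β → Prop
  | cycle {α : Type u} {β : Type v} {G : Graph α β} : G.IsCycleOfLength δ → Obtainable δ G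
  | iso {α α' : Type u} {β β' : Type v} {G : Graph α β} {H : Graph α' β'} :
      Obtainable δ G → G.IsIsomorphic H → Obtainable δ H
  | pathCon {α : Type u} {β : Type v} {G₁ G₂ G : Graph α β} :
      Obtainable δ G₁ → Obtainable δ G₂ → IsPathCon δ G₁ G₂ G → Obtainable δ G
  | deltaCon {α : Type u} {β : Type v} {G₁ G₂ G : Graph α β} :
      Obtainable δ G₁ → Obtainable δ G₂ → IsDeltaCon δ G₁ G₂ G → Obtainable δ G
  | reverseCon {α : Type u} {β : Type v} {G G' : Graph α β} :
      Obtainable δ G → IsReverseCon δ G G' → Obtainable δ G'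

end Graph

/-!
Connectivity is handled through predicates that are constant on a set as soon as they are preserved
along its edges (`ConnOn`), which avoids walks. In these terms, for a 2-connected graph `G`, an edge
`e = xy` is contractible if and only if it has no parallels and `G - {x, y}` is connected, and `S`
is a good flat if and only if `S ⊂ V(G)` is 2-connected in `G` and `V(G) \ S` is connected.

The path construction is a 2-sum along edges of weights `1` and `δ - 1` (`IsTwoSum`), and the other
two constructions reduce to 2-sums. The `δ`-construction is a pair of 2-sums with a bond between
them, that is, with two vertices joined by `δ` edges of weight `1`; the reverse construction splits
off a `δ`-cycle, whose edges have weight `δ - 1`. Good flats, deletable edges and contractible edges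
of a 2-sum come from those of its summands, and since the two glued weights add up to `δ`, the
weight equalities of the summands give those of the 2-sum (`IsTwoSum.isSpadeWeight`).

Conversely, suppose that `e₁` is deletable in the left summand and `e₂` is contractible in the right
one. Then the left summand is a good flat of the 2-sum, its equality fixes the total weights on both
sides, and the equalities descend to both summands (`IsTwoSum.isWeakSpadeWeight`). What descends at
once is a weak form, in which the weight of an edge is only required to be justified by the edge
being deletable or contractible, and flats with at most one edge are ignored. The edges that are
both deletable and contractible are the obstacle: for the strong form they must not exist. The weak
form is nevertheless sufficient (`IsWeakSpadeWeight.exists_isSpadeWeight`), by decomposing the graph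
and gluing it together again.

The decomposition rests on a trichotomy (`IsWeakSpadeWeight.cycle_or_bond_or_reducing`): a graph
with the weak equalities is a `δ`-cycle, or a bond with `δ` edges, or it has a good flat with at
least two edges that is attached to the rest at two vertices only, and so it is a 2-sum as above. To
see this, suppose that there is no such flat, and that there are at least three vertices. If some
pair of vertices separates the graph, then every vertex has at most two neighbours and the graph is
a cycle. If none does, and there are at least four vertices, then `V(G) \ {v}` is a good flat for
every `v`, the edges at each vertex have total weight `δ + 1`, and counting all edges twice
contradicts the total weight.

So graphs with the weight equalities are obtained from `δ`-cycles by the path construction and from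
bonds with `δ` edges, and such a bond arises from two `δ`-cycles by the `δ`-construction and two
reverse constructions (`obtainable_of_bond`).

In the other direction, the class of 2-connected graphs that satisfy the weight equalities or are
the 2-cycle is closed under the three constructions (`Obtainable.isSpadeOrTwoCycle`). Only the
reverse construction needs another idea. Let `A` be a set of vertices that is attached to the rest
at two vertices, with connected complement. Splitting `A` at its separating vertices shows that the
weight of `A` is at most that of a good flat of the same size, with equality only if `A` is
2-connected (`IsSpadeWeight.le_of_attach`). The total weight of what remains after removing the
`δ`-cycle attains the bound, so the new edge is deletable and the equalities descend.
-/

namespace Graph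

variable {α : Type u} {β : Type v}

open Set

/-! ### Connectivity by closed predicates -/

/-- The vertices of `X` are connected inside `X`: `X` is nonempty, and a predicate that is
preserved along the edges with both ends in `X` is constant on `X`. -/
def ConnOn (G : Graph α β) (X : Set α) : Prop :=
  X.Nonempty ∧ ∀ P : α → Prop,
    (∀ e a b, G.IsLink e a b → a ∈ X → b ∈ X → P a → P b) → ∀ a ∈ X, ∀ b ∈ X, P a → P b

/-- The vertex set `X` has at least two elements, is connected in `G`, and has no separating
vertex. For a loopless `G` this says that `G` restricted to `X` is 2-connected. -/
structure TwoConnOn (G : Graph α β) (X : Set α) : Prop where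
  nontrivial : X.Nontrivial
  conn : G.ConnOn X
  conn_diff : ∀ x ∈ X, G.ConnOn (X \ {x})

lemma isConn_iff {G : Graph α β} : G.IsConn ↔ G.ConnOn V(G) := by
  refine and_congr_right fun _ ↦ ⟨fun h P hP a ha b hb hPa ↦ ?_, fun h a ha b hb ↦ ?_⟩
  · have := h a ha b hb
    induction this with
    | refl => exact hPa
    | @tail c d _ hcd ih =>
      obtain ⟨e, he⟩ := hcd
      exact hP e c d he he.left_mem he.right_mem (ih he.left_mem)
  · exact h (Relation.ReflTransGen G.Adj a) (fun e c d he _ _ hc ↦ hc.tail he.adj) a ha b hb .refl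

/-- Connectedness passes to a graph with at least as many adjacencies. -/
lemma ConnOn.mono {γ : Type*} {G : Graph α β} {H : Graph α γ} {X : Set α}
    (h : G.ConnOn X) (hGH : ∀ e a b, G.IsLink e a b → a ∈ X → b ∈ X → ∃ f, H.IsLink f a b) :
    H.ConnOn X :=
  ⟨h.1, fun P hP ↦ h.2 P fun e a b he ha hb hPa ↦
    let ⟨f, hf⟩ := hGH e a b he ha hb
    hP f a b hf ha hb hPa⟩

lemma TwoConnOn.mono {γ : Type*} {G : Graph α β} {H : Graph α γ} {X : Set α}
    (h : G.TwoConnOn X) (hGH : ∀ e a b, G.IsLink e a b → a ∈ X → b ∈ X → ∃ f, H.IsLink f a b) :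
    H.TwoConnOn X :=
  ⟨h.1, h.2.mono hGH, fun x hx ↦ (h.3 x hx).mono fun e a b he ha hb ↦ hGH e a b he ha.1 hb.1⟩

lemma connOn_congr {γ : Type*} {G : Graph α β} {H : Graph α γ} {X : Set α}
    (h : ∀ a ∈ X, ∀ b ∈ X, G.Adj a b ↔ H.Adj a b) : G.ConnOn X ↔ H.ConnOn X :=
  ⟨fun hG ↦ hG.mono fun _ a b he ha hb ↦ (h a ha b hb).1 he.adj,
    fun hG ↦ hG.mono fun _ a b he ha hb ↦ (h a ha b hb).2 he.adj⟩

lemma twoConnOn_congr {γ : Type*} {G : Graph α β} {H : Graph α γ} {X : Set α}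
    (h : ∀ a ∈ X, ∀ b ∈ X, G.Adj a b ↔ H.Adj a b) : G.TwoConnOn X ↔ H.TwoConnOn X :=
  ⟨fun hG ↦ hG.mono fun _ a b he ha hb ↦ (h a ha b hb).1 he.adj,
    fun hG ↦ hG.mono fun _ a b he ha hb ↦ (h a ha b hb).2 he.adj⟩

/-- A predicate closed along edges is closed in both directions. -/
lemma ConnOn.iff {G : Graph α β} {X : Set α} (h : G.ConnOn X) {P : α → Prop}
    (hP : ∀ e a b, G.IsLink e a b → a ∈ X → b ∈ X → P a → P b) {a b : α} (ha : a ∈ X)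
    (hb : b ∈ X) : P a ↔ P b :=
  ⟨h.2 P hP a ha b hb, h.2 P hP b hb a ha⟩

lemma connOn_singleton (G : Graph α β) (x : α) : G.ConnOn {x} :=
  ⟨singleton_nonempty x, fun P _ a ha b hb h ↦ by
    rw [mem_singleton_iff] at ha hb; rwa [hb, ← ha]⟩

lemma exists_of_not_connOn {G : Graph α β} {X : Set α} (hX : X.Nonempty) (h : ¬ G.ConnOn X) :
    ∃ P : α → Prop, (∀ e a b, G.IsLink e a b → a ∈ X → b ∈ X → P a → P b) ∧
      (∃ a ∈ X, P a) ∧ ∃ b ∈ X, ¬ P b := by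
  by_contra! hc
  refine h ⟨hX, fun P hP a ha b hb hPa ↦ ?_⟩
  by_contra hPb
  exact hPb (hc P hP ⟨a, ha, hPa⟩ b hb)

lemma twoConnOn_pair {G : Graph α β} {x y : α} {e : β} (he : G.IsLink e x y) (hne : x ≠ y) :
    G.TwoConnOn {x, y} := by
  refine ⟨⟨x, by simp, y, by simp, hne⟩, ⟨⟨x, by simp⟩, ?_⟩, ?_⟩
  · rintro P hP a (rfl | rfl) b (rfl | rfl) h
    · exact h
    · exact hP e _ _ he (by simp) (by simp) h
    · exact hP e _ _ he.symm (by simp) (by simp) h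
    · exact h
  · rintro z (rfl | rfl)
    · convert G.connOn_singleton y using 1
      ext; simp; grind
    · convert G.connOn_singleton x using 1
      ext; simp; grind

/-- Every vertex of `X` lies in a connected component of `X`. -/
lemma exists_component (G : Graph α β) {X : Set α} {v : α} (hv : v ∈ X) :
    ∃ C ⊆ X, v ∈ C ∧ G.ConnOn C ∧ ∀ e a b, G.IsLink e a b → a ∈ C → b ∈ X → b ∈ C := by
  let R : α → α → Prop := fun a b ↦ G.Adj a b ∧ a ∈ X ∧ b ∈ X
  have key : ∀ P : α → Prop, ∀ u, Relation.ReflTransGen R v u →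
      (∀ e a b, G.IsLink e a b → Relation.ReflTransGen R v a → Relation.ReflTransGen R v b →
        P a → P b) → (P v ↔ P u) := by
    intro P u hu hP
    induction hu with
    | refl => rfl
    | @tail b c hb hbc ih =>
      obtain ⟨e, he⟩ := hbc.1
      exact ih.trans ⟨hP e b c he hb (hb.tail hbc), hP e c b he.symm (hb.tail hbc) hb⟩
  have hsub : {u | Relation.ReflTransGen R v u} ⊆ X := by
    intro u hu
    cases hu with
    | refl => exact hv
    | tail _ h => exact h.2.2
  refine ⟨{u | Relation.ReflTransGen R v u}, hsub, .refl, ⟨⟨v, .refl⟩, ?_⟩, ?_⟩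
  · intro P hP a ha b hb hPa
    exact (key P b hb hP).1 ((key P a ha hP).2 hPa)
  · intro e a b he ha hb
    exact ha.tail ⟨he.adj, hsub ha, hb⟩

/-! ### 2-connectedness of a graph and of its minors -/

lemma TwoConnected.ne {G : Graph α β} (hG : G.TwoConnected) {e : β} {x y : α}
    (h : G.IsLink e x y) : x ≠ y := by
  have := hG.loopless
  exact h.ne

lemma connOn_deleteVerts {G : Graph α β} {X Y : Set α} (hY : ∀ a ∈ Y, a ∉ X) :
    (G.deleteVerts X).ConnOn Y ↔ G.ConnOn Y :=
  connOn_congr fun a ha b hb ↦ by simp [Adj, hY a ha, hY b hb]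

lemma twoConnOn_induce {G : Graph α β} {X Y : Set α} (hY : Y ⊆ X) :
    (G.induce X).TwoConnOn Y ↔ G.TwoConnOn Y :=
  twoConnOn_congr fun a ha b hb ↦ by simp [Adj, hY ha, hY hb]

lemma twoConnected_iff {G : Graph α β} :
    G.TwoConnected ↔ (∀ e x y, G.IsLink e x y → x ≠ y) ∧ G.TwoConnOn V(G) := by
  constructor
  · refine fun h ↦ ⟨fun e x y ↦ h.ne, h.nontrivial, isConn_iff.1 h.conn, fun x hx ↦ ?_⟩
    have := isConn_iff.1 (h.conn_delete x hx)
    rwa [vertexSet_deleteVerts, connOn_deleteVerts (fun a ha ↦ ha.2)] at this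
  · refine fun h ↦ ⟨⟨fun e x hx ↦ h.1 e x x hx rfl⟩, h.2.nontrivial, isConn_iff.2 h.2.conn,
      fun x hx ↦ ?_⟩
    rw [isConn_iff, vertexSet_deleteVerts, connOn_deleteVerts (fun a ha ↦ ha.2)]
    exact h.2.conn_diff x hx

lemma TwoConnected.twoConnOn {G : Graph α β} (hG : G.TwoConnected) : G.TwoConnOn V(G) :=
  (twoConnected_iff.1 hG).2

lemma twoConnected_induce_iff {G : Graph α β} (hG : ∀ e x y, G.IsLink e x y → x ≠ y) {S : Set α} :
    (G.induce S).TwoConnected ↔ G.TwoConnOn S := by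
  rw [twoConnected_iff, vertexSet_induce, twoConnOn_induce subset_rfl]
  exact and_iff_right fun e x y h ↦ hG e x y h.1

/-- Contracting a set `S` of vertices, after deletion of a set `F` of edges inside `S`. -/
lemma twoConnected_map_collapse_iff {G : Graph α β} (hG : G.TwoConnected) {S : Set α} {F : Set β}
    (hS : S.Nonempty) (hSV : S ⊆ V(G))
    (hF : ∀ e a b, G.IsLink e a b → e ∈ F → a ∈ S ∧ b ∈ S) :
    ((G.deleteEdges F).map (collapse S)).TwoConnected ↔
      (∀ e a b, G.IsLink e a b → a ∈ S → b ∈ S → e ∈ F) ∧ G.ConnOn (V(G) \ S) := by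
  have c1 : ∀ a ∈ S, collapse S a = none := fun a ha ↦ by simp [collapse, ha]
  have c2 : ∀ a ∉ S, collapse S a = some a := fun a ha ↦ by simp [collapse, ha]
  obtain ⟨s, hs⟩ := hS
  have hlink : ∀ e a b, G.IsLink e a b → e ∉ F →
      ((G.deleteEdges F).map (collapse S)).IsLink e (collapse S a) (collapse S b) :=
    fun e a b h he ↦ IsLink.map _ (by simp [h, he])
  have hV : V((G.deleteEdges F).map (collapse S)) = collapse S '' V(G) := rfl
  rw [twoConnected_iff, hV]
  constructor
  · rintro ⟨h1, h2⟩
    refine ⟨fun e a b h ha hb ↦ ?_, ?_⟩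
    · by_contra he
      exact h1 _ _ _ (hlink e a b h he) (by rw [c1 a ha, c1 b hb])
    · have h3 := h2.conn_diff none ⟨s, hSV hs, c1 s hs⟩
      refine ⟨?_, fun P hP a ha b hb hPa ↦ ?_⟩
      · obtain ⟨_, ⟨v, hv, rfl⟩, hv2⟩ := h3.1
        refine ⟨v, hv, fun hvS ↦ hv2 (c1 v hvS)⟩
      · have := h3.2 (fun o ↦ ∀ a, o = some a → P a) ?_ (some a) ⟨⟨a, ha.1, c2 a ha.2⟩, by simp⟩
          (some b) ⟨⟨b, hb.1, c2 b hb.2⟩, by simp⟩ (by simpa using hPa)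
        · exact this b rfl
        · rintro e _ _ ⟨u, v, huv, rfl, rfl⟩ ⟨-, hu⟩ ⟨-, hv⟩ h w hw
          have huS : u ∉ S := fun h ↦ hu (c1 u h)
          have hvS : v ∉ S := fun h ↦ hv (c1 v h)
          rw [c2 u huS] at h
          rw [c2 v hvS] at hw
          obtain rfl : v = w := by simpa using hw
          rw [deleteEdges_isLink] at huv
          exact hP e u v huv.1 ⟨huv.1.left_mem, huS⟩ ⟨huv.1.right_mem, hvS⟩ (h u rfl)
  · rintro ⟨h1, h2⟩
    obtain ⟨v, hv, hvS⟩ := h2.1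
    -- A closed predicate on the contraction pulls back to a closed predicate on `G`.
    have pull : ∀ (P : Option α → Prop) (X : Set α),
        (∀ e a b, ((G.deleteEdges F).map (collapse S)).IsLink e a b → a ∈ collapse S '' X →
          b ∈ collapse S '' X → P a → P b) →
        ∀ e a b, G.IsLink e a b → a ∈ X → b ∈ X → P (collapse S a) → P (collapse S b) := by
      intro P X hP e a b h ha hb hPa
      by_cases he : e ∈ F
      · obtain ⟨h1, h2⟩ := hF e a b h he
        rwa [c1 b h2, ← c1 a h1]
      · exact hP e _ _ (hlink e a b h he) ⟨a, ha, rfl⟩ ⟨b, hb, rfl⟩ hPa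
    have push : ∀ X : Set α, G.ConnOn X →
        ((G.deleteEdges F).map (collapse S)).ConnOn (collapse S '' X) := by
      rintro X ⟨⟨x, hx⟩, hX⟩
      refine ⟨⟨_, x, hx, rfl⟩, ?_⟩
      rintro P hP _ ⟨a, ha, rfl⟩ _ ⟨b, hb, rfl⟩
      exact hX (fun a ↦ P (collapse S a)) (pull P X hP) a ha b hb
    refine ⟨?_, ⟨none, ⟨s, hSV hs, c1 s hs⟩, some v, ⟨v, hv, c2 v hvS⟩, by simp⟩,
      push _ hG.twoConnOn.conn, ?_⟩
    · rintro e _ _ ⟨a, b, hab, rfl, rfl⟩ heq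
      rw [deleteEdges_isLink] at hab
      by_cases ha : a ∈ S <;> by_cases hb : b ∈ S
      · exact hab.2 (h1 e a b hab.1 ha hb)
      · simp [c1 a ha, c2 b hb] at heq
      · simp [c2 a ha, c1 b hb] at heq
      · rw [c2 a ha, c2 b hb, Option.some_inj] at heq
        exact hG.ne hab.1 heq
    · rintro _ ⟨x, hx, rfl⟩
      by_cases hxS : x ∈ S
      · convert push _ h2 using 1
        ext o
        simp only [mem_sdiff, mem_image, mem_singleton_iff, c1 x hxS]
        constructor
        · rintro ⟨⟨a, ha, rfl⟩, h⟩
          exact ⟨a, ⟨ha, fun h' ↦ h (c1 a h')⟩, rfl⟩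
        · rintro ⟨a, ⟨ha, ha'⟩, rfl⟩
          exact ⟨⟨a, ha, rfl⟩, by simp [c2 a ha']⟩
      · convert push _ (hG.twoConnOn.conn_diff x hx) using 1
        ext o
        simp only [mem_sdiff, mem_image, mem_singleton_iff, c2 x hxS]
        constructor
        · rintro ⟨⟨a, ha, rfl⟩, h⟩
          exact ⟨a, ⟨ha, fun h' ↦ h (h' ▸ c2 x hxS)⟩, rfl⟩
        · rintro ⟨a, ⟨ha, ha'⟩, rfl⟩
          refine ⟨⟨a, ha, rfl⟩, fun h ↦ ha' ?_⟩
          by_cases haS : a ∈ S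
          · simp [c1 a haS] at h
          · simpa [c2 a haS] using h

lemma contractEdge_twoConnected_iff {G : Graph α β} (hG : G.TwoConnected) {e : β} {x y : α}
    (he : G.IsLink e x y) : (G.contractEdge e).TwoConnected ↔
      (∀ f, G.IsLink f x y → f = e) ∧ G.ConnOn (V(G) \ {x, y}) := by
  have hS : {z | G.Inc e z} = {x, y} := by
    ext z
    simp only [mem_ofPred_eq, mem_insert_iff, mem_singleton_iff]
    refine ⟨fun h ↦ h.eq_or_eq_of_isLink he, ?_⟩
    rintro (rfl | rfl)
    exacts [he.inc_left, he.inc_right]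
  rw [contractEdge, hS, twoConnected_map_collapse_iff hG (by simp)]
  · refine and_congr_left fun _ ↦ ⟨fun h f hf ↦ h f x y hf (by simp) (by simp), ?_⟩
    rintro h f a b hf (rfl | rfl) (rfl | rfl)
    · exact absurd rfl (hG.ne hf)
    · exact h f hf
    · exact h f hf.symm
    · exact absurd rfl (hG.ne hf)
  · rintro z (rfl | rfl)
    exacts [he.left_mem, he.right_mem]
  · rintro f a b hf rfl
    exact ⟨hf.left_eq_or_eq he, hf.right_eq_or_eq he⟩

lemma isGoodFlat_iff {G : Graph α β} (hG : G.TwoConnected) {S : Set α} :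
    G.IsGoodFlat S ↔ S ⊂ V(G) ∧ G.TwoConnOn S ∧ G.ConnOn (V(G) \ S) := by
  have key : S ⊂ V(G) → S.Nonempty →
      ((G.contractVerts S).TwoConnected ↔ G.ConnOn (V(G) \ S)) := by
    intro h1 h2
    rw [contractVerts, twoConnected_map_collapse_iff hG h2 h1.subset]
    · exact and_iff_right fun e a b h ha hb ↦ ⟨a, b, h, ha, hb⟩
    · rintro e a b h ⟨c, d, hcd, hc, hd⟩
      obtain ⟨rfl, rfl⟩ | ⟨rfl, rfl⟩ := h.eq_and_eq_or_eq_and_eq hcd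
      exacts [⟨hc, hd⟩, ⟨hd, hc⟩]
  constructor
  · rintro ⟨h1, h2, h3⟩
    rw [twoConnected_induce_iff fun e x y ↦ hG.ne] at h2
    exact ⟨h1, h2, (key h1 h2.nontrivial.nonempty).1 h3⟩
  · rintro ⟨h1, h2, h3⟩
    exact ⟨h1, (twoConnected_induce_iff fun e x y ↦ hG.ne).2 h2,
      (key h1 h2.nontrivial.nonempty).2 h3⟩

lemma deleteEdges_twoConnected_iff {G : Graph α β} (hG : G.TwoConnected) {F : Set β} :
    (G.deleteEdges F).TwoConnected ↔ (G.deleteEdges F).TwoConnOn V(G) := by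
  rw [twoConnected_iff]
  exact and_iff_right fun e x y h ↦ hG.ne h.1

/-! ### Vertex sets attached at two vertices -/

/-- If the edges leaving `A` all leave from `x` or `y`, then a predicate closed on the part of a
connected set `Y` in `A` is constant there, as soon as it takes the same value at `x` and `y`:
extend it to the part of `Y` outside `A` by this value. -/
lemma ConnOn.const_of_attach {G : Graph α β} {Y A : Set α} {x y : α} (h : G.ConnOn Y)
    (hx : x ∈ A) (hy : y ∈ A)
    (hatt : ∀ e a b, G.IsLink e a b → a ∈ A → b ∉ A → a = x ∨ a = y)
    (hxy : x ∈ Y ∨ y ∈ Y) {P : α → Prop}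
    (hP : ∀ e a b, G.IsLink e a b → a ∈ Y ∩ A → b ∈ Y ∩ A → P a → P b)
    (hPxy : x ∈ Y → y ∈ Y → (P x ↔ P y)) : ∀ a ∈ Y ∩ A, ∀ b ∈ Y ∩ A, P a → P b := by
  obtain ⟨t, htY, htA, ht⟩ : ∃ t ∈ Y, t ∈ A ∧ ∀ s ∈ Y, s = x ∨ s = y → (P s ↔ P t) := by
    rcases hxy with hx' | hy'
    · refine ⟨x, hx', hx, ?_⟩
      rintro s hs (rfl | rfl)
      exacts [Iff.rfl, (hPxy hx' hs).symm]
    · refine ⟨y, hy', hy, ?_⟩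
      rintro s hs (rfl | rfl)
      exacts [hPxy hs hy', Iff.rfl]
  intro a ha b hb hPa
  have := h.2 (fun c ↦ (c ∈ A → P c) ∧ (c ∉ A → P t)) ?_ a ha.1 b hb.1
    ⟨fun _ ↦ hPa, fun h' ↦ absurd ha.2 h'⟩
  · exact this.1 hb.2
  · rintro e c d he hc hd ⟨h1, h2⟩
    by_cases hcA : c ∈ A <;> by_cases hdA : d ∈ A
    · exact ⟨fun _ ↦ hP e c d he ⟨hc, hcA⟩ ⟨hd, hdA⟩ (h1 hcA), fun h' ↦ absurd hdA h'⟩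
    · exact ⟨fun h' ↦ absurd h' hdA, fun _ ↦ (ht c hc (hatt e c d he hcA hdA)).1 (h1 hcA)⟩
    · exact ⟨fun _ ↦ (ht d hd (hatt e d c he.symm hdA hcA)).2 (h2 hcA), fun h' ↦ absurd hdA h'⟩
    · exact ⟨fun h' ↦ absurd h' hdA, fun _ ↦ h2 hcA⟩

/-- If the edges leaving `A` all leave from `x` or `y`, then replacing the outside of `A` by an edge
joining `x` and `y` preserves connectedness. -/
lemma ConnOn.inter_of_attach {γ : Type*} {G : Graph α β} {H : Graph α γ} {Y A : Set α} {x y : α}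
    (h : G.ConnOn Y) (hx : x ∈ A) (hy : y ∈ A)
    (hatt : ∀ e a b, G.IsLink e a b → a ∈ A → b ∉ A → a = x ∨ a = y)
    (hxy : x ∈ Y ∨ y ∈ Y)
    (hGH : ∀ e a b, G.IsLink e a b → a ∈ A → b ∈ A → ∃ f, H.IsLink f a b)
    (hH : ∃ f, H.IsLink f x y) : H.ConnOn (Y ∩ A) := by
  refine ⟨?_, fun P hP ↦ h.const_of_attach hx hy hatt hxy (fun e a b he ha hb ↦ ?_) ?_⟩
  · rcases hxy with h' | h'
    exacts [⟨x, h', hx⟩, ⟨y, h', hy⟩]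
  · obtain ⟨f, hf⟩ := hGH e a b he ha.2 hb.2
    exact hP f a b hf ha hb
  · obtain ⟨f, hf⟩ := hH
    exact fun hx' hy' ↦ ⟨hP f x y hf ⟨hx', hx⟩ ⟨hy', hy⟩, hP f y x hf.symm ⟨hy', hy⟩ ⟨hx', hx⟩⟩

lemma TwoConnOn.inter_of_attach {γ : Type*} {G : Graph α β} {H : Graph α γ} {Y A : Set α} {x y : α}
    (h : G.TwoConnOn Y) (hx : x ∈ A) (hy : y ∈ A) (hne : x ≠ y) (hxY : x ∈ Y) (hyY : y ∈ Y)
    (hatt : ∀ e a b, G.IsLink e a b → a ∈ A → b ∉ A → a = x ∨ a = y)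
    (hGH : ∀ e a b, G.IsLink e a b → a ∈ A → b ∈ A → ∃ f, H.IsLink f a b)
    (hH : ∃ f, H.IsLink f x y) : H.TwoConnOn (Y ∩ A) := by
  refine ⟨⟨x, ⟨hxY, hx⟩, y, ⟨hyY, hy⟩, hne⟩,
    h.conn.inter_of_attach hx hy hatt (.inl hxY) hGH hH, fun z hz ↦ ?_⟩
  rw [inter_sdiff_right_comm]
  refine (h.conn_diff z hz.1).inter_of_attach hx hy hatt ?_ hGH hH
  by_cases hxz : x = z
  · exact .inr ⟨hyY, fun h' ↦ hne (hxz.trans h'.symm)⟩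
  · exact .inl ⟨hxY, hxz⟩

/-- A nonempty set `C` of vertices all of whose neighbours outside `C` are `x` and `y` joins `x` to
`y` in a 2-connected graph: a predicate preserved along the edges meeting `C` takes the same value
at `x` and `y`. Otherwise `x` or `y` would separate a part of `C` from the rest. -/
lemma TwoConnected.iff_of_closed {G : Graph α β} (hG : G.TwoConnected) {C : Set α} {x y : α}
    (hC : C.Nonempty) (hCV : C ⊆ V(G)) (hx : x ∈ V(G)) (hy : y ∈ V(G)) (hxC : x ∉ C) (hyC : y ∉ C)
    (hcl : ∀ e a b, G.IsLink e a b → a ∈ C → b ∉ C → b = x ∨ b = y) {P : α → Prop}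
    (hP : ∀ e a b, G.IsLink e a b → a ∈ C → (P a ↔ P b)) : P x ↔ P y := by
  have key : ∀ (Q : α → Prop) (x y : α), x ∈ V(G) → y ∈ V(G) → x ∉ C → y ∉ C →
      (∀ e a b, G.IsLink e a b → a ∈ C → b ∉ C → b = x ∨ b = y) →
      (∀ e a b, G.IsLink e a b → a ∈ C → (Q a ↔ Q b)) → (∃ c ∈ C, Q c) → ¬ Q y → x ≠ y →
      False := by
    rintro Q x y hx hy hxC hyC hcl hQ ⟨c, hc, hQc⟩ hQy hne
    have := (hG.twoConnOn.conn_diff x hx).2 (fun a ↦ a ∈ C ∧ Q a) ?_ c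
      ⟨hCV hc, fun h ↦ hxC (h ▸ hc)⟩ y ⟨hy, hne.symm⟩ ⟨hc, hQc⟩
    · exact hyC this.1
    · rintro e a b he ha hb ⟨haC, hQa⟩
      have hQb := (hQ e a b he haC).1 hQa
      refine ⟨?_, hQb⟩
      by_contra hbC
      rcases hcl e a b he haC hbC with rfl | rfl
      exacts [hb.2 rfl, hQy hQb]
  obtain ⟨c, hc⟩ := hC
  by_cases hne : x = y
  · rw [hne]
  have hcl' : ∀ e a b, G.IsLink e a b → a ∈ C → b ∉ C → b = y ∨ b = x :=
    fun e a b he ha hb ↦ (hcl e a b he ha hb).symm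
  have hP' : ∀ e a b, G.IsLink e a b → a ∈ C → (¬ P a ↔ ¬ P b) :=
    fun e a b he ha ↦ not_congr (hP e a b he ha)
  by_cases hPc : P c
  · have h1 : P y := by
      by_contra h
      exact key P x y hx hy hxC hyC hcl hP ⟨c, hc, hPc⟩ h hne
    have h2 : P x := by
      by_contra h
      exact key P y x hy hx hyC hxC hcl' hP ⟨c, hc, hPc⟩ h (Ne.symm hne)
    exact iff_of_true h2 h1
  · have h1 : ¬ P y := by
      intro h
      exact key (fun a ↦ ¬ P a) x y hx hy hxC hyC hcl hP' ⟨c, hc, hPc⟩ (not_not.2 h) hne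
    have h2 : ¬ P x := by
      intro h
      exact key (fun a ↦ ¬ P a) y x hy hx hyC hxC hcl' hP' ⟨c, hc, hPc⟩ (not_not.2 h) (Ne.symm hne)
    exact iff_of_false h2 h1

/-- An edge that does not join `x` and `y` has another end. -/
lemma exists_vertex_of_not_parallel {G : Graph α β} (hG : G.TwoConnected) {f : β}
    {x y : α} (hf : f ∈ E(G)) (hxy : ¬ G.IsLink f x y) : (V(G) \ {x, y}).Nonempty := by
  obtain ⟨a, b, hab⟩ := exists_isLink_of_mem_edgeSet hf
  by_contra h
  rw [not_nonempty_iff_eq_empty, sdiff_eq_empty] at h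
  have h1 := h hab.left_mem
  have h2 := h hab.right_mem
  rcases h1 with rfl | rfl <;> rcases h2 with rfl | rfl
  · exact hG.ne hab rfl
  · exact hxy hab
  · exact hxy hab.symm
  · exact hG.ne hab rfl

/-- A 2-connected graph with at least two edges has no bridge. -/
lemma TwoConnected.connOn_deleteEdges {G : Graph α β} (hG : G.TwoConnected) {e f : β}
    (hf : f ∈ E(G)) (hfe : f ≠ e) : (G.deleteEdges {e}).ConnOn V(G) := by
  refine ⟨hG.nontrivial.nonempty, fun P hP ↦ hG.twoConnOn.conn.2 P ?_⟩
  intro e' a b he' ha hb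
  by_cases hee : e' = e
  swap
  · exact hP e' a b ⟨he', hee⟩ ha hb
  subst hee
  by_cases hfab : G.IsLink f a b
  · exact hP f a b ⟨hfab, hfe⟩ ha hb
  refine (hG.iff_of_closed (C := V(G) \ {a, b}) (exists_vertex_of_not_parallel hG hf hfab)
    sdiff_subset ha hb (by simp) (by simp) ?_ ?_).1
  · intro g c d hg hc hd
    simp only [mem_sdiff, mem_insert_iff, mem_singleton_iff, not_and, not_not] at hd
    exact hd hg.right_mem
  · intro g c d hg hc
    have hne : g ≠ e' := by
      rintro rfl
      exact hc.2 (hg.left_eq_or_eq he')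
    exact ⟨hP g c d ⟨hg, hne⟩ hg.left_mem hg.right_mem,
      hP g d c ⟨hg.symm, hne⟩ hg.right_mem hg.left_mem⟩

/-- In a 2-connected graph with at least two edges, every edge can be deleted or contracted. -/
lemma TwoConnected.delete_or_contract {G : Graph α β} (hG : G.TwoConnected) {e f : β}
    (he : e ∈ E(G)) (hf : f ∈ E(G)) (hfe : f ≠ e) :
    (G.deleteEdges {e}).TwoConnected ∨ (G.contractEdge e).TwoConnected := by
  obtain ⟨x, y, hxy⟩ := exists_isLink_of_mem_edgeSet he
  rw [contractEdge_twoConnected_iff hG hxy, deleteEdges_twoConnected_iff hG, or_iff_not_imp_right]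
  intro hcon
  by_cases hpar : ∃ g, G.IsLink g x y ∧ g ≠ e
  · obtain ⟨g, hg, hge⟩ := hpar
    refine hG.twoConnOn.mono fun e' a b he' _ _ ↦ ?_
    by_cases hee : e' = e
    · subst hee
      obtain ⟨rfl, rfl⟩ | ⟨rfl, rfl⟩ := he'.eq_and_eq_or_eq_and_eq hxy
      exacts [⟨g, hg, hge⟩, ⟨g, hg.symm, hge⟩]
    · exact ⟨e', he', hee⟩
  push Not at hpar
  have hcon' : ¬ G.ConnOn (V(G) \ {x, y}) := fun h ↦ hcon ⟨hpar, h⟩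
  obtain ⟨P, hP, ⟨a, ha, hPa⟩, b, hb, hPb⟩ := exists_of_not_connOn
    (exists_vertex_of_not_parallel hG hf fun h ↦ hfe (hpar f h)) hcon'
  refine ⟨hG.nontrivial, hG.connOn_deleteEdges hf hfe, fun z hz ↦ ?_⟩
  by_cases hzxy : z = x ∨ z = y
  · refine (hG.twoConnOn.conn_diff z hz).mono fun e' c d he' hc hd ↦ ⟨e', he', ?_⟩
    rintro rfl
    obtain ⟨rfl, rfl⟩ | ⟨rfl, rfl⟩ := he'.eq_and_eq_or_eq_and_eq hxy
    · rcases hzxy with rfl | rfl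
      exacts [hc.2 rfl, hd.2 rfl]
    · rcases hzxy with rfl | rfl
      exacts [hd.2 rfl, hc.2 rfl]
  push Not at hzxy
  refine ⟨⟨x, hxy.left_mem, Ne.symm hzxy.1⟩, fun Q hQ ↦ (hG.twoConnOn.conn_diff z hz).2 Q ?_⟩
  have hQxy : Q x ↔ Q y := by
    -- Of the two sides of `{x, y}`, one avoids `z`.
    have key : ∀ (R : α → Prop) (c : α), c ∈ V(G) \ {x, y} → R c → ¬ R z →
        (∀ e a b, G.IsLink e a b → a ∈ V(G) \ {x, y} → b ∈ V(G) \ {x, y} → R a → R b) →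
        (Q x ↔ Q y) := by
      intro R c hc hRc hRz hR
      refine hG.iff_of_closed (C := {a | a ∈ V(G) \ {x, y} ∧ R a}) ⟨c, hc, hRc⟩
        (fun a ha ↦ ha.1.1) hxy.left_mem hxy.right_mem (fun h ↦ h.1.2 (by simp))
        (fun h ↦ h.1.2 (by simp)) ?_ ?_
      · intro g c d hg hc hd
        by_contra hd'
        exact hd ⟨⟨hg.right_mem, hd'⟩, hR g c d hg hc.1 ⟨hg.right_mem, hd'⟩ hc.2⟩
      · intro g c d hg hc
        have hne : g ≠ e := by
          rintro rfl
          exact hc.1.2 (hg.left_eq_or_eq hxy)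
        have hcz : c ≠ z := by
          rintro rfl
          exact hRz hc.2
        have hdz : d ≠ z := by
          rintro rfl
          exact hRz (hR g c d hg hc.1 ⟨hg.right_mem, by simp [hzxy]⟩ hc.2)
        exact ⟨hQ g c d ⟨hg, hne⟩ ⟨hg.left_mem, hcz⟩ ⟨hg.right_mem, hdz⟩,
          hQ g d c ⟨hg.symm, hne⟩ ⟨hg.right_mem, hdz⟩ ⟨hg.left_mem, hcz⟩⟩
    by_cases hPz : P z
    · exact key (fun a ↦ ¬ P a) b hb hPb (not_not.2 hPz)
        (fun e a b he ha hb hPa hPb ↦ hPa (hP e b a he.symm hb ha hPb))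
    · exact key P a ha hPa hPz hP
  intro e' a b he' ha hb
  by_cases hee : e' = e
  · subst hee
    obtain ⟨rfl, rfl⟩ | ⟨rfl, rfl⟩ := he'.eq_and_eq_or_eq_and_eq hxy
    exacts [hQxy.1, hQxy.2]
  · exact hQ e' a b ⟨he', hee⟩ ha hb

/-- In a 2-connected graph with a third vertex, every vertex has two neighbours. -/
lemma TwoConnected.exists_isLink_ne {G : Graph α β} (hG : G.TwoConnected) {v a c : α}
    (hv : v ∈ V(G)) (hc : c ∈ V(G)) (hcv : c ≠ v) (hca : c ≠ a) :
    ∃ e u, G.IsLink e v u ∧ u ≠ a := by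
  by_contra! h
  by_cases hva : v = a
  · subst hva
    have := hG.twoConnOn.conn.2 (fun w ↦ w = v) ?_ v hv c hc rfl
    · exact hca this
    · rintro e u w he _ _ rfl
      exact h e w he
  have hconn : G.ConnOn (V(G) \ {a}) := by
    by_cases ha : a ∈ V(G)
    · exact hG.twoConnOn.conn_diff a ha
    · rw [sdiff_singleton_eq_self ha]
      exact hG.twoConnOn.conn
  have := hconn.2 (fun w ↦ w = v) ?_ v ⟨hv, hva⟩ c ⟨hc, hca⟩ rfl
  · exact hcv this
  · rintro e u w he _ hw rfl
    exact absurd (h e w he) hw.2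

/-! ### 2-sums -/

/-- `G` is loopless and is the 2-sum of `G₁` and `G₂` along `e₁` and `e₂`, both with ends `x` and
`y`: the two edges are identified and deleted. Only the edges that survive in `G` are required to be
distinct, so `e₁` and `e₂` may be equal, and each may be used as a label on the other side. -/
structure IsTwoSum (G₁ G₂ : Graph α β) (e₁ e₂ : β) (x y : α) (G : Graph α β) : Prop where
  ne : x ≠ y
  link₁ : G₁.IsLink e₁ x y
  link₂ : G₂.IsLink e₂ x y
  inter : V(G₁) ∩ V(G₂) = {x, y}
  disj : ∀ e ∈ E(G₁), e ≠ e₁ → e ∈ E(G₂) → e = e₂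
  verts : V(G) = V(G₁) ∪ V(G₂)
  isLink : ∀ e a b, G.IsLink e a b ↔ (G₁.IsLink e a b ∧ e ≠ e₁) ∨ (G₂.IsLink e a b ∧ e ≠ e₂)
  loopless : ∀ e a b, G.IsLink e a b → a ≠ b

namespace IsTwoSum

variable {G₁ G₂ G : Graph α β} {e₁ e₂ : β} {x y : α}

lemma symm (h : IsTwoSum G₁ G₂ e₁ e₂ x y G) : IsTwoSum G₂ G₁ e₂ e₁ x y G where
  ne := h.ne
  link₁ := h.link₂
  link₂ := h.link₁
  inter := inter_comm _ _ ▸ h.inter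
  disj e he hne he' := by
    by_contra h'
    exact hne (h.disj e he' h' he)
  verts := union_comm _ _ ▸ h.verts
  isLink e a b := (h.isLink e a b).trans or_comm
  loopless := h.loopless

/-- Graphs in the right position have a 2-sum. -/
lemma _root_.Graph.TwoConnected.exists_isTwoSum (hG₁ : G₁.TwoConnected) (hG₂ : G₂.TwoConnected)
    (link₁ : G₁.IsLink e₁ x y) (link₂ : G₂.IsLink e₂ x y) (inter : V(G₁) ∩ V(G₂) = {x, y})
    (disj : ∀ e ∈ E(G₁), e ≠ e₁ → e ∈ E(G₂) → e = e₂) :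
    ∃ G : Graph α β, IsTwoSum G₁ G₂ e₁ e₂ x y G := by
  refine ⟨{ vertexSet := V(G₁) ∪ V(G₂)
            IsLink := fun e a b ↦ (G₁.IsLink e a b ∧ e ≠ e₁) ∨ (G₂.IsLink e a b ∧ e ≠ e₂)
            isLink_symm := fun e _ ↦ ⟨fun a b h ↦ h.imp (And.imp_left fun h ↦ h.symm)
              (And.imp_left fun h ↦ h.symm)⟩
            eq_or_eq_of_isLink_of_isLink := ?_
            left_mem_of_isLink := fun e a b h ↦ h.imp (fun h ↦ h.1.left_mem) fun h ↦ h.1.left_mem },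
    hG₁.ne link₁, link₁, link₂, inter, disj, rfl, fun e a b ↦ Iff.rfl, ?_⟩
  · rintro e a b c d (h | h) (h' | h')
    · exact h.1.left_eq_or_eq h'.1
    · exact absurd (disj e h.1.edge_mem h.2 h'.1.edge_mem) h'.2
    · exact absurd (disj e h'.1.edge_mem h'.2 h.1.edge_mem) h.2
    · exact h.1.left_eq_or_eq h'.1
  · rintro e a b (h | h)
    exacts [hG₁.ne h.1, hG₂.ne h.1]

lemma eq_or_eq (h : IsTwoSum G₁ G₂ e₁ e₂ x y G) {a : α} (h1 : a ∈ V(G₁)) (h2 : a ∈ V(G₂)) :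
    a = x ∨ a = y := by
  have : a ∈ V(G₁) ∩ V(G₂) := ⟨h1, h2⟩
  rwa [h.inter] at this

lemma subset_left (h : IsTwoSum G₁ G₂ e₁ e₂ x y G) : V(G₁) ⊆ V(G) :=
  h.verts ▸ subset_union_left

lemma loopless_left (h : IsTwoSum G₁ G₂ e₁ e₂ x y G) {e : β} {a b : α} (he : G₁.IsLink e a b) :
    a ≠ b := by
  by_cases hee : e = e₁
  · subst hee
    obtain ⟨rfl, rfl⟩ | ⟨rfl, rfl⟩ := he.eq_and_eq_or_eq_and_eq h.link₁
    exacts [h.ne, h.ne.symm]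
  · exact h.loopless e a b ((h.isLink e a b).2 (.inl ⟨he, hee⟩))

lemma of_left (h : IsTwoSum G₁ G₂ e₁ e₂ x y G) {e : β} {a b : α} (he : G₁.IsLink e a b)
    (hne : e ≠ e₁) : G.IsLink e a b :=
  (h.isLink e a b).2 (.inl ⟨he, hne⟩)

/-- An edge of the left summand other than `e₁` keeps its ends. -/
lemma isLink_iff_left (h : IsTwoSum G₁ G₂ e₁ e₂ x y G) {e : β} (he : e ∈ E(G₁)) (hne : e ≠ e₁)
    {a b : α} : G.IsLink e a b ↔ G₁.IsLink e a b := by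
  rw [h.isLink]
  constructor
  · rintro (h' | h')
    · exact h'.1
    · exact absurd (h.disj e he hne h'.1.edge_mem) h'.2
  · exact fun h' ↦ .inl ⟨h', hne⟩

lemma attach (h : IsTwoSum G₁ G₂ e₁ e₂ x y G) (e : β) (a b : α) (he : G.IsLink e a b)
    (ha : a ∈ V(G₁)) (hb : b ∉ V(G₁)) : a = x ∨ a = y := by
  rcases (h.isLink e a b).1 he with h' | h'
  · exact absurd h'.1.right_mem hb
  · exact h.eq_or_eq ha h'.1.left_mem

lemma exists_left (h : IsTwoSum G₁ G₂ e₁ e₂ x y G) (e : β) (a b : α) (he : G.IsLink e a b)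
    (ha : a ∈ V(G₁)) (hb : b ∈ V(G₁)) : ∃ f, G₁.IsLink f a b := by
  rcases (h.isLink e a b).1 he with h' | h'
  · exact ⟨e, h'.1⟩
  · have hne := h.loopless e a b he
    rcases h.eq_or_eq ha h'.1.left_mem with rfl | rfl <;>
      rcases h.eq_or_eq hb h'.1.right_mem with rfl | rfl
    exacts [absurd rfl hne, ⟨e₁, h.link₁⟩, ⟨e₁, h.link₁.symm⟩, absurd rfl hne]

lemma edge_ne_of_notMem (h : IsTwoSum G₁ G₂ e₁ e₂ x y G) {S : Set α} (hS : ¬ (x ∈ S ∧ y ∈ S))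
    {e : β} {a b : α} (he : G₁.IsLink e a b) (ha : a ∈ S) (hb : b ∈ S) : e ≠ e₁ := by
  rintro rfl
  obtain ⟨rfl, rfl⟩ | ⟨rfl, rfl⟩ := he.eq_and_eq_or_eq_and_eq h.link₁
  exacts [hS ⟨ha, hb⟩, hS ⟨hb, ha⟩]

/-- A set of vertices on the left that does not contain both glued vertices spans the same edges
in the left summand and in the 2-sum. -/
lemma induce_left_eq (h : IsTwoSum G₁ G₂ e₁ e₂ x y G) {S : Set α} (hS : ¬ (x ∈ S ∧ y ∈ S))
    (hS1 : S ⊆ V(G₁)) : G.induce S = G₁.induce S := by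
  refine Graph.ext rfl fun e a b ↦ ?_
  simp only [induce_isLink, and_congr_left_iff, and_imp]
  intro ha hb
  rw [h.isLink]
  constructor
  · rintro (h' | h')
    · exact h'.1
    · have hne := h.loopless e a b ((h.isLink e a b).2 (.inr h'))
      rcases h.eq_or_eq (hS1 ha) h'.1.left_mem with rfl | rfl <;>
        rcases h.eq_or_eq (hS1 hb) h'.1.right_mem with rfl | rfl
      exacts [absurd rfl hne, absurd ⟨ha, hb⟩ hS, absurd ⟨hb, ha⟩ hS, absurd rfl hne]
  · exact fun h' ↦ .inl ⟨h', h.edge_ne_of_notMem hS h' ha hb⟩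

/-- The summands of a 2-connected 2-sum are 2-connected. -/
lemma twoConnected_left (h : IsTwoSum G₁ G₂ e₁ e₂ x y G) (hG : G.TwoConnected) :
    G₁.TwoConnected := by
  refine twoConnected_iff.2 ⟨fun e a b he ↦ h.loopless_left he, ?_⟩
  have := hG.twoConnOn.inter_of_attach (H := G₁) h.link₁.left_mem h.link₁.right_mem h.ne
    (h.subset_left h.link₁.left_mem) (h.subset_left h.link₁.right_mem) h.attach h.exists_left
    ⟨e₁, h.link₁⟩
  rwa [inter_eq_right.2 h.subset_left] at this

/-- If `Y` is connected in the left summand and contains one of the glued vertices, then `Y`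
together with the inner vertices of the right summand is connected in the 2-sum. -/
lemma connOn_union (h : IsTwoSum G₁ G₂ e₁ e₂ x y G) (hG₂ : G₂.TwoConnected) {f : β}
    (hf : f ∈ E(G₂)) (hfe : f ≠ e₂) {Y : Set α} (hY : G₁.ConnOn Y)
    (hxy : x ∈ Y ∨ y ∈ Y) : G.ConnOn (Y ∪ (V(G₂) \ {x, y})) := by
  refine ⟨hY.1.mono subset_union_left, fun P hP ↦ ?_⟩
  -- `P` is constant on the part of the right summand in question.
  have h2 : ∃ t ∈ Y, ∀ a ∈ V(G₂), (a = x → x ∈ Y) → (a = y → y ∈ Y) → (P a ↔ P t) := by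
    have hmem : ∀ a ∈ V(G₂), (a = x → x ∈ Y) → (a = y → y ∈ Y) →
        a ∈ Y ∪ (V(G₂) \ {x, y}) := by
      intro a ha h1 h2
      by_cases hax : a = x
      · exact .inl (hax ▸ h1 hax)
      by_cases hay : a = y
      · exact .inl (hay ▸ h2 hay)
      exact .inr ⟨ha, by simp [hax, hay]⟩
    have side : ∀ s t : α, s ∈ V(G₂) → t ∈ V(G₂) → s ≠ t → (s = x ∨ s = y) →
        (∀ a, a = x ∨ a = y → a = s ∨ a = t) → t ∈ Y → s ∉ Y →
        ∀ a ∈ V(G₂), (a = x → x ∈ Y) → (a = y → y ∈ Y) → (P a ↔ P t) := by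
      intro s t hs ht hst hs' hst' htY hsY a ha h1 h2
      have has : a ≠ s := by
        rintro rfl
        rcases hs' with rfl | rfl
        exacts [hsY (h1 rfl), hsY (h2 rfl)]
      have hm : ∀ b ∈ V(G₂) \ {s}, b ∈ Y ∪ (V(G₂) \ {x, y}) := by
        intro b hb
        by_cases hb' : b = x ∨ b = y
        · rcases hst' b hb' with rfl | rfl
          exacts [absurd rfl hb.2, .inl htY]
        · exact .inr ⟨hb.1, hb'⟩
      refine (hG₂.twoConnOn.conn_diff s hs).iff (fun e b c he hb hc ↦ ?_) ⟨ha, has⟩ ⟨ht, hst.symm⟩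
      refine hP e b c (h.symm.of_left he ?_) (hm b hb) (hm c hc)
      rintro rfl
      obtain ⟨rfl, rfl⟩ | ⟨rfl, rfl⟩ := he.eq_and_eq_or_eq_and_eq h.link₂
      · rcases hs' with rfl | rfl
        exacts [hb.2 rfl, hc.2 rfl]
      · rcases hs' with rfl | rfl
        exacts [hc.2 rfl, hb.2 rfl]
    by_cases hx : x ∈ Y <;> by_cases hy : y ∈ Y
    · refine ⟨x, hx, fun a ha _ _ ↦ ?_⟩
      refine (hG₂.connOn_deleteEdges hf hfe).iff (fun e b c he hb hc ↦ ?_) ha h.link₂.left_mem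
      exact hP e b c (h.symm.of_left he.1 he.2) (hmem b hb (fun _ ↦ hx) fun _ ↦ hy)
        (hmem c hc (fun _ ↦ hx) fun _ ↦ hy)
    · exact ⟨x, hx, side y x h.link₂.right_mem h.link₂.left_mem h.ne.symm (.inr rfl)
        (fun a ↦ Or.symm) hx hy⟩
    · exact ⟨y, hy, side x y h.link₂.left_mem h.link₂.right_mem h.ne (.inl rfl)
        (fun a ↦ id) hy hx⟩
    · exact absurd hxy (by simp [hx, hy])
  obtain ⟨t, ht, h2⟩ := h2
  have h1 : ∀ a ∈ Y, (P a ↔ P t) := by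
    intro a ha
    refine hY.iff (fun e b c he hb hc ↦ ?_) ha ht
    by_cases hee : e = e₁
    · subst hee
      obtain ⟨rfl, rfl⟩ | ⟨rfl, rfl⟩ := he.eq_and_eq_or_eq_and_eq h.link₁
      · exact ((h2 b h.link₂.left_mem (fun _ ↦ hb) (fun _ ↦ hc)).trans
          (h2 c h.link₂.right_mem (fun _ ↦ hb) (fun _ ↦ hc)).symm).1
      · exact ((h2 b h.link₂.right_mem (fun _ ↦ hc) (fun _ ↦ hb)).trans
          (h2 c h.link₂.left_mem (fun _ ↦ hc) (fun _ ↦ hb)).symm).1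
    · exact hP e b c (h.of_left he hee) (.inl hb) (.inl hc)
  have h3 : ∀ a ∈ Y ∪ (V(G₂) \ {x, y}), (P a ↔ P t) := by
    rintro a (ha | ha)
    · exact h1 a ha
    · exact h2 a ha.1 (fun h' ↦ absurd (.inl h') ha.2) (fun h' ↦ absurd (.inr h') ha.2)
  exact fun a ha b hb ↦ ((h3 a ha).trans (h3 b hb).symm).1

/-- The 2-sum of 2-connected graphs with at least two edges each is 2-connected. -/
lemma twoConnected (h : IsTwoSum G₁ G₂ e₁ e₂ x y G) (hG₁ : G₁.TwoConnected)
    (hG₂ : G₂.TwoConnected) {f₁ f₂ : β} (hf₁ : f₁ ∈ E(G₁)) (hfe₁ : f₁ ≠ e₁) (hf₂ : f₂ ∈ E(G₂))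
    (hfe₂ : f₂ ≠ e₂) : G.TwoConnected := by
  have key : ∀ (G₁ G₂ : Graph α β) (e₁ e₂ f₂ : β), IsTwoSum G₁ G₂ e₁ e₂ x y G → G₁.TwoConnected →
      G₂.TwoConnected → f₂ ∈ E(G₂) → f₂ ≠ e₂ → ∀ z ∈ V(G₁), G.ConnOn (V(G) \ {z}) := by
    intro G₁ G₂ e₁ e₂ f₂ h hG₁ hG₂ hf₂ hfe₂ z hz
    convert h.connOn_union hG₂ hf₂ hfe₂ (hG₁.twoConnOn.conn_diff z hz) ?_ using 1
    · ext a
      simp only [h.verts, mem_sdiff, mem_union, mem_singleton_iff, mem_insert_iff, not_or]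
      constructor
      · rintro ⟨h1 | h1, h2⟩
        · exact .inl ⟨h1, h2⟩
        · by_cases ha : a = x ∨ a = y
          · rcases ha with rfl | rfl
            exacts [.inl ⟨h.link₁.left_mem, h2⟩, .inl ⟨h.link₁.right_mem, h2⟩]
          · exact .inr ⟨h1, not_or.1 ha⟩
      · rintro (⟨h1, h2⟩ | ⟨h1, h2⟩)
        · exact ⟨.inl h1, h2⟩
        · refine ⟨.inr h1, ?_⟩
          rintro rfl
          rcases h.eq_or_eq hz h1 with rfl | rfl
          exacts [h2.1 rfl, h2.2 rfl]
    · by_cases hzx : z = x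
      · exact .inr ⟨h.link₁.right_mem, fun h' ↦ h.ne (hzx.symm.trans h'.symm)⟩
      · exact .inl ⟨h.link₁.left_mem, fun h' ↦ hzx h'.symm⟩
  refine twoConnected_iff.2 ⟨h.loopless, ⟨x, h.subset_left h.link₁.left_mem, y,
    h.subset_left h.link₁.right_mem, h.ne⟩, ?_, fun z hz ↦ ?_⟩
  · convert h.connOn_union hG₂ hf₂ hfe₂ hG₁.twoConnOn.conn (.inl h.link₁.left_mem) using 1
    ext a
    simp only [h.verts, mem_union, mem_sdiff, mem_insert_iff, mem_singleton_iff]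
    constructor
    · rintro (h1 | h1)
      · exact .inl h1
      · by_cases ha : a = x ∨ a = y
        · rcases ha with rfl | rfl
          exacts [.inl h.link₁.left_mem, .inl h.link₁.right_mem]
        · exact .inr ⟨h1, ha⟩
    · exact Or.imp_right And.left
  · rw [h.verts] at hz
    rcases hz with hz | hz
    · exact key G₁ G₂ e₁ e₂ f₂ h hG₁ hG₂ hf₂ hfe₂ z hz
    · exact key G₂ G₁ e₂ e₁ f₁ h.symm hG₂ hG₁ hf₁ hfe₁ z hz

lemma deleteEdges_left (h : IsTwoSum G₁ G₂ e₁ e₂ x y G) {e : β} (he : e ∈ E(G₁)) (hne : e ≠ e₁) :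
    IsTwoSum (G₁.deleteEdges {e}) G₂ e₁ e₂ x y (G.deleteEdges {e}) where
  ne := h.ne
  link₁ := ⟨h.link₁, hne.symm⟩
  link₂ := h.link₂
  inter := h.inter
  disj e' he' := h.disj e' he'.1
  verts := h.verts
  isLink e' a b := by
    simp only [deleteEdges_isLink, h.isLink, mem_singleton_iff]
    constructor
    · rintro ⟨h1 | h1, h2⟩
      exacts [.inl ⟨⟨h1.1, h2⟩, h1.2⟩, .inr h1]
    · rintro (h1 | h1)
      · exact ⟨.inl ⟨h1.1.1, h1.2⟩, h1.1.2⟩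
      · refine ⟨.inr h1, ?_⟩
        rintro rfl
        exact h1.2 (h.disj _ he hne h1.1.edge_mem)
  loopless e a b he := h.loopless e a b he.1

lemma induce_left (h : IsTwoSum G₁ G₂ e₁ e₂ x y G) {S : Set α} (hx : x ∈ S) (hy : y ∈ S)
    (hS : S ⊆ V(G₁)) : IsTwoSum (G₁.induce S) G₂ e₁ e₂ x y (G.induce (S ∪ V(G₂))) where
  ne := h.ne
  link₁ := ⟨h.link₁, hx, hy⟩
  link₂ := h.link₂
  inter := by
    refine Subset.antisymm (fun a ha ↦ h.eq_or_eq (hS ha.1) ha.2) ?_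
    rintro a (rfl | rfl)
    exacts [⟨hx, h.link₂.left_mem⟩, ⟨hy, h.link₂.right_mem⟩]
  disj e he := h.disj e (by
    obtain ⟨a, b, h', -⟩ := he
    exact h'.edge_mem)
  verts := rfl
  isLink e a b := by
    simp only [induce_isLink, h.isLink, mem_union]
    constructor
    · rintro ⟨h1 | h1, h2, h3⟩
      · refine .inl ⟨⟨h1.1, ?_, ?_⟩, h1.2⟩
        · rcases h2 with h2 | h2
          · exact h2
          · rcases h.eq_or_eq h1.1.left_mem h2 with rfl | rfl
            exacts [hx, hy]
        · rcases h3 with h3 | h3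
          · exact h3
          · rcases h.eq_or_eq h1.1.right_mem h3 with rfl | rfl
            exacts [hx, hy]
      · exact .inr h1
    · rintro (⟨⟨h1, h2, h3⟩, h4⟩ | h1)
      · exact ⟨.inl ⟨h1, h4⟩, .inl h2, .inl h3⟩
      · exact ⟨.inr h1, .inr h1.1.left_mem, .inr h1.1.right_mem⟩
  loopless e a b he := h.loopless e a b he.1

lemma delete_left (h : IsTwoSum G₁ G₂ e₁ e₂ x y G) {e : β} (he : e ∈ E(G₁)) (hne : e ≠ e₁)
    (hd : (G.deleteEdges {e}).TwoConnected) : (G₁.deleteEdges {e}).TwoConnected :=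
  (h.deleteEdges_left he hne).twoConnected_left hd

/-- If an edge of the left summand can be contracted in the 2-sum, then it can be contracted in the
left summand. The exceptional case to be excluded is a left summand that is a 2-cycle. -/
lemma contract_left (h : IsTwoSum G₁ G₂ e₁ e₂ x y G) (hG : G.TwoConnected) {e f₂ : β}
    (he : e ∈ E(G₁)) (hne : e ≠ e₁) (hf₂ : f₂ ∈ E(G₂)) (hfe₂ : f₂ ≠ e₂)
    (h3 : V(G₁) ≠ {x, y} ∨ ∃ f ∈ E(G₁), f ≠ e₁ ∧ f ≠ e)
    (hc : (G.contractEdge e).TwoConnected) : (G₁.contractEdge e).TwoConnected := by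
  obtain ⟨a, b, hab⟩ := exists_isLink_of_mem_edgeSet he
  rw [contractEdge_twoConnected_iff hG (h.of_left hab hne)] at hc
  rw [contractEdge_twoConnected_iff (h.twoConnected_left hG) hab]
  obtain ⟨hc1, hc2⟩ := hc
  have hxy : ¬ (x ∈ ({a, b} : Set α) ∧ y ∈ ({a, b} : Set α)) := by
    rintro ⟨hx, hy⟩
    have hlink : G₁.IsLink e x y := by
      rcases hx with rfl | rfl <;> rcases hy with rfl | rfl
      exacts [absurd rfl h.ne, hab, hab.symm, absurd rfl h.ne]
    have hpair : ({a, b} : Set α) = {x, y} := by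
      obtain ⟨rfl, rfl⟩ | ⟨rfl, rfl⟩ := hab.eq_and_eq_or_eq_and_eq hlink
      exacts [rfl, pair_comm _ _]
    have huniq : ∀ f, G.IsLink f x y → f = e := by
      intro f hf
      refine hc1 f ?_
      obtain ⟨rfl, rfl⟩ | ⟨rfl, rfl⟩ := hab.eq_and_eq_or_eq_and_eq hlink
      exacts [hf, hf.symm]
    rw [hpair] at hc2
    have h3' : (V(G₁) \ {x, y}).Nonempty := by
      rcases h3 with h3 | ⟨f, hf, hf1, hf2⟩
      · by_contra h'
        rw [not_nonempty_iff_eq_empty, sdiff_eq_empty] at h'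
        refine h3 (Subset.antisymm h' ?_)
        rintro z (rfl | rfl)
        exacts [h.link₁.left_mem, h.link₁.right_mem]
      · exact exists_vertex_of_not_parallel (h.twoConnected_left hG) hf
          fun hf' ↦ hf2 (huniq f (h.of_left hf' hf1))
    have h4' : (V(G₂) \ {x, y}).Nonempty := by
      refine exists_vertex_of_not_parallel (h.symm.twoConnected_left hG) hf₂ fun hf' ↦ ?_
      have := huniq f₂ (h.symm.of_left hf' hfe₂)
      exact hfe₂ (h.disj f₂ (this ▸ he) (this ▸ hne) hf₂)
    obtain ⟨u, hu, hu'⟩ := h3'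
    obtain ⟨w, hw, hw'⟩ := h4'
    have := hc2.2 (fun z ↦ z ∈ V(G₁)) ?_ u ⟨h.subset_left hu, hu'⟩ w
      ⟨h.symm.subset_left hw, hw'⟩ hu
    · exact hw' (h.eq_or_eq this hw)
    · intro g c d hg hc hd hc1
      by_contra hd1
      exact hc.2 (h.attach g c d hg hc1 hd1)
  refine ⟨fun f hf ↦ hc1 f (h.of_left hf ?_), ?_⟩
  · exact h.edge_ne_of_notMem hxy hf (by simp) (by simp)
  · have := hc2.inter_of_attach (H := G₁) h.link₁.left_mem h.link₁.right_mem h.attach ?_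
      h.exists_left ⟨e₁, h.link₁⟩
    · rwa [sdiff_inter_right_comm, inter_eq_right.2 h.subset_left] at this
    · by_contra h'
      push Not at h'
      refine hxy ⟨?_, ?_⟩
      · by_contra hx
        exact h'.1 ⟨h.subset_left h.link₁.left_mem, hx⟩
      · by_contra hy
        exact h'.2 ⟨h.subset_left h.link₁.right_mem, hy⟩

/-! ### Good flats of 2-sums -/

/-- A good flat of the left summand that contains the glued edge, and another edge, gives a good
flat of the 2-sum that contains the right summand. -/
lemma isGoodFlat_union (h : IsTwoSum G₁ G₂ e₁ e₂ x y G) (hG : G.TwoConnected) {f₁ f₂ : β}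
    {S : Set α} (hS : G₁.IsGoodFlat S) (hx : x ∈ S) (hy : y ∈ S)
    (hf₁ : f₁ ∈ E(G₁.induce S)) (hfe₁ : f₁ ≠ e₁) (hf₂ : f₂ ∈ E(G₂)) (hfe₂ : f₂ ≠ e₂) :
    G.IsGoodFlat (S ∪ V(G₂)) := by
  have hG₁ := h.twoConnected_left hG
  have hG₂ := h.symm.twoConnected_left hG
  have hV : V(G) \ (S ∪ V(G₂)) = V(G₁) \ S := by
    ext a
    simp only [h.verts, mem_sdiff, mem_union, not_or]
    constructor
    · rintro ⟨h1 | h1, h2, h3⟩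
      exacts [⟨h1, h2⟩, absurd h1 h3]
    · rintro ⟨h1, h2⟩
      refine ⟨.inl h1, h2, fun h3 ↦ h2 ?_⟩
      rcases h.eq_or_eq h1 h3 with rfl | rfl
      exacts [hx, hy]
  have hS' := (isGoodFlat_iff hG₁).1 hS
  rw [isGoodFlat_iff hG]
  refine ⟨⟨?_, ?_⟩, ?_, ?_⟩
  · exact h.verts ▸ union_subset_union_left _ hS.ssubset.subset
  · obtain ⟨z, hz⟩ := hS'.2.2.1
    rw [← hV] at hz
    exact fun h' ↦ hz.2 (h' hz.1)
  · rw [← twoConnected_induce_iff fun e a b ↦ hG.ne]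
    exact (h.induce_left hx hy hS.ssubset.subset).twoConnected hS.restrict hG₂ hf₁ hfe₁ hf₂ hfe₂
  · rw [hV]
    refine hS'.2.2.mono fun e a b he ha hb ↦ ⟨e, h.of_left he ?_⟩
    exact h.edge_ne_of_notMem (S := V(G₁) \ S) (fun h' ↦ h'.1.2 hx) he ha hb

lemma isGoodFlat_of_left (h : IsTwoSum G₁ G₂ e₁ e₂ x y G) (hG : G.TwoConnected) {f₂ : β}
    {S : Set α} (hS : G₁.IsGoodFlat S) (hxy : ¬ (x ∈ S ∧ y ∈ S))
    (hf₂ : f₂ ∈ E(G₂)) (hfe₂ : f₂ ≠ e₂) : G.IsGoodFlat S := by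
  have hG₁ := h.twoConnected_left hG
  have hG₂ := h.symm.twoConnected_left hG
  have hS' := (isGoodFlat_iff hG₁).1 hS
  rw [isGoodFlat_iff hG]
  refine ⟨hS.ssubset.trans_subset h.subset_left, ?_, ?_⟩
  · rw [← twoConnected_induce_iff fun e a b ↦ hG.ne, h.induce_left_eq hxy hS.ssubset.subset]
    exact hS.restrict
  · convert h.connOn_union hG₂ hf₂ hfe₂ hS'.2.2 ?_ using 1
    · ext a
      simp only [h.verts, mem_sdiff, mem_union, mem_insert_iff, mem_singleton_iff]
      constructor
      · rintro ⟨h1 | h1, h2⟩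
        · exact .inl ⟨h1, h2⟩
        · by_cases ha : a = x ∨ a = y
          · rcases ha with rfl | rfl
            exacts [.inl ⟨h.link₁.left_mem, h2⟩, .inl ⟨h.link₁.right_mem, h2⟩]
          · exact .inr ⟨h1, ha⟩
      · rintro (⟨h1, h2⟩ | ⟨h1, h2⟩)
        · exact ⟨.inl h1, h2⟩
        · exact ⟨.inr h1, fun h' ↦ h2 (h.eq_or_eq (hS.ssubset.subset h') h1)⟩
    · by_contra h'
      push Not at h'
      refine hxy ⟨?_, ?_⟩
      · by_contra hx
        exact h'.1 ⟨h.link₁.left_mem, hx⟩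
      · by_contra hy
        exact h'.2 ⟨h.link₁.right_mem, hy⟩

/-- A good flat of the 2-sum containing the right summand restricts to a good flat of the left
summand. -/
lemma isGoodFlat_inter (h : IsTwoSum G₁ G₂ e₁ e₂ x y G) (hG : G.TwoConnected) {S : Set α}
    (hS : G.IsGoodFlat S) (hS2 : V(G₂) ⊆ S) : G₁.IsGoodFlat (S ∩ V(G₁)) := by
  have hx := hS2 h.link₂.left_mem
  have hy := hS2 h.link₂.right_mem
  have hS' := (isGoodFlat_iff hG).1 hS
  have hV : V(G₁) \ (S ∩ V(G₁)) = V(G) \ S := by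
    ext a
    simp only [h.verts, mem_sdiff, mem_union, mem_inter_iff, not_and]
    constructor
    · rintro ⟨h1, h2⟩
      exact ⟨.inl h1, fun h3 ↦ h2 h3 h1⟩
    · rintro ⟨h1 | h1, h2⟩
      exacts [⟨h1, fun h3 ↦ absurd h3 h2⟩, absurd (hS2 h1) h2]
  rw [isGoodFlat_iff (h.twoConnected_left hG)]
  refine ⟨⟨inter_subset_right, ?_⟩, ?_, ?_⟩
  · obtain ⟨z, hz⟩ := hS'.2.2.1
    rw [← hV] at hz
    exact fun h' ↦ hz.2 (h' hz.1)
  · exact hS'.2.1.inter_of_attach h.link₁.left_mem h.link₁.right_mem h.ne hx hy h.attach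
      h.exists_left ⟨e₁, h.link₁⟩
  · rw [hV]
    refine hS'.2.2.mono fun e a b he ha hb ↦ h.exists_left e a b he ?_ ?_
    · rw [← hV] at ha
      exact ha.1
    · rw [← hV] at hb
      exact hb.1

lemma isGoodFlat_left (h : IsTwoSum G₁ G₂ e₁ e₂ x y G) (hG : G.TwoConnected) {S : Set α}
    (hS : G.IsGoodFlat S) (hS1 : S ⊆ V(G₁)) (hxy : ¬ (x ∈ S ∧ y ∈ S)) : G₁.IsGoodFlat S := by
  have hS' := (isGoodFlat_iff hG).1 hS
  have hG₁ := h.twoConnected_left hG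
  have hxy' : x ∈ V(G) \ S ∨ y ∈ V(G) \ S := by
    by_contra h'
    push Not at h'
    refine hxy ⟨?_, ?_⟩
    · by_contra hx
      exact h'.1 ⟨h.subset_left h.link₁.left_mem, hx⟩
    · by_contra hy
      exact h'.2 ⟨h.subset_left h.link₁.right_mem, hy⟩
  rw [isGoodFlat_iff hG₁]
  refine ⟨⟨hS1, fun h' ↦ ?_⟩, ?_, ?_⟩
  · exact hxy ⟨h' h.link₁.left_mem, h' h.link₁.right_mem⟩
  · rw [← twoConnected_induce_iff fun e a b ↦ hG₁.ne, ← h.induce_left_eq hxy hS1]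
    exact hS.restrict
  · have := hS'.2.2.inter_of_attach (H := G₁) h.link₁.left_mem h.link₁.right_mem h.attach hxy'
      h.exists_left ⟨e₁, h.link₁⟩
    rwa [sdiff_inter_right_comm, inter_eq_right.2 h.subset_left] at this

/-- A good flat of a 2-sum contains one of the summands, or is contained in one of them. -/
lemma isGoodFlat_cases (h : IsTwoSum G₁ G₂ e₁ e₂ x y G) (hG : G.TwoConnected) {S : Set α}
    (hS : G.IsGoodFlat S) : V(G₂) ⊆ S ∨ V(G₁) ⊆ S ∨
      (¬ (x ∈ S ∧ y ∈ S) ∧ S ⊆ V(G₁)) ∨ (¬ (x ∈ S ∧ y ∈ S) ∧ S ⊆ V(G₂)) := by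
  have hS' := (isGoodFlat_iff hG).1 hS
  by_cases hxy : x ∈ S ∧ y ∈ S
  · by_contra hc
    push Not at hc
    obtain ⟨u, hu, huS⟩ := not_subset.1 hc.1
    obtain ⟨w, hw, hwS⟩ := not_subset.1 hc.2.1
    have := hS'.2.2.2 (fun z ↦ z ∈ V(G₁)) ?_ w ⟨h.subset_left hw, hwS⟩ u
      ⟨h.symm.subset_left hu, huS⟩ hw
    · rcases h.eq_or_eq this hu with rfl | rfl
      exacts [huS hxy.1, huS hxy.2]
    · intro g c d hg hgc hgd hc1
      by_contra hd1
      rcases h.attach g c d hg hc1 hd1 with rfl | rfl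
      exacts [hgc.2 hxy.1, hgc.2 hxy.2]
  · refine .inr (.inr ?_)
    by_contra hc
    obtain ⟨u, hu, hu1⟩ := not_subset.1 fun hs ↦ hc (.inl ⟨hxy, hs⟩)
    obtain ⟨w, hw, hw2⟩ := not_subset.1 fun hs ↦ hc (.inr ⟨hxy, hs⟩)
    have hw1 : w ∈ V(G₁) := by
      have := hS.ssubset.subset hw
      rw [h.verts] at this
      exact this.resolve_right hw2
    obtain ⟨t, ht1, ht2, ht⟩ : ∃ t ∈ V(G₁), t ∈ V(G₂) ∧ ∀ s ∈ S, s = x ∨ s = y → s = t := by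
      by_cases hx : x ∈ S
      · refine ⟨x, h.link₁.left_mem, h.link₂.left_mem, ?_⟩
        rintro s hs (rfl | rfl)
        exacts [rfl, absurd ⟨hx, hs⟩ hxy]
      · refine ⟨y, h.link₁.right_mem, h.link₂.right_mem, ?_⟩
        rintro s hs (rfl | rfl)
        exacts [absurd hs hx, rfl]
    have hconn : G.ConnOn (S \ {t}) := by
      by_cases htS : t ∈ S
      · exact hS'.2.1.conn_diff t htS
      · rw [sdiff_singleton_eq_self htS]
        exact hS'.2.1.conn
    refine hu1 (hconn.2 (fun z ↦ z ∈ V(G₁)) ?_ w ⟨hw, ?_⟩ u ⟨hu, ?_⟩ hw1)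
    · intro g c d hg hgc hgd hc1
      by_contra hd1
      exact hgc.2 (ht c hgc.1 (h.attach g c d hg hc1 hd1))
    · rintro rfl
      exact hw2 ht2
    · rintro rfl
      exact hu1 ht1

end IsTwoSum

/-! ### Weights -/

/-- The total weight of the edges of `G`. -/
noncomputable def totalWeight (G : Graph α β) (w : β → ℕ) : ℕ := ∑ᶠ e ∈ E(G), w e

/-- `w` is a weight function witnessing the weight equalities. -/
structure IsSpadeWeight (G : Graph α β) (δ : ℕ) (w : β → ℕ) : Prop extends G.IsWeight δ w where
  total : G.totalWeight w = δ * (V(G).ncard - 1)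
  flat : ∀ S : Set α, G.IsGoodFlat S → (G.induce S).totalWeight w + 1 = δ * (S.ncard - 1)

/-- A weak form of the weight equalities. An edge that can be both deleted and contracted may have
either weight, and the good flats that consist of a single edge are ignored. -/
structure IsWeakSpadeWeight (G : Graph α β) (δ : ℕ) (w : β → ℕ) : Prop where
  values : ∀ e ∈ E(G), (w e = 1 ∧ (G.deleteEdges {e}).TwoConnected) ∨
    (w e = δ - 1 ∧ (G.contractEdge e).TwoConnected)
  total : G.totalWeight w = δ * (V(G).ncard - 1)
  flat : ∀ S : Set α, G.IsGoodFlat S → E(G.induce S).Nontrivial →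
    (G.induce S).totalWeight w + 1 = δ * (S.ncard - 1)

lemma satisfiesSpade_iff {G : Graph α β} {δ : ℕ} :
    G.SatisfiesSpade δ ↔ ∃ w, G.IsSpadeWeight δ w :=
  ⟨fun ⟨w, h1, h2, h3⟩ ↦ ⟨w, h1, h2, h3⟩, fun ⟨w, h⟩ ↦ ⟨w, h.toIsWeight, h.total, h.flat⟩⟩

lemma totalWeight_congr {G H : Graph α β} {w w' : β → ℕ} (hE : E(G) = E(H))
    (h : ∀ e ∈ E(G), w e = w' e) : G.totalWeight w = H.totalWeight w' := by
  rw [totalWeight, totalWeight, ← hE]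
  exact finsum_mem_congr rfl h

lemma totalWeight_const (G : Graph α β) (hE : E(G).Finite) (k : ℕ) :
    G.totalWeight (fun _ ↦ k) = E(G).ncard * k := by
  rw [totalWeight, finsum_mem_eq_finite_toFinset_sum _ hE, Finset.sum_const, smul_eq_mul,
    ncard_eq_toFinset_card _ hE]

lemma totalWeight_insert {G H : Graph α β} {w w' : β → ℕ} {e : β} (hG : E(G).Finite)
    (he : e ∈ E(G)) (hH : E(H) = E(G) \ {e}) (h : ∀ f ∈ E(H), w' f = w f) :
    G.totalWeight w = w e + H.totalWeight w' := by
  rw [totalWeight, totalWeight, finsum_mem_congr rfl h, hH, ← finsum_mem_insert _ (by simp)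
    (hG.subset sdiff_subset)]
  congr! 2
  rw [insert_sdiff_singleton, insert_eq_of_mem he]

lemma edgeSet_induce_subset (G : Graph α β) (S : Set α) : E(G.induce S) ⊆ E(G) := by
  rintro e ⟨a, b, h, -⟩
  exact h.edge_mem

lemma TwoConnected.exists_isLink {G : Graph α β} (hG : G.TwoConnected) {v : α} (hv : v ∈ V(G)) :
    ∃ e u, G.IsLink e v u := by
  by_contra! h
  obtain ⟨c, hc, hcv⟩ := hG.nontrivial.exists_ne v
  refine hcv (hG.twoConnOn.conn.2 (fun u ↦ u = v) ?_ v hv c hc rfl)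
  rintro e u w he _ _ rfl
  exact absurd he (h e w)

lemma TwoConnected.two_le_ncard {G : Graph α β} (hG : G.TwoConnected) (hV : V(G).Finite) :
    2 ≤ V(G).ncard :=
  (Set.one_lt_ncard hV).2 hG.nontrivial

/-- A 2-connected graph with only one edge has only two vertices. -/
lemma TwoConnected.verts_eq_pair {G : Graph α β} (hG : G.TwoConnected) {e : β} {x y : α}
    (he : G.IsLink e x y) (h : ∀ f ∈ E(G), G.IsLink f x y) : V(G) = {x, y} := by
  refine Subset.antisymm (fun c hc ↦ ?_) ?_
  · obtain ⟨f, u, hf⟩ := hG.exists_isLink hc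
    exact hf.left_eq_or_eq (h f hf.edge_mem)
  · rintro z (rfl | rfl)
    exacts [he.left_mem, he.right_mem]

lemma deleteEdges_twoConnected_of_pair {G : Graph α β} (hG : G.TwoConnected) {x y : α} {e f : β}
    (hV : V(G) = {x, y}) (hf : G.IsLink f x y) (hfe : f ≠ e) :
    (G.deleteEdges {e}).TwoConnected := by
  rw [deleteEdges_twoConnected_iff hG, hV]
  exact twoConnOn_pair (e := f) ⟨hf, hfe⟩ (hG.ne hf)

lemma isLink_of_verts_pair {G : Graph α β} (hG : G.TwoConnected) {x y : α} (hV : V(G) = {x, y})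
    {e : β} (he : e ∈ E(G)) : G.IsLink e x y := by
  obtain ⟨a, b, hab⟩ := exists_isLink_of_mem_edgeSet he
  have ha := hab.left_mem
  have hb := hab.right_mem
  have hne := hG.ne hab
  rw [hV] at ha hb
  rcases ha with rfl | rfl <;> rcases hb with rfl | rfl
  exacts [absurd rfl hne, hab, hab.symm, absurd rfl hne]

namespace IsSpadeWeight

variable {G : Graph α β} {δ : ℕ} {w : β → ℕ}

lemma exists_ne (hw : G.IsSpadeWeight δ w) (hδ : 2 < δ) (hG : G.TwoConnected) {e : β}
    (he : e ∈ E(G)) : ∃ f ∈ E(G), f ≠ e := by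
  by_contra! h
  obtain ⟨x, y, hxy⟩ := exists_isLink_of_mem_edgeSet he
  have hE : E(G) = {e} := Subset.antisymm h (singleton_subset_iff.2 he)
  have hV := hG.verts_eq_pair hxy fun f hf ↦ h f hf ▸ hxy
  have ht := hw.total
  rw [totalWeight, hE, finsum_mem_singleton, hV, ncard_pair (hG.ne hxy)] at ht
  rcases hw.values e he with h' | h' <;> omega

lemma exists_ne_ne (hw : G.IsSpadeWeight δ w) (hδ : 2 < δ) (hG : G.TwoConnected) {e₀ e : β}
    {x y : α} (he₀ : G.IsLink e₀ x y) (he : e ∈ E(G)) (hne : e ≠ e₀) :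
    V(G) ≠ {x, y} ∨ ∃ f ∈ E(G), f ≠ e₀ ∧ f ≠ e := by
  by_contra! h
  obtain ⟨hV, h⟩ := h
  have hE : E(G) = {e₀, e} := by
    refine Subset.antisymm (fun f hf ↦ ?_) (pair_subset he₀.edge_mem he)
    by_cases hf0 : f = e₀
    · exact .inl hf0
    · exact .inr (h f hf hf0)
  have h1 := hw.of_delete e he (deleteEdges_twoConnected_of_pair hG hV he₀ hne.symm)
  have h2 := hw.of_delete e₀ he₀.edge_mem
    (deleteEdges_twoConnected_of_pair hG hV (isLink_of_verts_pair hG hV he) hne)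
  have ht := hw.total
  rw [totalWeight, hE, finsum_mem_pair hne.symm, hV, ncard_pair (hG.ne he₀)] at ht
  omega

lemma isWeakSpadeWeight (hw : G.IsSpadeWeight δ w) (hδ : 2 < δ) (hG : G.TwoConnected) :
    G.IsWeakSpadeWeight δ w where
  values e he := by
    obtain ⟨f, hf, hfe⟩ := hw.exists_ne hδ hG he
    rcases hG.delete_or_contract he hf hfe with h | h
    exacts [.inl ⟨hw.of_delete e he h, h⟩, .inr ⟨hw.of_contract e he h, h⟩]
  total := hw.total
  flat S hS _ := hw.flat S hS

end IsSpadeWeight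

lemma IsWeight.unique {G : Graph α β} {δ : ℕ} {w w' : β → ℕ} (hG : G.TwoConnected)
    (hw : G.IsWeight δ w) (hw' : G.IsWeight δ w') {e f : β} (he : e ∈ E(G)) (hf : f ∈ E(G))
    (hfe : f ≠ e) : w e = w' e := by
  rcases hG.delete_or_contract he hf hfe with h | h
  · rw [hw.of_delete e he h, hw'.of_delete e he h]
  · rw [hw.of_contract e he h, hw'.of_contract e he h]

lemma IsWeakSpadeWeight.isSpadeWeight {G : Graph α β} {δ : ℕ} {w : β → ℕ} (hG : G.TwoConnected)
    (hδ : 2 < δ) (hw : G.IsWeakSpadeWeight δ w)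
    (h1 : ∀ e ∈ E(G), (G.deleteEdges {e}).TwoConnected → w e = 1)
    (h2 : ∀ e ∈ E(G), (G.contractEdge e).TwoConnected → w e = δ - 1) : G.IsSpadeWeight δ w where
  values e he := (hw.values e he).imp And.left And.left
  of_delete := h1
  of_contract := h2
  total := hw.total
  flat S hS := by
    by_cases hE : E(G.induce S).Nontrivial
    · exact hw.flat S hS hE
    -- The good flat is a single edge, which can be contracted.
    rw [not_nontrivial_iff] at hE
    have hS' := (isGoodFlat_iff hG).1 hS
    obtain ⟨c, hc⟩ := hS.restrict.nontrivial.nonempty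
    obtain ⟨e, y, he⟩ := hS.restrict.exists_isLink hc
    have hSV := hS.restrict.verts_eq_pair he fun f hf ↦ hE hf he.edge_mem ▸ he
    rw [vertexSet_induce] at hSV
    have hcon : (G.contractEdge e).TwoConnected := by
      rw [contractEdge_twoConnected_iff hG he.1, ← hSV]
      exact ⟨fun f hf ↦ hE ⟨c, y, hf, he.2⟩ he.edge_mem, hS'.2.2⟩
    have hE' : E(G.induce S) = {e} :=
      Subset.antisymm (fun f hf ↦ hE hf he.edge_mem) (singleton_subset_iff.2 he.edge_mem)
    rw [totalWeight, hE', finsum_mem_singleton, h2 e he.1.edge_mem hcon, hSV,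
      ncard_pair (hG.ne he.1)]
    omega

/-! ### Weights of 2-sums -/

namespace IsTwoSum

variable {G₁ G₂ G : Graph α β} {e₁ e₂ : β} {x y : α} {δ : ℕ} {w w₁ w₂ : β → ℕ}

lemma edgeSet_eq (h : IsTwoSum G₁ G₂ e₁ e₂ x y G) : E(G) = (E(G₁) \ {e₁}) ∪ (E(G₂) \ {e₂}) := by
  ext e
  simp only [edge_mem_iff_exists_isLink, h.isLink, mem_union, mem_sdiff, mem_singleton_iff]
  constructor
  · rintro ⟨a, b, h' | h'⟩
    exacts [.inl ⟨⟨a, b, h'.1⟩, h'.2⟩, .inr ⟨⟨a, b, h'.1⟩, h'.2⟩]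
  · rintro (⟨⟨a, b, h1⟩, h2⟩ | ⟨⟨a, b, h1⟩, h2⟩)
    exacts [⟨a, b, .inl ⟨h1, h2⟩⟩, ⟨a, b, .inr ⟨h1, h2⟩⟩]

lemma totalWeight_eq (h : IsTwoSum G₁ G₂ e₁ e₂ x y G) (hE₁ : E(G₁).Finite) (hE₂ : E(G₂).Finite)
    (hw₁ : ∀ e ∈ E(G₁), e ≠ e₁ → w e = w₁ e) (hw₂ : ∀ e ∈ E(G₂), e ≠ e₂ → w e = w₂ e) :
    G.totalWeight w + (w₁ e₁ + w₂ e₂) = G₁.totalWeight w₁ + G₂.totalWeight w₂ := by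
  have hd : Disjoint (E(G₁) \ {e₁}) (E(G₂) \ {e₂}) := by
    rw [Set.disjoint_left]
    exact fun e he he' ↦ he'.2 (h.disj e he.1 he.2 he'.1)
  have key : ∀ (G : Graph α β) (e : β) (w w' : β → ℕ), E(G).Finite → e ∈ E(G) →
      (∀ f ∈ E(G), f ≠ e → w' f = w f) →
      G.totalWeight w = w e + ∑ᶠ f ∈ E(G) \ {e}, w' f := by
    intro G e w w' hG he hw
    exact totalWeight_insert (H := G.deleteEdges {e}) hG he rfl fun f hf ↦ hw f hf.1 hf.2
  rw [key G₁ e₁ w₁ w hE₁ h.link₁.edge_mem hw₁, key G₂ e₂ w₂ w hE₂ h.link₂.edge_mem hw₂, totalWeight,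
    h.edgeSet_eq, finsum_mem_union hd (hE₁.subset sdiff_subset) (hE₂.subset sdiff_subset)]
  ring

lemma ncard_add_two (h : IsTwoSum G₁ G₂ e₁ e₂ x y G) (hV₁ : V(G₁).Finite) (hV₂ : V(G₂).Finite) :
    V(G).ncard + 2 = V(G₁).ncard + V(G₂).ncard := by
  rw [← ncard_union_add_ncard_inter _ _ hV₁ hV₂, h.inter, ncard_pair h.ne, h.verts]

lemma two_le_ncard_left (h : IsTwoSum G₁ G₂ e₁ e₂ x y G) (hV₁ : V(G₁).Finite) :
    2 ≤ V(G₁).ncard :=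
  (Set.one_lt_ncard hV₁).2 ⟨x, h.link₁.left_mem, y, h.link₁.right_mem, h.ne⟩

lemma total_sub_one_mul (h : IsTwoSum G₁ G₂ e₁ e₂ x y G) (hV₁ : V(G₁).Finite)
    (hV₂ : V(G₂).Finite) (δ : ℕ) :
    δ * (V(G).ncard - 1) + δ = δ * (V(G₁).ncard - 1) + δ * (V(G₂).ncard - 1) := by
  have h1 := h.ncard_add_two hV₁ hV₂
  have h2 := h.two_le_ncard_left hV₁
  have h3 := h.symm.two_le_ncard_left hV₂
  rw [← Nat.mul_add, ← Nat.mul_succ]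
  congr 1
  omega

/-- The weight equality of a good flat of a 2-sum, for a flat that lies in the left summand or
contains the right summand. -/
lemma flat_of_left (h : IsTwoSum G₁ G₂ e₁ e₂ x y G) (hG : G.TwoConnected) (hV₁ : V(G₁).Finite)
    (hV₂ : V(G₂).Finite) (hE₁ : E(G₁).Finite) (hE₂ : E(G₂).Finite)
    (hw₁ : ∀ e ∈ E(G₁), e ≠ e₁ → w e = w₁ e) (hw₂ : ∀ e ∈ E(G₂), e ≠ e₂ → w e = w₂ e)
    (hδ : w₁ e₁ + w₂ e₂ = δ)
    (hf : ∀ S : Set α, G₁.IsGoodFlat S → (G₁.induce S).totalWeight w₁ + 1 = δ * (S.ncard - 1))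
    (ht : G₂.totalWeight w₂ = δ * (V(G₂).ncard - 1)) {S : Set α} (hS : G.IsGoodFlat S)
    (hS' : V(G₂) ⊆ S ∨ (¬ (x ∈ S ∧ y ∈ S) ∧ S ⊆ V(G₁))) :
    (G.induce S).totalWeight w + 1 = δ * (S.ncard - 1) := by
  rcases hS' with hS2 | ⟨hxy, hS1⟩
  · have hsum := h.induce_left (S := S ∩ V(G₁)) ⟨hS2 h.link₂.left_mem, h.link₁.left_mem⟩
      ⟨hS2 h.link₂.right_mem, h.link₁.right_mem⟩ inter_subset_right
    have hSeq : S ∩ V(G₁) ∪ V(G₂) = S := by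
      ext a
      have : a ∈ S → a ∈ V(G) := fun h' ↦ hS.ssubset.subset h'
      rw [h.verts] at this
      constructor
      · rintro (h' | h')
        exacts [h'.1, hS2 h']
      · exact fun h' ↦ (this h').imp_left fun h'' ↦ ⟨h', h''⟩
    have h1 := hf _ (h.isGoodFlat_inter hG hS hS2)
    have h2 := hsum.totalWeight_eq (w := w) (hE₁.subset (edgeSet_induce_subset _ _)) hE₂
      (fun e he ↦ hw₁ e (edgeSet_induce_subset _ _ he)) hw₂
    have h3 := hsum.total_sub_one_mul (hV₁.subset inter_subset_right) hV₂ δ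
    rw [hSeq] at h2 h3
    simp only [vertexSet_induce] at h3
    omega
  · have h1 := hf _ (h.isGoodFlat_left hG hS hS1 hxy)
    rw [h.induce_left_eq hxy hS1, ← h1, Nat.add_right_cancel_iff]
    refine totalWeight_congr rfl fun e he ↦ ?_
    refine hw₁ e (edgeSet_induce_subset _ _ he) ?_
    obtain ⟨a, b, he, ha, hb⟩ := he
    exact h.edge_ne_of_notMem hxy he ha hb

/-- A weight function on the left summand gives the required values on its edges in the 2-sum. -/
lemma isWeight_of_left (h : IsTwoSum G₁ G₂ e₁ e₂ x y G) (hG : G.TwoConnected) (hδ : 2 < δ)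
    (hw : G₁.IsSpadeWeight δ w₁) {f₂ : β} (hf₂ : f₂ ∈ E(G₂)) (hfe₂ : f₂ ≠ e₂) {e : β}
    (he : e ∈ E(G₁)) (hne : e ≠ e₁) :
    (w₁ e = 1 ∨ w₁ e = δ - 1) ∧ ((G.deleteEdges {e}).TwoConnected → w₁ e = 1) ∧
      ((G.contractEdge e).TwoConnected → w₁ e = δ - 1) :=
  ⟨hw.values e he, fun hd ↦ hw.of_delete e he (h.delete_left he hne hd),
    fun hc ↦ hw.of_contract e he (h.contract_left hG he hne hf₂ hfe₂
      (hw.exists_ne_ne hδ (h.twoConnected_left hG) h.link₁ he hne) hc)⟩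

/-- The weight equalities pass to a 2-sum along edges whose weights add up to `δ`. -/
theorem isSpadeWeight (h : IsTwoSum G₁ G₂ e₁ e₂ x y G) (hG₁ : G₁.TwoConnected)
    (hG₂ : G₂.TwoConnected) (hV₁ : V(G₁).Finite) (hV₂ : V(G₂).Finite) (hE₁ : E(G₁).Finite)
    (hE₂ : E(G₂).Finite) (hδ : 2 < δ) (hs₁ : G₁.IsSpadeWeight δ w₁) (hs₂ : G₂.IsSpadeWeight δ w₂)
    (he : w₁ e₁ + w₂ e₂ = δ)
    (hw₁ : ∀ e ∈ E(G₁), e ≠ e₁ → w e = w₁ e) (hw₂ : ∀ e ∈ E(G₂), e ≠ e₂ → w e = w₂ e) :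
    G.IsSpadeWeight δ w := by
  obtain ⟨f₁, hf₁, hfe₁⟩ := hs₁.exists_ne hδ hG₁ h.link₁.edge_mem
  obtain ⟨f₂, hf₂, hfe₂⟩ := hs₂.exists_ne hδ hG₂ h.link₂.edge_mem
  have hG := h.twoConnected hG₁ hG₂ hf₁ hfe₁ hf₂ hfe₂
  have key : ∀ e ∈ E(G), (w e = 1 ∨ w e = δ - 1) ∧
      ((G.deleteEdges {e}).TwoConnected → w e = 1) ∧
      ((G.contractEdge e).TwoConnected → w e = δ - 1) := by
    intro e he
    rw [h.edgeSet_eq] at he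
    rcases he with he | he
    · rw [hw₁ e he.1 he.2]
      exact h.isWeight_of_left hG hδ hs₁ hf₂ hfe₂ he.1 he.2
    · rw [hw₂ e he.1 he.2]
      exact h.symm.isWeight_of_left hG hδ hs₂ hf₁ hfe₁ he.1 he.2
  refine ⟨⟨fun e he ↦ (key e he).1, fun e he ↦ (key e he).2.1, fun e he ↦ (key e he).2.2⟩, ?_, ?_⟩
  · have h1 := h.totalWeight_eq hE₁ hE₂ hw₁ hw₂
    have h2 := h.total_sub_one_mul hV₁ hV₂ δ
    have h3 := hs₁.total
    have h4 := hs₂.total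
    omega
  · intro S hS
    have left := h.flat_of_left hG hV₁ hV₂ hE₁ hE₂ hw₁ hw₂ he hs₁.flat hs₂.total hS
    have right := h.symm.flat_of_left hG hV₂ hV₁ hE₂ hE₁ hw₂ hw₁ (by omega) hs₂.flat hs₁.total hS
    rcases h.isGoodFlat_cases hG hS with h' | h' | h' | h'
    exacts [left (.inl h'), right (.inl h'), left (.inr h'), right (.inr h')]

/-- If the edge `e₂` is contractible, then the rest of the right summand is connected, and the edges
of the left summand other than `e₁` span an induced subgraph. -/
lemma connOn_compl_left (h : IsTwoSum G₁ G₂ e₁ e₂ x y G) (hG : G.TwoConnected)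
    (hc : (G₂.contractEdge e₂).TwoConnected) :
    G.ConnOn (V(G) \ V(G₁)) ∧ E(G.induce V(G₁)) = E(G₁) \ {e₁} := by
  rw [contractEdge_twoConnected_iff (h.symm.twoConnected_left hG) h.link₂] at hc
  constructor
  · have hV : V(G) \ V(G₁) = V(G₂) \ {x, y} := by
      ext a
      simp only [h.verts, mem_sdiff, mem_union]
      constructor
      · rintro ⟨h1 | h1, h2⟩
        · exact absurd h1 h2
        · refine ⟨h1, ?_⟩
          rintro (rfl | rfl)
          exacts [h2 h.link₁.left_mem, h2 h.link₁.right_mem]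
      · rintro ⟨h1, h2⟩
        exact ⟨.inr h1, fun h3 ↦ h2 (h.eq_or_eq h3 h1)⟩
    rw [hV]
    refine hc.2.mono fun e a b he ha hb ↦ ⟨e, h.symm.of_left he ?_⟩
    exact h.symm.edge_ne_of_notMem (S := V(G₂) \ {x, y}) (fun h' ↦ h'.1.2 (by simp)) he ha hb
  · ext e
    constructor
    · rintro ⟨a, b, he, ha, hb⟩
      rcases (h.isLink e a b).1 he with h' | h'
      · exact ⟨h'.1.edge_mem, h'.2⟩
      · have hne := h.loopless e a b he
        rcases h.eq_or_eq ha h'.1.left_mem with rfl | rfl <;>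
          rcases h.eq_or_eq hb h'.1.right_mem with rfl | rfl
        exacts [absurd rfl hne, absurd (hc.1 e h'.1) h'.2, absurd (hc.1 e h'.1.symm) h'.2,
          absurd rfl hne]
    · rintro ⟨he, hne⟩
      obtain ⟨a, b, hab⟩ := exists_isLink_of_mem_edgeSet he
      exact ⟨a, b, h.of_left hab hne, hab.left_mem, hab.right_mem⟩

/-- The left summand becomes a good flat when `e₁` is deletable and `e₂` is contractible. -/
lemma isGoodFlat_verts (h : IsTwoSum G₁ G₂ e₁ e₂ x y G) (hG : G.TwoConnected)
    (hd : (G₁.deleteEdges {e₁}).TwoConnected) (hc : (G₂.contractEdge e₂).TwoConnected) :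
    G.IsGoodFlat V(G₁) := by
  have hconn := (h.connOn_compl_left hG hc).1
  rw [isGoodFlat_iff hG]
  refine ⟨⟨h.subset_left, ?_⟩, ?_, hconn⟩
  · obtain ⟨z, hz⟩ := hconn.1
    exact fun h' ↦ hz.2 (h' hz.1)
  · exact hd.twoConnOn.mono fun e a b he _ _ ↦ ⟨e, h.of_left he.1 he.2⟩

/-- The weak weight equalities pass to the left summand, once the total weight of the right summand
is known. -/
lemma isWeakSpadeWeight_left (h : IsTwoSum G₁ G₂ e₁ e₂ x y G) (hG : G.TwoConnected)
    (hV₁ : V(G₁).Finite) (hV₂ : V(G₂).Finite) (hE₁ : E(G₁).Finite) (hE₂ : E(G₂).Finite)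
    (hw₁ : ∀ e ∈ E(G₁), e ≠ e₁ → w e = w₁ e) (hw₂ : ∀ e ∈ E(G₂), e ≠ e₂ → w e = w₂ e)
    (hδ : w₁ e₁ + w₂ e₂ = δ) (hw : G.IsWeakSpadeWeight δ w)
    (ht : G₂.totalWeight w₂ = δ * (V(G₂).ncard - 1))
    (he₁ : (w₁ e₁ = 1 ∧ (G₁.deleteEdges {e₁}).TwoConnected) ∨
      (w₁ e₁ = δ - 1 ∧ (G₁.contractEdge e₁).TwoConnected))
    {f₂ : β} (hf₂ : f₂ ∈ E(G₂)) (hfe₂ : f₂ ≠ e₂)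
    (h3 : ∀ e ∈ E(G₁), e ≠ e₁ → V(G₁) ≠ {x, y} ∨ ∃ f ∈ E(G₁), f ≠ e₁ ∧ f ≠ e) :
    G₁.IsWeakSpadeWeight δ w₁ where
  values e he := by
    by_cases hne : e = e₁
    · exact hne ▸ he₁
    · rw [← hw₁ e he hne]
      rcases hw.values e (h.edgeSet_eq ▸ .inl ⟨he, hne⟩) with h' | h'
      · exact .inl ⟨h'.1, h.delete_left he hne h'.2⟩
      · exact .inr ⟨h'.1, h.contract_left hG he hne hf₂ hfe₂ (h3 e he hne) h'.2⟩
  total := by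
    have h1 := h.totalWeight_eq hE₁ hE₂ hw₁ hw₂
    have h2 := h.total_sub_one_mul hV₁ hV₂ δ
    have h3 := hw.total
    omega
  flat S hS hSE := by
    by_cases hxy : x ∈ S ∧ y ∈ S
    · obtain ⟨f₁, hf₁, hfe₁⟩ := hSE.exists_ne e₁
      have hflat := h.isGoodFlat_union hG hS hxy.1 hxy.2 hf₁ hfe₁ hf₂ hfe₂
      have hsum := h.induce_left hxy.1 hxy.2 hS.ssubset.subset
      have hf₁' := edgeSet_induce_subset _ _ hf₁
      have h1 := hw.flat _ hflat ⟨f₁, hsum.edgeSet_eq ▸ .inl ⟨hf₁, hfe₁⟩, f₂,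
        hsum.edgeSet_eq ▸ .inr ⟨hf₂, hfe₂⟩, fun h' ↦ hfe₂ (h.disj f₂ (h' ▸ hf₁') (h' ▸ hfe₁) hf₂)⟩
      have h2 := hsum.totalWeight_eq (w := w) (hE₁.subset (edgeSet_induce_subset _ _)) hE₂
        (fun e he ↦ hw₁ e (edgeSet_induce_subset _ _ he)) hw₂
      have h3 := hsum.total_sub_one_mul (hV₁.subset hS.ssubset.subset) hV₂ δ
      simp only [vertexSet_induce] at h3
      omega
    · have heq := h.induce_left_eq hxy hS.ssubset.subset
      have h1 := hw.flat S (h.isGoodFlat_of_left hG hS hxy hf₂ hfe₂) (heq ▸ hSE)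
      rw [heq] at h1
      rw [← h1, Nat.add_right_cancel_iff]
      refine totalWeight_congr rfl fun e he ↦ (hw₁ e (edgeSet_induce_subset _ _ he) ?_).symm
      obtain ⟨a, b, he, ha, hb⟩ := he
      exact h.edge_ne_of_notMem hxy he ha hb

open Classical in
/-- The weak weight equalities pass to the summands of a 2-sum along a deletable edge `e₁` and a
contractible edge `e₂`. The left summand is a good flat, which fixes the total weight on both
sides. -/
theorem isWeakSpadeWeight (h : IsTwoSum G₁ G₂ e₁ e₂ x y G) (hG : G.TwoConnected) (hδ : 2 < δ)
    (hV₁ : V(G₁).Finite) (hV₂ : V(G₂).Finite) (hE₁ : E(G₁).Finite) (hE₂ : E(G₂).Finite)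
    (hd : (G₁.deleteEdges {e₁}).TwoConnected) (hc : (G₂.contractEdge e₂).TwoConnected)
    (hnt : (E(G₁) \ {e₁}).Nontrivial) (hw : G.IsWeakSpadeWeight δ w) :
    G₁.IsWeakSpadeWeight δ (Function.update w e₁ 1) ∧
      G₂.IsWeakSpadeWeight δ (Function.update w e₂ (δ - 1)) := by
  have hG₂ := h.symm.twoConnected_left hG
  have hS := h.isGoodFlat_verts hG hd hc
  have hE := (h.connOn_compl_left hG hc).2
  have hw₁ : ∀ e ∈ E(G₁), e ≠ e₁ → w e = Function.update w e₁ 1 e :=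
    fun e _ hne ↦ by simp [hne]
  have hw₂ : ∀ e ∈ E(G₂), e ≠ e₂ → w e = Function.update w e₂ (δ - 1) e :=
    fun e _ hne ↦ by simp [hne]
  have hδ' : Function.update w e₁ 1 e₁ + Function.update w e₂ (δ - 1) e₂ = δ := by
    simp only [Function.update_self]
    omega
  have ht₁ : G₁.totalWeight (Function.update w e₁ 1) = δ * (V(G₁).ncard - 1) := by
    rw [← hw.flat _ hS (hE ▸ hnt), totalWeight_insert hE₁ h.link₁.edge_mem hE
      (fun f hf ↦ ?_), Function.update_self, add_comm]
    rw [hE] at hf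
    exact hw₁ f hf.1 hf.2
  have ht₂ : G₂.totalWeight (Function.update w e₂ (δ - 1)) = δ * (V(G₂).ncard - 1) := by
    have h1 := h.totalWeight_eq hE₁ hE₂ hw₁ hw₂
    have h2 := h.total_sub_one_mul hV₁ hV₂ δ
    have h3 := hw.total
    omega
  obtain ⟨f₁, hf₁, hfe₁⟩ := hnt.nonempty
  obtain ⟨z, hz⟩ := ((contractEdge_twoConnected_iff hG₂ h.link₂).1 hc).2.1
  obtain ⟨f₂, u, hf₂⟩ := hG₂.exists_isLink hz.1
  have hfe₂ : f₂ ≠ e₂ := by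
    rintro rfl
    exact hz.2 (hf₂.left_eq_or_eq h.link₂)
  constructor
  · refine h.isWeakSpadeWeight_left hG hV₁ hV₂ hE₁ hE₂ hw₁ hw₂ hδ' hw ht₂
      (.inl ⟨by simp, hd⟩) hf₂.edge_mem hfe₂ fun e he hne ↦ .inr ?_
    obtain ⟨f, hf, hfe⟩ := hnt.exists_ne e
    exact ⟨f, hf.1, hf.2, hfe⟩
  · refine h.symm.isWeakSpadeWeight_left hG hV₂ hV₁ hE₂ hE₁ hw₂ hw₁ (by omega) hw ht₁
      (.inr ⟨by simp, hc⟩) hf₁ hfe₁ fun e he hne ↦ .inl fun h' ↦ ?_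
    exact hz.2 (h' ▸ hz.1)

end IsTwoSum

/-! ### Decomposition along a good flat attached at two vertices -/

/-- The good flat `S` has at least two edges, and its vertices `x` and `y` are the only ones with
neighbours outside `S`. -/
structure IsReducingFlat (G : Graph α β) (S : Set α) (x y : α) : Prop where
  isGoodFlat : G.IsGoodFlat S
  left_mem : x ∈ S
  right_mem : y ∈ S
  ne : x ≠ y
  attach : ∀ e a b, G.IsLink e a b → a ∈ S → b ∉ S → a = x ∨ a = y
  nontrivial : E(G.induce S).Nontrivial

/-- `G` with an edge `e` between `x` and `y`, replacing any edge of `G` with the label `e`. -/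
def addEdge (G : Graph α β) (e : β) (x y : α) : Graph α β where
  vertexSet := {x, y} ∪ V(G)
  IsLink f a b := (f = e ∧ s(a, b) = s(x, y)) ∨ (f ≠ e ∧ G.IsLink f a b)
  isLink_symm f _ := ⟨fun a b h ↦ by
    rcases h with ⟨h1, h2⟩ | ⟨h1, h2⟩
    · exact .inl ⟨h1, Sym2.eq_swap.trans h2⟩
    · exact .inr ⟨h1, h2.symm⟩⟩
  eq_or_eq_of_isLink_of_isLink f a b c d h h' := by
    rcases h with ⟨h1, h2⟩ | ⟨h1, h2⟩ <;> rcases h' with ⟨h3, h4⟩ | ⟨h3, h4⟩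
    · have := h2.trans h4.symm
      rw [Sym2.eq_iff] at this
      exact this.imp And.left And.left
    · exact absurd h1 h3
    · exact absurd h3 h1
    · exact h2.left_eq_or_eq h4
  left_mem_of_isLink f a b h := by
    rcases h with ⟨h1, h2⟩ | ⟨h1, h2⟩
    · rw [Sym2.eq_iff] at h2
      exact .inl (h2.imp And.left And.left)
    · exact .inr h2.left_mem

lemma addEdge_isLink {G : Graph α β} {e f : β} {x y a b : α} :
    (G.addEdge e x y).IsLink f a b ↔ (f = e ∧ s(a, b) = s(x, y)) ∨ (f ≠ e ∧ G.IsLink f a b) :=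
  Iff.rfl

lemma edgeSet_addEdge (G : Graph α β) (e : β) (x y : α) :
    E(G.addEdge e x y) = insert e E(G) := by
  ext f
  simp only [edge_mem_iff_exists_isLink, addEdge_isLink, mem_insert_iff]
  constructor
  · rintro ⟨a, b, h | h⟩
    exacts [.inl h.1, .inr ⟨a, b, h.2⟩]
  · rintro (h | ⟨a, b, h⟩)
    · exact ⟨x, y, .inl ⟨h, rfl⟩⟩
    · by_cases hf : f = e
      exacts [⟨x, y, .inl ⟨hf, rfl⟩⟩, ⟨a, b, .inr ⟨hf, h⟩⟩]

/-- A reducing flat splits the graph as a 2-sum, in which one edge can be deleted and the other one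
can be contracted. -/
lemma IsReducingFlat.exists_isTwoSum {G : Graph α β} (hG : G.TwoConnected) {S : Set α} {x y : α}
    (h : G.IsReducingFlat S x y) {e₁ e₂ : β} (he₁ : e₁ ∉ E(G.induce S))
    (he₂ : e₂ ∉ E(G) \ E(G.induce S)) :
    ∃ G₁ G₂ : Graph α β, IsTwoSum G₁ G₂ e₁ e₂ x y G ∧ V(G₁) = S ∧
      E(G₁) = insert e₁ E(G.induce S) ∧ V(G₂) ⊆ V(G) ∧
      E(G₂) = insert e₂ (E(G) \ E(G.induce S)) ∧
      (G₁.deleteEdges {e₁}).TwoConnected ∧ (G₂.contractEdge e₂).TwoConnected := by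
  have hSV := h.isGoodFlat.ssubset.subset
  set T : Set α := {x, y} ∪ V(G) \ S with hT
  set K := (G.deleteEdges E(G.induce S)).induce T with hK
  have hV₁ : V((G.induce S).addEdge e₁ x y) = S := by
    refine union_eq_right.2 ?_
    rintro z (rfl | rfl)
    exacts [h.left_mem, h.right_mem]
  have hV₂ : V(K.addEdge e₂ x y) = T := union_eq_right.2 subset_union_left
  have hEK : E(K) = E(G) \ E(G.induce S) := by
    ext e
    constructor
    · rintro ⟨a, b, h1, -⟩
      exact ⟨h1.1.edge_mem, h1.2⟩
    · rintro ⟨h1, h2⟩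
      obtain ⟨a, b, hab⟩ := exists_isLink_of_mem_edgeSet h1
      refine ⟨a, b, ⟨hab, h2⟩, ?_⟩
      have hT' : ∀ a b, G.IsLink e a b → a ∈ T := by
        intro a b hab
        by_cases ha : a ∈ S
        · by_cases hb : b ∈ S
          · exact absurd ⟨a, b, hab, ha, hb⟩ h2
          · exact .inl (h.attach e a b hab ha hb)
        · exact .inr ⟨hab.left_mem, ha⟩
      exact ⟨hT' a b hab, hT' b a hab.symm⟩
  have hKlink : ∀ e a b, K.IsLink e a b ↔ G.IsLink e a b ∧ e ∉ E(G.induce S) := by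
    intro e a b
    refine ⟨fun h' ↦ h'.1, fun h' ↦ ?_⟩
    have : e ∈ E(K) := hEK ▸ ⟨h'.1.edge_mem, h'.2⟩
    obtain ⟨c, d, hcd⟩ := exists_isLink_of_mem_edgeSet this
    obtain ⟨rfl, rfl⟩ | ⟨rfl, rfl⟩ := h'.1.eq_and_eq_or_eq_and_eq hcd.1.1
    exacts [hcd, hcd.symm]
  have hsum : IsTwoSum ((G.induce S).addEdge e₁ x y) (K.addEdge e₂ x y) e₁ e₂ x y G := by
    refine ⟨h.ne, .inl ⟨rfl, rfl⟩, .inl ⟨rfl, rfl⟩, ?_, ?_, ?_, ?_, fun e a b ↦ hG.ne⟩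
    · rw [hV₁, hV₂, hT]
      ext z
      simp only [mem_inter_iff, mem_union, mem_insert_iff, mem_singleton_iff, mem_sdiff]
      constructor
      · rintro ⟨h1, h2 | h2⟩
        exacts [h2, absurd h1 h2.2]
      · rintro (rfl | rfl)
        exacts [⟨h.left_mem, .inl (.inl rfl)⟩, ⟨h.right_mem, .inl (.inr rfl)⟩]
    · intro e he hne he'
      rw [edgeSet_addEdge] at he he'
      by_contra hne'
      have h1 := he.resolve_left hne
      have h2 := he'.resolve_left hne'
      rw [hEK] at h2
      exact h2.2 h1
    · rw [hV₁, hV₂, hT]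
      ext z
      simp only [mem_union, mem_insert_iff, mem_singleton_iff, mem_sdiff]
      constructor
      · intro hz
        by_cases hzS : z ∈ S
        exacts [.inl hzS, .inr (.inr ⟨hz, hzS⟩)]
      · rintro (h1 | (rfl | rfl) | h1)
        exacts [hSV h1, hSV h.left_mem, hSV h.right_mem, h1.1]
    · intro e a b
      simp only [addEdge_isLink, hKlink, ne_eq]
      constructor
      · intro hab
        by_cases heS : e ∈ E(G.induce S)
        · refine .inl ⟨.inr ⟨fun h' ↦ he₁ (h' ▸ heS), hab, ?_⟩, fun h' ↦ he₁ (h' ▸ heS)⟩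
          obtain ⟨c, d, hcd, hc, hd⟩ := heS
          obtain ⟨rfl, rfl⟩ | ⟨rfl, rfl⟩ := hab.eq_and_eq_or_eq_and_eq hcd
          exacts [⟨hc, hd⟩, ⟨hd, hc⟩]
        · have : e ≠ e₂ := fun h' ↦ he₂ (h' ▸ ⟨hab.edge_mem, heS⟩)
          exact .inr ⟨.inr ⟨this, hab, heS⟩, this⟩
      · rintro (⟨h1 | h1, h2⟩ | ⟨h1 | h1, h2⟩)
        exacts [absurd h1.1 h2, h1.2.1, absurd h1.1 h2, h1.2.1]
  refine ⟨_, _, hsum, hV₁, edgeSet_addEdge _ _ _ _, ?_, by rw [edgeSet_addEdge, hEK], ?_, ?_⟩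
  · exact hsum.symm.subset_left
  · rw [deleteEdges_twoConnected_iff (hsum.twoConnected_left hG), hV₁]
    refine ((isGoodFlat_iff hG).1 h.isGoodFlat).2.1.mono fun e a b he ha hb ↦ ?_
    have : e ≠ e₁ := by
      rintro rfl
      exact he₁ ⟨a, b, he, ha, hb⟩
    exact ⟨e, .inr ⟨this, he, ha, hb⟩, this⟩
  · rw [contractEdge_twoConnected_iff (hsum.symm.twoConnected_left hG) hsum.link₂]
    constructor
    · rintro f (hf | hf)
      · exact hf.1
      · rw [hKlink] at hf
        exact absurd ⟨x, y, hf.2.1, h.left_mem, h.right_mem⟩ hf.2.2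
    · have hT2 : V(K.addEdge e₂ x y) \ {x, y} = V(G) \ S := by
        rw [hV₂, hT]
        ext z
        simp only [mem_union, mem_insert_iff, mem_singleton_iff, mem_sdiff]
        constructor
        · rintro ⟨h1 | h1, h2⟩
          exacts [absurd h1 h2, h1]
        · refine fun h1 ↦ ⟨.inr h1, ?_⟩
          rintro (rfl | rfl)
          exacts [h1.2 h.left_mem, h1.2 h.right_mem]
      rw [hT2]
      refine ((isGoodFlat_iff hG).1 h.isGoodFlat).2.2.mono fun e a b he ha hb ↦ ?_
      have heS : e ∉ E(G.induce S) := by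
        rintro ⟨c, d, hcd, hc, hd⟩
        rcases he.left_eq_or_eq hcd with rfl | rfl
        exacts [ha.2 hc, ha.2 hd]
      exact ⟨e, .inr ⟨fun h' ↦ he₂ (h' ▸ ⟨he.edge_mem, heS⟩), (hKlink e a b).2 ⟨he, heS⟩⟩⟩

/-! ### Graphs without reducing flats -/

lemma TwoConnected.edgeSet_nontrivial {G : Graph α β} (hG : G.TwoConnected) {a b c : α}
    (ha : a ∈ V(G)) (hb : b ∈ V(G)) (hab : a ≠ b) (hc : c ∈ V(G)) (hca : c ≠ a) (hcb : c ≠ b) :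
    E(G).Nontrivial := by
  obtain ⟨e, u, he, hu⟩ := hG.exists_isLink_ne (a := a) hc hb hcb.symm hab.symm
  obtain ⟨f, v, hf, hv⟩ := hG.exists_isLink_ne (a := u) hc ha hca.symm hu.symm
  refine ⟨e, he.edge_mem, f, hf.edge_mem, ?_⟩
  rintro rfl
  exact hv (hf.right_unique he)

/-- A vertex set attached at `x` and `y` that is not 2-connected has a vertex separating `x` from
`y`. -/
lemma exists_separating {G : Graph α β} (hG : G.TwoConnected) {A : Set α} {x y : α}
    (hA : A ⊆ V(G)) (hx : x ∈ A) (hy : y ∈ A) (hne : x ≠ y)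
    (hatt : ∀ e a b, G.IsLink e a b → a ∈ A → b ∉ A → a = x ∨ a = y)
    (hin : (A \ {x, y}).Nonempty) (hA2 : ¬ G.TwoConnOn A) :
    ∃ z ∈ A \ {x, y}, ∃ P : α → Prop,
      (∀ e a b, G.IsLink e a b → a ∈ A \ {z} → b ∈ A \ {z} → P a → P b) ∧ P x ∧ ¬ P y := by
  by_contra! H
  have H' : ∀ z ∈ A \ {x, y}, ∀ P : α → Prop,
      (∀ e a b, G.IsLink e a b → a ∈ A \ {z} → b ∈ A \ {z} → P a → P b) → (P x ↔ P y) := by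
    refine fun z hz P hP ↦ ⟨H z hz P hP, fun hPy ↦ ?_⟩
    by_contra hPx
    exact H z hz (fun a ↦ ¬ P a)
      (fun e a b he ha hb hPa hPb ↦ hPa (hP e b a he.symm hb ha hPb)) hPx hPy
  refine hA2 ⟨⟨x, hx, y, hy, hne⟩, ⟨⟨x, hx⟩, fun P hP ↦ ?_⟩, fun z hz ↦ ⟨?_, fun P hP ↦ ?_⟩⟩
  · obtain ⟨z, hz⟩ := hin
    have := hG.twoConnOn.conn.const_of_attach hx hy hatt (.inl (hA hx)) (P := P)
      (fun e a b he ha hb ↦ hP e a b he ha.2 hb.2)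
      fun _ _ ↦ H' z hz P fun e a b he ha hb ↦ hP e a b he ha.1 hb.1
    rwa [inter_eq_right.2 hA] at this
  · by_cases hzx : x = z
    · exact ⟨y, hy, fun h ↦ hne (hzx.trans h.symm)⟩
    · exact ⟨x, hx, hzx⟩
  · have heq : V(G) \ {z} ∩ A = A \ {z} := by
      rw [sdiff_inter_right_comm, inter_eq_right.2 hA]
    have := (hG.twoConnOn.conn_diff z (hA hz)).const_of_attach hx hy hatt ?_ (P := P)
      (by rwa [heq]) fun hx' hy' ↦ H' z ⟨hz, ?_⟩ P hP
    · rwa [heq] at this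
    · by_cases hzx : x = z
      · exact .inr ⟨hA hy, fun h ↦ hne (hzx.trans h.symm)⟩
      · exact .inl ⟨hA hx, hzx⟩
    · rintro (rfl | rfl)
      exacts [hx'.2 rfl, hy'.2 rfl]

namespace IsReducingFlat

variable {G : Graph α β}

/-- The complement of a connected set with neighbours `x` and `y` is a reducing flat if it is
2-connected and has two edges. -/
lemma of_compl (hG : G.TwoConnected) {C : Set α} {x y : α} (hx : x ∈ V(G)) (hy : y ∈ V(G))
    (hne : x ≠ y) (hCV : C ⊆ V(G)) (hC : G.ConnOn C) (hxC : x ∉ C) (hyC : y ∉ C)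
    (hcl : ∀ e a b, G.IsLink e a b → a ∈ C → b ∉ C → b = x ∨ b = y)
    (h2 : G.TwoConnOn (V(G) \ C)) (hnt : E(G.induce (V(G) \ C)).Nontrivial) :
    G.IsReducingFlat (V(G) \ C) x y where
  isGoodFlat := by
    rw [isGoodFlat_iff hG, sdiff_sdiff_cancel_left hCV]
    refine ⟨⟨sdiff_subset, fun h ↦ ?_⟩, h2, hC⟩
    obtain ⟨c, hc⟩ := hC.1
    exact (h (hCV hc)).2 hc
  left_mem := ⟨hx, hxC⟩
  right_mem := ⟨hy, hyC⟩
  ne := hne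
  attach e a b he ha hb := by
    have hbC : b ∈ C := by
      by_contra h
      exact hb ⟨he.right_mem, h⟩
    exact hcl e b a he.symm hbC ha.2
  nontrivial := hnt

end IsReducingFlat

/-- The complement of a closed set with neighbours `x` and `y` is 2-connected if `x` and `y` are
adjacent. -/
lemma TwoConnected.twoConnOn_compl {G : Graph α β} (hG : G.TwoConnected) {C : Set α} {x y : α}
    {f : β} (hf : G.IsLink f x y) (hxC : x ∉ C) (hyC : y ∉ C)
    (hcl : ∀ e a b, G.IsLink e a b → a ∈ C → b ∉ C → b = x ∨ b = y) :
    G.TwoConnOn (V(G) \ C) := by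
  have := hG.twoConnOn.inter_of_attach (A := V(G) \ C) (H := G) ⟨hf.left_mem, hxC⟩
    ⟨hf.right_mem, hyC⟩ (hG.ne hf) hf.left_mem hf.right_mem ?_ (fun e a b he _ _ ↦ ⟨e, he⟩) ⟨f, hf⟩
  · rwa [inter_eq_right.2 sdiff_subset] at this
  · intro e a b he ha hb
    have hbC : b ∈ C := by
      by_contra h
      exact hb ⟨he.right_mem, h⟩
    exact hcl e b a he.symm hbC ha.2

section Irreducible

variable {G : Graph α β}

lemma eq_of_parallel (hG : G.TwoConnected) (hirr : ∀ S x y, ¬ G.IsReducingFlat S x y) {x y v : α}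
    (hv : v ∈ V(G) \ {x, y}) {f g : β} (hf : G.IsLink f x y) (hg : G.IsLink g x y) : f = g := by
  by_contra hfg
  obtain ⟨C, hCV, hvC, hC, hcl⟩ := exists_component G hv
  have hxC : x ∉ C := fun h ↦ (hCV h).2 (by simp)
  have hyC : y ∉ C := fun h ↦ (hCV h).2 (by simp)
  have hcl' : ∀ e a b, G.IsLink e a b → a ∈ C → b ∉ C → b = x ∨ b = y := by
    intro e a b he ha hb
    by_contra h
    exact hb (hcl e a b he ha ⟨he.right_mem, h⟩)
  exact hirr _ _ _ (IsReducingFlat.of_compl hG hf.left_mem hf.right_mem (hG.ne hf)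
    (hCV.trans sdiff_subset) hC hxC hyC hcl' (hG.twoConnOn_compl hf hxC hyC hcl')
    ⟨f, ⟨x, y, hf, ⟨hf.left_mem, hxC⟩, hf.right_mem, hyC⟩, g,
      ⟨x, y, hg, ⟨hf.left_mem, hxC⟩, hf.right_mem, hyC⟩, hfg⟩)

lemma connOn_of_isLink (hG : G.TwoConnected) (hirr : ∀ S x y, ¬ G.IsReducingFlat S x y) {x y v : α}
    (hv : v ∈ V(G) \ {x, y}) {f : β} (hf : G.IsLink f x y) : G.ConnOn (V(G) \ {x, y}) := by
  obtain ⟨C, hCV, hvC, hC, hcl⟩ := exists_component G hv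
  have hxC : x ∉ C := fun h ↦ (hCV h).2 (by simp)
  have hyC : y ∉ C := fun h ↦ (hCV h).2 (by simp)
  have hcl' : ∀ e a b, G.IsLink e a b → a ∈ C → b ∉ C → b = x ∨ b = y := by
    intro e a b he ha hb
    by_contra h
    exact hb (hcl e a b he ha ⟨he.right_mem, h⟩)
  by_cases hall : V(G) \ {x, y} ⊆ C
  · rwa [Subset.antisymm hall hCV]
  obtain ⟨u, hu, huC⟩ := not_subset.1 hall
  exfalso
  have h2 := hG.twoConnOn_compl hf hxC hyC hcl'
  refine hirr _ _ _ (IsReducingFlat.of_compl hG hf.left_mem hf.right_mem (hG.ne hf)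
    (hCV.trans sdiff_subset) hC hxC hyC hcl' h2 ?_)
  exact ((twoConnected_induce_iff fun e a b ↦ hG.ne).2 h2).edgeSet_nontrivial
    (a := x) (b := y) (c := u) ⟨hf.left_mem, hxC⟩ ⟨hf.right_mem, hyC⟩ (hG.ne hf) ⟨hu.1, huC⟩
    (fun h ↦ hu.2 (.inl h)) (fun h ↦ hu.2 (.inr h))

/-- In a graph without reducing flats, a vertex `x` of a separating pair `{x, y}` has at most one
neighbour on each side. The side is not 2-connected, hence has a vertex `z` separating `x` from `y`,
and `{x, z}` is a separating pair with a smaller side. -/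
lemma exists_unique_neighbor (hG : G.TwoConnected) (hV : V(G).Finite)
    (hirr : ∀ S x y, ¬ G.IsReducingFlat S x y) {x : α} (hx : x ∈ V(G)) (C : Set α) (y : α)
    (hCV : C ⊆ V(G)) (hy : y ∈ V(G)) (hne : x ≠ y) (hxC : x ∉ C) (hyC : y ∉ C)
    (hcl : ∀ e a b, G.IsLink e a b → a ∈ C → b ∉ C → b = x ∨ b = y)
    (hD : ∃ v ∈ V(G), v ∉ C ∧ v ≠ x ∧ v ≠ y) : ∃ c, ∀ e u, G.IsLink e x u → u ∈ C → u = c := by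
  obtain ⟨n, hn⟩ : ∃ n, C.ncard = n := ⟨_, rfl⟩
  induction n using Nat.strong_induction_on generalizing C y with
  | _ n ih =>
  rcases C.eq_empty_or_nonempty with rfl | ⟨c₀, hc₀⟩
  · exact ⟨x, fun e u _ hu ↦ absurd hu (notMem_empty u)⟩
  obtain ⟨v, hv, hvC, hvx, hvy⟩ := hD
  -- The complement of a component `D` on the other side of `{x, y}` is not a reducing flat, so it
  -- has a separating vertex `z`, which lies in `C`.
  obtain ⟨D, hDV, hvD, hDc, hDcl⟩ := exists_component G (X := V(G) \ (C ∪ {x, y})) (v := v)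
    ⟨hv, by simp [hvC, hvx, hvy]⟩
  have hxD : x ∉ D := fun h ↦ (hDV h).2 (by simp)
  have hyD : y ∉ D := fun h ↦ (hDV h).2 (by simp)
  have hCD : ∀ c ∈ C, c ∉ D := fun c hc h ↦ (hDV h).2 (.inl hc)
  have hDcl' : ∀ e a b, G.IsLink e a b → a ∈ D → b ∉ D → b = x ∨ b = y := by
    intro e a b he ha hb
    by_contra h
    refine hb (hDcl e a b he ha ⟨he.right_mem, ?_⟩)
    rintro (hbC | hb')
    · rcases hcl e b a he.symm hbC fun h ↦ hCD a h ha with rfl | rfl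
      exacts [hxD ha, hyD ha]
    · exact h hb'
  have hSx : x ∈ V(G) \ D := ⟨hx, hxD⟩
  have hSy : y ∈ V(G) \ D := ⟨hy, hyD⟩
  have hSC : ∀ c ∈ C, c ∈ V(G) \ D := fun c hc ↦ ⟨hCV hc, hCD c hc⟩
  have hcx : ∀ c ∈ C, c ≠ x := fun c hc h ↦ hxC (h ▸ hc)
  have hcy : ∀ c ∈ C, c ≠ y := fun c hc h ↦ hyC (h ▸ hc)
  have hS2 : ¬ G.TwoConnOn (V(G) \ D) := by
    intro h2
    exact hirr _ _ _ (IsReducingFlat.of_compl hG hx hy hne (hDV.trans sdiff_subset) hDc hxD hyD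
      hDcl' h2 (((twoConnected_induce_iff fun e a b ↦ hG.ne).2 h2).edgeSet_nontrivial
        (a := x) (b := y) (c := c₀) hSx hSy hne (hSC c₀ hc₀) (hcx c₀ hc₀) (hcy c₀ hc₀)))
  obtain ⟨z, ⟨hzS, hzxy⟩, P, hP, hPx, hPy⟩ := exists_separating hG sdiff_subset hSx hSy hne
    (fun e a b he ha hb ↦ hDcl' e b a he.symm
      (by_contra fun h ↦ hb ⟨he.right_mem, h⟩) ha.2)
    ⟨c₀, hSC c₀ hc₀, by simp [hcx c₀ hc₀, hcy c₀ hc₀]⟩ hS2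
  have hxz : x ≠ z := fun h ↦ hzxy (.inl h.symm)
  have hyz : y ≠ z := fun h ↦ hzxy (.inr h.symm)
  have hnext : ∀ e a b, G.IsLink e a b → a ∈ C → b ∈ C ∨ b = x ∨ b = y := by
    intro e a b he ha
    by_cases hb : b ∈ C
    exacts [.inl hb, .inr (hcl e a b he ha hb)]
  have hnextS : ∀ e a b, G.IsLink e a b → a ∈ C → b ∈ V(G) \ D := by
    intro e a b he ha
    rcases hnext e a b he ha with h | rfl | rfl
    exacts [hSC b h, hSx, hSy]
  have hzC : z ∈ C := by
    by_contra hzC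
    refine hPy ((hG.iff_of_closed ⟨c₀, hc₀⟩ hCV hx hy hxC hyC hcl (P := P) ?_).1 hPx)
    intro e a b he ha
    have ha' : a ∈ (V(G) \ D) \ {z} := ⟨hSC a ha, fun h ↦ hzC (h ▸ ha)⟩
    have hb' : b ∈ (V(G) \ D) \ {z} := by
      refine ⟨hnextS e a b he ha, ?_⟩
      rcases hnext e a b he ha with h | rfl | rfl
      exacts [fun h' ↦ hzC (h' ▸ h), hxz, hyz]
    exact ⟨hP e a b he ha' hb', hP e b a he.symm hb' ha'⟩
  have hxS : x ∈ (V(G) \ D) \ {z} := ⟨hSx, hxz⟩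
  -- The part of `C` on the side of `x`, to which the induction hypothesis is applied.
  set C₁ : Set α := {c | c ∈ C ∧ c ≠ z ∧ P c} with hC₁
  have hxC₁ : ∀ e u, G.IsLink e x u → u ∈ C → u ≠ z → u ∈ C₁ :=
    fun e u he hu huz ↦ ⟨hu, huz, hP e x u he hxS ⟨hSC u hu, huz⟩ hPx⟩
  have hcl₁ : ∀ e a b, G.IsLink e a b → a ∈ C₁ → b ∉ C₁ → b = x ∨ b = z := by
    intro e a b he ha hb
    by_contra! h
    have hPb := hP e a b he ⟨hSC a ha.1, ha.2.1⟩ ⟨hnextS e a b he ha.1, h.2⟩ ha.2.2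
    rcases hnext e a b he ha.1 with h' | h' | rfl
    exacts [hb ⟨h', h.2, hPb⟩, h.1 h', hPy hPb]
  rcases C₁.eq_empty_or_nonempty with hemp | ⟨c₁, hc₁⟩
  · refine ⟨z, fun e u he hu ↦ ?_⟩
    by_contra huz
    exact notMem_empty u (hemp ▸ hxC₁ e u he hu huz)
  · have hyC₁ : y ∉ C₁ := fun h ↦ hyC h.1
    have hsub : C₁ ⊂ C := ⟨fun c hc ↦ hc.1, fun h ↦ (h hzC).2.1 rfl⟩
    obtain ⟨c, hc⟩ := ih C₁.ncard (hn ▸ ncard_lt_ncard hsub (hV.subset hCV)) C₁ z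
      (hsub.subset.trans hCV) (hCV hzC) hxz (fun h ↦ hxC h.1) (fun h ↦ h.2.1 rfl) hcl₁
      ⟨y, hy, hyC₁, hne.symm, hyz⟩ rfl
    refine ⟨c, fun e u he hu ↦ hc e u he (hxC₁ e u he hu ?_)⟩
    rintro rfl
    -- An edge from `x` to the separating vertex `z` is excluded, since its ends separate `C₁`.
    refine hyC₁ ((connOn_of_isLink hG hirr ⟨hy, ?_⟩ he).2 (fun a ↦ a ∈ C₁) ?_ c₁
      ⟨hCV hc₁.1, ?_⟩ y ⟨hy, ?_⟩ hc₁)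
    · simp [hne.symm, hyz]
    · intro g a b hg _ hb ha
      by_contra hb'
      exact hb.2 (hcl₁ g a b hg ha hb')
    · simp [hcx c₁ hc₁.1, hc₁.2.1]
    · simp [hne.symm, hyz]

/-- The vertex `v` has at most two neighbours. -/
def AtMostTwoNeighbors (G : Graph α β) (v : α) : Prop :=
  ∃ c d, ∀ e u, G.IsLink e v u → u = c ∨ u = d

lemma atMostTwoNeighbors_of_separating (hG : G.TwoConnected) (hV : V(G).Finite)
    (hirr : ∀ S x y, ¬ G.IsReducingFlat S x y) {x y u v : α} (hx : x ∈ V(G)) (hy : y ∈ V(G))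
    (hne : x ≠ y) {C : Set α} (hCV : C ⊆ V(G)) (hxC : x ∉ C) (hyC : y ∉ C)
    (hcl : ∀ e a b, G.IsLink e a b → a ∈ C → b ∉ C → b = x ∨ b = y) (hu : u ∈ C)
    (hv : v ∈ V(G)) (hvC : v ∉ C) (hvx : v ≠ x) (hvy : v ≠ y) : G.AtMostTwoNeighbors x := by
  have huV := hCV hu
  have hux : u ≠ x := fun h ↦ hxC (h ▸ hu)
  have huy : u ≠ y := fun h ↦ hyC (h ▸ hu)
  obtain ⟨c, hc⟩ := exists_unique_neighbor hG hV hirr hx C y hCV hy hne hxC hyC hcl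
    ⟨v, hv, hvC, hvx, hvy⟩
  have hcl' : ∀ e a b, G.IsLink e a b → a ∈ V(G) \ (C ∪ {x, y}) → b ∉ V(G) \ (C ∪ {x, y}) →
      b = x ∨ b = y := by
    intro e a b he ha hb
    by_contra h
    refine hb ⟨he.right_mem, ?_⟩
    rintro (hbC | hb')
    · exact ha.2 (.inr (hcl e b a he.symm hbC fun h' ↦ ha.2 (.inl h')))
    · exact h hb'
  obtain ⟨d, hd⟩ := exists_unique_neighbor hG hV hirr hx (V(G) \ (C ∪ {x, y})) y sdiff_subset hy hne
    (fun h ↦ h.2 (by simp)) (fun h ↦ h.2 (by simp)) hcl' ⟨u, huV, fun h ↦ h.2 (.inl hu), hux, huy⟩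
  refine ⟨c, d, fun e w he ↦ ?_⟩
  by_cases hwC : w ∈ C
  · exact .inl (hc e w he hwC)
  refine .inr (hd e w he ⟨he.right_mem, ?_⟩)
  rintro (h | rfl | rfl)
  · exact hwC h
  · exact hG.ne he rfl
  · refine hvC ((connOn_of_isLink hG hirr ⟨hv, ?_⟩ he).2 (fun a ↦ a ∈ C) ?_ u ⟨huV, ?_⟩ v
      ⟨hv, ?_⟩ hu)
    · simp [hvx, hvy]
    · intro g a b hg _ hb ha
      by_contra hb'
      exact hb.2 (hcl g a b hg ha hb')
    · simp [hux, huy]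
    · simp [hvx, hvy]

lemma AtMostTwoNeighbors.of_isLink (hG : G.TwoConnected) (hV : V(G).Finite)
    (hirr : ∀ S x y, ¬ G.IsReducingFlat S x y) {u v a b : α} {e : β} (ha : a ∈ V(G))
    (hb : b ∈ V(G)) (hav : a ≠ v) (hbv : b ≠ v) (hab : a ≠ b)
    (hv : G.AtMostTwoNeighbors v) (he : G.IsLink e v u) : G.AtMostTwoNeighbors u := by
  obtain ⟨c, d, hcd⟩ := hv
  obtain ⟨d', hd', hne, hnb⟩ : ∃ d' ∈ V(G), d' ≠ u ∧
      ∀ e w, G.IsLink e v w → w = u ∨ w = d' := by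
    obtain ⟨g, d', hg, hd'u⟩ : ∃ g d', G.IsLink g v d' ∧ d' ≠ u := by
      by_cases hau : a = u
      · exact hG.exists_isLink_ne he.left_mem hb hbv (hau ▸ hab.symm)
      · exact hG.exists_isLink_ne he.left_mem ha hav hau
    refine ⟨d', hg.right_mem, hd'u, fun f w hf ↦ ?_⟩
    have h1 := hcd e u he
    have h2 := hcd g d' hg
    have h3 := hcd f w hf
    grind
  have huv := (hG.ne he).symm
  have hd'v : d' ≠ v := by
    rintro rfl
    obtain ⟨g, w, hg, hw⟩ : ∃ g w, G.IsLink g d' w ∧ w ≠ u := by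
      by_cases hau : a = u
      · exact hG.exists_isLink_ne he.left_mem hb hbv (hau ▸ hab.symm)
      · exact hG.exists_isLink_ne he.left_mem ha hav hau
    rcases hnb g w hg with h | h
    exacts [hw h, hG.ne hg h.symm]
  by_cases hthird : ∃ w ∈ V(G), w ≠ v ∧ w ≠ u ∧ w ≠ d'
  · obtain ⟨w, hw, hwv, hwu, hwd⟩ := hthird
    refine atMostTwoNeighbors_of_separating hG hV hirr he.right_mem hd' hne.symm (C := {v})
      (singleton_subset_iff.2 he.left_mem) (by simpa using huv) (by simpa using hd'v) ?_
      (mem_singleton v) hw (by simpa using hwv) hwu hwd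
    rintro g _ b hg rfl _
    exact hnb g b hg
  · push Not at hthird
    refine ⟨v, d', fun g w hg ↦ ?_⟩
    by_contra! h
    exact h.2 (hthird w hg.right_mem h.1 (hG.ne hg).symm)

end Irreducible

section Irreducible

variable {G : Graph α β}

open Classical in
/-- A graph on at least four vertices that stays connected after the removal of any two vertices
does not satisfy the weak weight equalities for `δ > 2`. The complement of each vertex is a good
flat, and the sum of these equalities contradicts the equality for the total weight. -/
lemma IsWeakSpadeWeight.not_threeConnected (hG : G.TwoConnected) (hV : V(G).Finite)
    (hE : E(G).Finite) {δ : ℕ} (hδ : 2 < δ) {w : β → ℕ} (hw : G.IsWeakSpadeWeight δ w)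
    (h4 : 4 ≤ V(G).ncard)
    (h3 : ∀ x ∈ V(G), ∀ y ∈ V(G), x ≠ y → G.ConnOn (V(G) \ {x, y})) : False := by
  have hcard : V(G).ncard = hV.toFinset.card := ncard_eq_toFinset_card _ hV
  have hflat : ∀ v ∈ hV.toFinset,
      (∑ e ∈ hE.toFinset, if ¬ G.Inc e v then w e else 0) + 1 = δ * (V(G).ncard - 2) := by
    intro v hv
    rw [Finite.mem_toFinset] at hv
    have hncard : (V(G) \ {v}).ncard = V(G).ncard - 1 := ncard_sdiff_singleton_of_mem hv
    have hfin : (V(G) \ {v}).Finite := hV.subset sdiff_subset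
    have h2 : G.TwoConnOn (V(G) \ {v}) := by
      refine ⟨(one_lt_ncard hfin).1 (by omega), hG.twoConnOn.conn_diff v hv, fun z hz ↦ ?_⟩
      rw [sdiff_sdiff]
      exact h3 v hv z hz.1 fun h ↦ hz.2 h.symm
    have hgood : G.IsGoodFlat (V(G) \ {v}) := by
      rw [isGoodFlat_iff hG, sdiff_sdiff_cancel_left (singleton_subset_iff.2 hv)]
      exact ⟨⟨sdiff_subset, fun h ↦ (h hv).2 rfl⟩, h2, connOn_singleton G v⟩
    obtain ⟨a, ha, b, hb, c, hc, hab, hac, hbc⟩ := (two_lt_ncard hfin).1 (by omega)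
    have := hw.flat _ hgood (((twoConnected_induce_iff fun e a b ↦ hG.ne).2 h2).edgeSet_nontrivial
      ha hb hab hc hac.symm hbc.symm)
    rw [hncard, Nat.sub_sub] at this
    rw [← this, totalWeight, ← Finset.sum_filter,
      ← finsum_mem_coe_finset]
    congr! 4 with e
    simp only [Finset.coe_filter, Finite.mem_toFinset, mem_ofPred_eq]
    constructor
    · rintro ⟨h1, h2⟩
      obtain ⟨a, b, hab⟩ := exists_isLink_of_mem_edgeSet h1
      refine ⟨a, b, hab, ⟨hab.left_mem, ?_⟩, hab.right_mem, ?_⟩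
      · rintro rfl
        exact h2 hab.inc_left
      · rintro rfl
        exact h2 hab.inc_right
    · rintro ⟨a, b, hab, h1, h2⟩
      refine ⟨hab.edge_mem, fun h ↦ ?_⟩
      rcases h.eq_or_eq_of_isLink hab with rfl | rfl
      exacts [h1.2 rfl, h2.2 rfl]
  -- In the sum of these equalities, an edge is counted once for every vertex that is not its end.
  have hsum := Finset.sum_congr (rfl : hV.toFinset = hV.toFinset) hflat
  have hedge : ∀ e ∈ hE.toFinset, (∑ v ∈ hV.toFinset, if ¬ G.Inc e v then w e else 0) =
      (V(G).ncard - 2) * w e := by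
    intro e he
    rw [Finite.mem_toFinset] at he
    obtain ⟨a, b, hab⟩ := exists_isLink_of_mem_edgeSet he
    rw [← Finset.sum_filter, Finset.sum_const, smul_eq_mul]
    congr 1
    have : hV.toFinset.filter (fun v ↦ ¬ G.Inc e v) = hV.toFinset \ {a, b} := by
      ext v
      simp only [Finset.mem_filter, Finset.mem_sdiff, Finset.mem_insert, Finset.mem_singleton]
      refine and_congr_right fun _ ↦ not_congr ⟨fun h ↦ h.eq_or_eq_of_isLink hab, ?_⟩
      rintro (rfl | rfl)
      exacts [hab.inc_left, hab.inc_right]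
    rw [this, Finset.card_sdiff_of_subset, Finset.card_pair (hG.ne hab), hcard]
    intro v hv
    rw [Finite.mem_toFinset]
    simp only [Finset.mem_insert, Finset.mem_singleton] at hv
    rcases hv with rfl | rfl
    exacts [hab.left_mem, hab.right_mem]
  rw [Finset.sum_add_distrib, Finset.sum_comm, Finset.sum_congr rfl hedge, ← Finset.mul_sum,
    Finset.sum_const, Finset.sum_const, ← hcard] at hsum
  have ht := hw.total
  rw [totalWeight, finsum_mem_eq_finite_toFinset_sum _ hE] at ht
  rw [ht] at hsum
  obtain ⟨k, hk⟩ : ∃ k, V(G).ncard = k + 4 := ⟨_, (Nat.sub_add_cancel h4).symm⟩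
  rw [hk] at hsum
  simp only [smul_eq_mul, show k + 4 - 2 = k + 2 by omega, show k + 4 - 1 = k + 3 by omega] at hsum
  nlinarith [Nat.mul_le_mul (Nat.le_refl (k + 2)) (Nat.succ_le_of_lt hδ)]

/-- In a graph without reducing flats that satisfies the weak weight equalities, all vertices have
at most two neighbours. -/
lemma IsWeakSpadeWeight.atMostTwoNeighbors (hG : G.TwoConnected) (hV : V(G).Finite)
    (hE : E(G).Finite) {δ : ℕ} (hδ : 2 < δ) {w : β → ℕ} (hw : G.IsWeakSpadeWeight δ w)
    (hirr : ∀ S x y, ¬ G.IsReducingFlat S x y) (h3 : 2 < V(G).ncard) :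
    ∀ v ∈ V(G), G.AtMostTwoNeighbors v := by
  by_contra! hc
  obtain ⟨v, hv, hv2⟩ := hc
  have hothers : ∀ v ∈ V(G), ∃ a ∈ V(G), ∃ b ∈ V(G), a ≠ v ∧ b ≠ v ∧ a ≠ b := by
    intro v hv
    have : 1 < (V(G) \ {v}).ncard := by
      rw [ncard_sdiff_singleton_of_mem hv]
      omega
    obtain ⟨a, ha, b, hb, hab⟩ := (one_lt_ncard (hV.subset sdiff_subset)).1 this
    exact ⟨a, ha.1, b, hb.1, ha.2, hb.2, hab⟩
  -- Having at most two neighbours propagates along edges, so no vertex has this property, and no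
  -- pair of vertices separates the graph.
  have hnot : ∀ u ∈ V(G), ¬ G.AtMostTwoNeighbors u := by
    intro u hu hu2
    refine hv2 (hG.twoConnOn.conn.2 _ ?_ u hu v hv hu2)
    intro e a b he ha hb ha2
    obtain ⟨c, hc, d, hd, hca, hda, hcd⟩ := hothers a ha
    exact ha2.of_isLink hG hV hirr hc hd hca hda hcd he
  obtain ⟨a, ha, b, hb, hav, hbv, hab⟩ := hothers v hv
  refine hw.not_threeConnected hG hV hE hδ ?_ fun x hx y hy hne ↦ ?_
  · by_contra h4
    have hV3 : V(G) = {v, a, b} := by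
      symm
      refine eq_of_subset_of_ncard_le ?_ ?_ hV
      · rintro z (rfl | rfl | rfl)
        exacts [hv, ha, hb]
      · rw [ncard_eq_three.2 ⟨v, a, b, hav.symm, hbv.symm, hab, rfl⟩]
        omega
    refine hv2 ⟨a, b, fun e u he ↦ ?_⟩
    have := he.right_mem
    rw [hV3] at this
    exact this.resolve_left (hG.ne he).symm
  · by_contra hconn
    have hne' : (V(G) \ {x, y}).Nonempty := by
      obtain ⟨c, hc, d, hd, hcx, hdx, hcd⟩ := hothers x hx
      by_cases hcy : c = y
      · exact ⟨d, hd, by simp [hdx, ← hcy, hcd.symm]⟩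
      · exact ⟨c, hc, by simp [hcx, hcy]⟩
    obtain ⟨P, hP, ⟨c, hc, hPc⟩, d, hd, hPd⟩ := exists_of_not_connOn hne' hconn
    refine hnot x hx (atMostTwoNeighbors_of_separating hG hV hirr hx hy hne
      (C := {c | c ∈ V(G) \ {x, y} ∧ P c}) (fun c hc ↦ hc.1.1) (fun h ↦ h.1.2 (by simp))
      (fun h ↦ h.1.2 (by simp)) ?_ ⟨hc, hPc⟩ hd.1 (fun h ↦ hPd h.2)
      (fun h ↦ hd.2 (.inl h)) (fun h ↦ hd.2 (.inr h)))
    intro e a b he ha hb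
    by_contra h
    have hb' : b ∈ V(G) \ {x, y} := ⟨he.right_mem, h⟩
    exact hb ⟨hb', hP e a b he ha.1 hb' ha.2⟩

end Irreducible

/-! ### Cycles -/

lemma image_Iio_eq_range_zmod {γ : Type*} (f : ℕ → γ) (n : ℕ) [NeZero n] :
    f '' Iio n = range fun i : ZMod n ↦ f i.val := by
  ext z
  constructor
  · rintro ⟨i, hi, rfl⟩
    exact ⟨(i : ZMod n), by simp only [ZMod.val_natCast_of_lt (show i < n from hi)]⟩
  · rintro ⟨i, rfl⟩
    exact ⟨i.val, ZMod.val_lt i, rfl⟩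

lemma isCycleOfLength_of_nat {G : Graph α β} {n : ℕ} {p : ℕ → α} {q : ℕ → β} (hn : 0 < n)
    (hp : InjOn p (Iio n)) (hq : InjOn q (Iio n)) (hV : V(G) = p '' Iio n)
    (hE : E(G) = q '' Iio n)
    (hlink : ∀ i < n, G.IsLink (q i) (p i) (p (if i + 1 = n then 0 else i + 1))) :
    G.IsCycleOfLength n := by
  have : NeZero n := ⟨hn.ne'⟩
  refine ⟨fun i ↦ p i.val, fun i ↦ q i.val, fun i j h ↦ ?_, fun i j h ↦ ?_, ?_, ?_, fun i ↦ ?_⟩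
  · exact ZMod.val_injective n (hp (ZMod.val_lt i) (ZMod.val_lt j) h)
  · exact ZMod.val_injective n (hq (ZMod.val_lt i) (ZMod.val_lt j) h)
  · rw [hV, image_Iio_eq_range_zmod]
  · rw [hE, image_Iio_eq_range_zmod]
  · have h1 := hlink i.val (ZMod.val_lt i)
    have h2 : (i + 1).val = if i.val + 1 = n then 0 else i.val + 1 := by
      have h3 : i + 1 = ((i.val + 1 : ℕ) : ZMod n) := by simp
      have h4 := ZMod.val_lt i
      rw [h3, ZMod.val_natCast]
      split_ifs with h
      · rw [h, Nat.mod_self]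
      · exact Nat.mod_eq_of_lt (by omega)
    simpa only [h2] using h1

/-- A 2-connected graph without parallel edges in which all vertices have at most two neighbours is
a cycle: a path that cannot be extended closes up. -/
lemma exists_isCycleOfLength {G : Graph α β} (hG : G.TwoConnected) (hV : V(G).Finite)
    (h3 : 2 < V(G).ncard) (hpar : ∀ x y f g, G.IsLink f x y → G.IsLink g x y → f = g)
    (h2 : ∀ v ∈ V(G), G.AtMostTwoNeighbors v) : ∃ n, 2 < n ∧ G.IsCycleOfLength n := by
  -- `Q m` says that there is a path with `m` edges.
  let Q : ℕ → Prop := fun m ↦ ∃ p : ℕ → α, InjOn p (Iic m) ∧ (∀ i ≤ m, p i ∈ V(G)) ∧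
    ∀ i < m, G.Adj (p i) (p (i + 1))
  have htwo : ∀ v ∈ V(G), ∀ a, ∃ e u, G.IsLink e v u ∧ u ≠ a := by
    intro v hv a
    have : ¬ V(G) ⊆ {v, a} := by
      intro h
      have h1 := ncard_le_ncard h (by simp)
      have h2 := ncard_insert_le v {a}
      rw [ncard_singleton] at h2
      omega
    obtain ⟨c, hc, hc'⟩ := not_subset.1 this
    exact hG.exists_isLink_ne hv hc (fun h ↦ hc' (.inl h)) (fun h ↦ hc' (.inr h))
  obtain ⟨m, ⟨p, hp, hpV, hadj⟩, hmax⟩ : ∃ m, Q m ∧ ¬ Q (m + 1) := by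
    by_contra! h
    have hall : ∀ m, Q m := by
      intro m
      induction m with
      | zero =>
        obtain ⟨v, hv⟩ := hG.nontrivial.nonempty
        exact ⟨fun _ ↦ v, fun i hi j hj _ ↦ (Nat.le_zero.1 hi).trans (Nat.le_zero.1 hj).symm,
          fun _ _ ↦ hv, by simp⟩
      | succ m ih => exact h m ih
    obtain ⟨p, hp, hpV, -⟩ := hall V(G).ncard
    have h1 := ncard_le_ncard (show p '' Iic V(G).ncard ⊆ V(G) by
      rintro _ ⟨i, hi, rfl⟩
      exact hpV i hi) hV
    rw [hp.ncard_image, ← Finset.coe_Iic, ncard_coe_finset, Nat.card_Iic] at h1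
    omega
  have hend : ∀ e u, G.IsLink e (p m) u → ∃ j ≤ m, u = p j := by
    intro e u he
    by_contra! h
    refine hmax ⟨Function.update p (m + 1) u, ?_, ?_, ?_⟩
    · intro i hi j hj hij
      rw [mem_Iic] at hi hj
      rcases Nat.lt_or_ge m i with hi' | hi' <;> rcases Nat.lt_or_ge m j with hj' | hj'
      · omega
      · obtain rfl : i = m + 1 := by omega
        rw [Function.update_self, Function.update_of_ne (by omega)] at hij
        exact absurd hij (h j hj')
      · obtain rfl : j = m + 1 := by omega
        rw [Function.update_self, Function.update_of_ne (by omega)] at hij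
        exact absurd hij.symm (h i hi')
      · rw [Function.update_of_ne (by omega), Function.update_of_ne (by omega)] at hij
        exact hp hi' hj' hij
    · intro i hi
      by_cases him : i = m + 1
      · rw [him, Function.update_self]
        exact he.right_mem
      · rw [Function.update_of_ne him]
        exact hpV i (by omega)
    · intro i hi
      rw [Function.update_of_ne (by omega)]
      by_cases him : i = m
      · rw [him, Function.update_self]
        exact he.adj
      · rw [Function.update_of_ne (by omega)]
        exact hadj i (by omega)
  have hinj : ∀ i j, i ≤ m → j ≤ m → p i = p j → i = j := fun i j hi hj h ↦ hp hi hj h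
  -- A third neighbour is impossible.
  have hthree : ∀ i, ∀ a b c, G.Adj (p i) a → G.Adj (p i) b → G.Adj (p i) c → a ≠ b →
      c = a ∨ c = b := by
    rintro i a b c ⟨e, he⟩ ⟨f, hf⟩ ⟨g, hg⟩ hab
    obtain ⟨s, t, hst⟩ := h2 _ he.left_mem
    have h1 := hst e a he
    have h2 := hst f b hf
    have h3 := hst g c hg
    grind
  -- The end `p m` has a second neighbour, on the path. It is `p 0`, since an inner vertex of the
  -- path already has two other neighbours.
  obtain ⟨hm2, hclose⟩ : 2 ≤ m ∧ G.Adj (p m) (p 0) := by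
    obtain ⟨e, u, he, hu⟩ := htwo (p m) (hpV m le_rfl) (p (m - 1))
    obtain ⟨j, hj, rfl⟩ := hend e u he
    have hjm : j ≠ m := by
      rintro rfl
      exact hG.ne he rfl
    have hjm' : j ≠ m - 1 := by
      rintro rfl
      exact hu rfl
    by_cases hj0 : j = 0
    · subst hj0
      exact ⟨by omega, he.adj⟩
    · exfalso
      have h1 := hadj (j - 1) (by omega)
      rw [Nat.sub_add_cancel (by omega)] at h1
      have h2 := hadj j (by omega)
      rcases hthree j (p (j - 1)) (p (j + 1)) (p m) h1.symm h2 he.symm.adj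
        (fun h ↦ by have := hinj _ _ (by omega) (by omega) h; omega) with h | h
      · have := hinj _ _ (by omega) (by omega) h
        omega
      · have := hinj _ _ (by omega) (by omega) h
        omega
  have hnext : ∀ i ≤ m, G.Adj (p i) (p (if i + 1 = m + 1 then 0 else i + 1)) := by
    intro i hi
    split_ifs with h
    · obtain rfl : i = m := by omega
      exact hclose
    · exact hadj i (by omega)
  have hnb : ∀ i ≤ m, ∀ u, G.Adj (p i) u → ∃ j ≤ m, u = p j ∧
      ((if i + 1 = m + 1 then 0 else i + 1) = j ∨ (if j + 1 = m + 1 then 0 else j + 1) = i) := by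
    intro i hi u hu
    obtain ⟨j, hj, hji⟩ : ∃ j ≤ m, (if j + 1 = m + 1 then 0 else j + 1) = i := by
      by_cases hi0 : i = 0
      · exact ⟨m, le_rfl, by simp [hi0]⟩
      · exact ⟨i - 1, by omega, by split_ifs <;> omega⟩
    have h1 := hnext j hj
    rw [hji] at h1
    have hle : (if i + 1 = m + 1 then 0 else i + 1) ≤ m := by
      split_ifs <;> omega
    rcases hthree i _ _ u (hnext i hi) h1.symm hu
      (fun h ↦ by have := hinj _ _ hle hj h; split_ifs at * <;> omega) with h | h
    exacts [⟨_, hle, h, .inl rfl⟩, ⟨j, hj, h, .inr hji⟩]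
  -- No edge leaves the cycle, so it contains all vertices.
  have hVp : V(G) = p '' Iio (m + 1) := by
    refine Subset.antisymm (fun v hv ↦ ?_) ?_
    · refine hG.twoConnOn.conn.2 (fun a ↦ a ∈ p '' Iio (m + 1)) ?_ (p 0) (hpV 0 (by omega)) v hv
        ⟨0, by simp, rfl⟩
      rintro e _ b he _ _ ⟨i, hi, rfl⟩
      obtain ⟨j, hj, rfl, -⟩ := hnb i (Nat.lt_succ_iff.1 hi) b he.adj
      exact ⟨j, Nat.lt_succ_iff.2 hj, rfl⟩
    · rintro _ ⟨i, hi, rfl⟩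
      exact hpV i (Nat.lt_succ_iff.1 hi)
  have hchoice : ∀ i, ∃ e, i ≤ m → G.IsLink e (p i) (p (if i + 1 = m + 1 then 0 else i + 1)) := by
    intro i
    by_cases hi : i ≤ m
    · obtain ⟨e, he⟩ := hnext i hi
      exact ⟨e, fun _ ↦ he⟩
    · obtain ⟨e, -⟩ := hnext 0 (by omega)
      exact ⟨e, fun h ↦ absurd h hi⟩
  choose q hq using hchoice
  refine ⟨m + 1, by omega, isCycleOfLength_of_nat (by omega) (fun i hi j hj h ↦ hinj i j
    (Nat.lt_succ_iff.1 hi) (Nat.lt_succ_iff.1 hj) h) ?_ hVp ?_ fun i hi ↦ hq i (by omega)⟩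
  · intro i hi j hj hij
    rw [mem_Iio] at hi hj
    have h1 := hq i (by omega)
    have h2 := hq j (by omega)
    rw [hij] at h1
    obtain ⟨h3, -⟩ | ⟨h3, h4⟩ := h1.eq_and_eq_or_eq_and_eq h2
    · exact hinj i j (by omega) (by omega) h3
    · have h5 := hinj _ _ (by omega) (by split_ifs <;> omega) h3
      have h6 := hinj _ _ (by split_ifs <;> omega) (by omega) h4
      split_ifs at h5 h6 <;> omega
  · refine Subset.antisymm (fun e he ↦ ?_) ?_
    · obtain ⟨a, b, hab⟩ := exists_isLink_of_mem_edgeSet he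
      have ha := hab.left_mem
      rw [hVp] at ha
      obtain ⟨i, hi, rfl⟩ := ha
      rw [mem_Iio] at hi
      obtain ⟨j, hj, rfl, hij | hij⟩ := hnb i (by omega) b hab.adj
      · have := hq i (by omega)
        rw [hij] at this
        exact ⟨i, hi, hpar _ _ _ _ this hab⟩
      · have := hq j hj
        rw [hij] at this
        exact ⟨j, Nat.lt_succ_iff.2 hj, hpar _ _ _ _ this.symm hab⟩
    · rintro _ ⟨i, hi, rfl⟩
      exact (hq i (Nat.lt_succ_iff.1 hi)).edge_mem

namespace IsCycleOfLength

variable {G : Graph α β} {n : ℕ}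

lemma ncard_verts (h : G.IsCycleOfLength n) : V(G).ncard = n := by
  obtain ⟨c, d, hc, -, hV, -⟩ := h
  rw [hV, ← image_univ, ncard_image_of_injective _ hc, ncard_univ, Nat.card_zmod]

lemma ncard_edges (h : G.IsCycleOfLength n) : E(G).ncard = n := by
  obtain ⟨c, d, -, hd, -, hE, -⟩ := h
  rw [hE, ← image_univ, ncard_image_of_injective _ hd, ncard_univ, Nat.card_zmod]

lemma finite (h : G.IsCycleOfLength n) (hn : 0 < n) : V(G).Finite ∧ E(G).Finite :=
  ⟨finite_of_ncard_pos (by rwa [h.ncard_verts]), finite_of_ncard_pos (by rwa [h.ncard_edges])⟩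

lemma eq_of_parallel (h : G.IsCycleOfLength n) (hn : 2 < n) {x y : α} {f g : β}
    (hf : G.IsLink f x y) (hg : G.IsLink g x y) : f = g := by
  obtain ⟨c, d, hc, hd, hV, hE, hl⟩ := h
  have key : ∀ f ∈ E(G), ∃ i, f = d i := by
    intro f hf
    rw [hE] at hf
    obtain ⟨i, rfl⟩ := hf
    exact ⟨i, rfl⟩
  obtain ⟨i, rfl⟩ := key f hf.edge_mem
  obtain ⟨j, rfl⟩ := key g hg.edge_mem
  have hne : (2 : ZMod n) ≠ 0 := by
    intro h2
    have : ((2 : ℕ) : ZMod n) = 0 := by exact_mod_cast h2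
    rw [ZMod.natCast_eq_zero_iff] at this
    exact absurd (Nat.le_of_dvd (by norm_num) this) (by omega)
  have hg' : G.IsLink (d j) (c i) (c (i + 1)) := by
    obtain ⟨rfl, rfl⟩ | ⟨rfl, rfl⟩ := (hl i).eq_and_eq_or_eq_and_eq hf
    exacts [hg, hg.symm]
  obtain ⟨h1, -⟩ | ⟨h1, h2⟩ := hg'.eq_and_eq_or_eq_and_eq (hl j)
  · rw [hc h1]
  · have h3 := hc h1
    have h4 := hc h2
    refine absurd ?_ hne
    rw [← h4] at h3
    linear_combination -h3

/-- Each vertex of a cycle has exactly two neighbours. -/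
lemma exists_neighbors (h : G.IsCycleOfLength n) (hn : 2 < n) {v : α} (hv : v ∈ V(G)) {e : β}
    {u : α} (he : G.IsLink e v u) : ∃ o ∈ V(G), o ≠ u ∧ o ≠ v ∧
      ∀ f w, G.IsLink f v w → w = u ∨ w = o := by
  obtain ⟨c, d, hc, hd, hV, hE, hl⟩ := h
  rw [hV] at hv
  obtain ⟨i, rfl⟩ := hv
  have hnb : ∀ f w, G.IsLink f (c i) w → w = c (i + 1) ∨ w = c (i - 1) := by
    intro f w hf
    have hfE := hf.edge_mem
    rw [hE] at hfE
    obtain ⟨j, rfl⟩ := hfE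
    obtain ⟨h1, h2⟩ | ⟨h1, h2⟩ := hf.eq_and_eq_or_eq_and_eq (hl j)
    · exact .inl (by rw [h2, hc h1])
    · refine .inr ?_
      rw [h2, hc h1]
      simp
  have hmem : ∀ j, c j ∈ V(G) := fun j ↦ hV ▸ mem_range_self j
  have hcast : ∀ k : ℕ, 0 < k → k < n → (k : ZMod n) ≠ 0 := by
    intro k hk hkn h2
    rw [ZMod.natCast_eq_zero_iff] at h2
    exact absurd (Nat.le_of_dvd hk h2) (by omega)
  have h1 : (1 : ZMod n) ≠ 0 := by exact_mod_cast hcast 1 (by omega) (by omega)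
  have h2 : (2 : ZMod n) ≠ 0 := by exact_mod_cast hcast 2 (by omega) (by omega)
  have n1 : c (i + 1) ≠ c i := fun h' ↦ h1 (by linear_combination hc h')
  have n2 : c (i - 1) ≠ c i := fun h' ↦ h1 (by linear_combination -hc h')
  have n3 : c (i - 1) ≠ c (i + 1) := fun h' ↦ h2 (by linear_combination -hc h')
  rcases hnb e u he with rfl | rfl
  · exact ⟨c (i - 1), hmem _, n3, n2, hnb⟩
  · exact ⟨c (i + 1), hmem _, n3.symm, n1, fun f w hf ↦ (hnb f w hf).symm⟩

/-- Removing fewer than `n` consecutive vertices of a cycle leaves a connected set. -/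
lemma connOn_diff {c : ZMod n → α} {d : ZMod n → β} (hc : c.Injective) (hV : V(G) = range c)
    (hl : ∀ i, G.IsLink (d i) (c i) (c (i + 1))) (k : ZMod n) {r : ℕ} (hr : r < n) :
    G.ConnOn (V(G) \ {v | ∃ j < r, v = c (k + (j : ℕ))}) := by
  have : NeZero n := ⟨by omega⟩
  have hrep : ∀ i : ZMod n, ∃ j < n, i = k + (j : ℕ) := fun i ↦
    ⟨(i - k).val, ZMod.val_lt _, by simp⟩
  have hinj : ∀ j j' : ℕ, j < n → j' < n → c (k + (j : ℕ)) = c (k + (j' : ℕ)) → j = j' := by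
    intro j j' hj hj' h
    have := add_left_cancel (hc h)
    rwa [ZMod.natCast_eq_natCast_iff', Nat.mod_eq_of_lt hj, Nat.mod_eq_of_lt hj'] at this
  have hset : ∀ v, v ∈ V(G) \ {v | ∃ j < r, v = c (k + (j : ℕ))} ↔
      ∃ j, r ≤ j ∧ j < n ∧ v = c (k + (j : ℕ)) := by
    intro v
    rw [hV]
    constructor
    · rintro ⟨⟨i, rfl⟩, h2⟩
      obtain ⟨j, hj, rfl⟩ := hrep i
      refine ⟨j, ?_, hj, rfl⟩
      by_contra h
      exact h2 ⟨j, by omega, rfl⟩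
    · rintro ⟨j, h1, h2, rfl⟩
      refine ⟨mem_range_self _, ?_⟩
      rintro ⟨j', h3, h4⟩
      have := hinj j j' h2 (by omega) h4
      omega
  refine ⟨⟨c (k + (r : ℕ)), (hset _).2 ⟨r, le_rfl, hr, rfl⟩⟩, fun P hP ↦ ?_⟩
  have key : ∀ j, r ≤ j → j < n → (P (c (k + (j : ℕ))) ↔ P (c (k + (r : ℕ)))) := by
    intro j hj
    induction j, hj using Nat.le_induction with
    | base => exact fun _ ↦ Iff.rfl
    | succ j hj ih =>
      intro hjn
      have h1 := hl (k + (j : ℕ))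
      rw [add_assoc, ← Nat.cast_succ] at h1
      have m1 := (hset _).2 ⟨j, hj, by omega, rfl⟩
      have m2 := (hset _).2 ⟨j + 1, by omega, hjn, rfl⟩
      exact Iff.trans ⟨hP _ _ _ h1.symm m2 m1, hP _ _ _ h1 m1 m2⟩ (ih (by omega))
  intro a ha b hb
  obtain ⟨i, h1, h2, rfl⟩ := (hset a).1 ha
  obtain ⟨j, h3, h4, rfl⟩ := (hset b).1 hb
  exact ((key i h1 h2).trans (key j h3 h4).symm).1

lemma twoConnected (h : G.IsCycleOfLength n) (hn : 1 < n) : G.TwoConnected := by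
  obtain ⟨c, d, hc, hd, hV, hE, hl⟩ := h
  have : Fact (1 < n) := ⟨hn⟩
  have h01 : c 0 ≠ c 1 := fun h ↦ zero_ne_one (hc h)
  refine twoConnected_iff.2 ⟨?_, ⟨c 0, hV ▸ mem_range_self _, c 1, hV ▸ mem_range_self _, h01⟩,
    ?_, fun x hx ↦ ?_⟩
  · intro e x y he
    have heE := he.edge_mem
    rw [hE] at heE
    obtain ⟨i, rfl⟩ := heE
    have : c i ≠ c (i + 1) := fun h' ↦ one_ne_zero (α := ZMod n) (by linear_combination -hc h')
    obtain ⟨rfl, rfl⟩ | ⟨rfl, rfl⟩ := he.eq_and_eq_or_eq_and_eq (hl i)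
    exacts [this, this.symm]
  · convert connOn_diff hc hV hl 0 (r := 0) (by omega) using 1
    ext; simp
  · rw [hV] at hx
    obtain ⟨k, rfl⟩ := hx
    convert connOn_diff hc hV hl k (r := 1) hn using 1
    ext; simp

lemma contract (h : G.IsCycleOfLength n) (hn : 2 < n) {e : β} (he : e ∈ E(G)) :
    (G.contractEdge e).TwoConnected := by
  have hG := h.twoConnected (by omega)
  have hpar := fun x y f g ↦ h.eq_of_parallel hn (x := x) (y := y) (f := f) (g := g)
  obtain ⟨c, d, hc, hd, hV, hE, hl⟩ := h
  rw [hE] at he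
  obtain ⟨i, rfl⟩ := he
  rw [contractEdge_twoConnected_iff hG (hl i)]
  refine ⟨fun f hf ↦ hpar _ _ _ _ hf (hl i), ?_⟩
  convert connOn_diff hc hV hl i (r := 2) hn using 2
  ext v
  simp only [mem_insert_iff, mem_singleton_iff, mem_ofPred_eq]
  constructor
  · rintro (rfl | rfl)
    exacts [⟨0, by omega, by simp⟩, ⟨1, by omega, by simp⟩]
  · rintro ⟨j, hj, rfl⟩
    interval_cases j <;> simp

lemma not_delete (h : G.IsCycleOfLength n) (hn : 2 < n) {e : β} (he : e ∈ E(G)) :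
    ¬ (G.deleteEdges {e}).TwoConnected := by
  intro hd
  obtain ⟨a, b, hab⟩ := exists_isLink_of_mem_edgeSet he
  obtain ⟨o, ho, hob, hoa, hnb⟩ := h.exists_neighbors hn hab.left_mem hab
  obtain ⟨f, u, hf, hu⟩ := hd.exists_isLink_ne (a := o) hab.left_mem hab.right_mem
    ((h.twoConnected (by omega)).ne hab).symm hob.symm
  rcases hnb f u hf.1 with rfl | rfl
  · exact hf.2 (h.eq_of_parallel hn hf.1 hab)
  · exact hu rfl

/-- The only good flats of a cycle are its edges. -/
lemma edgeSet_induce_subsingleton (h : G.IsCycleOfLength n) (hn : 2 < n) {S : Set α}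
    (hS : G.IsGoodFlat S) : E(G.induce S).Subsingleton := by
  have hG := h.twoConnected (by omega)
  obtain ⟨s, hs⟩ := hS.restrict.nontrivial.nonempty
  rw [vertexSet_induce] at hs
  obtain ⟨t, ht, htS⟩ := not_subset.1 hS.ssubset.2
  -- An edge leaves `S`, from a vertex `a` with a single neighbour in `S`.
  obtain ⟨e, a, b, hab, ha, hb⟩ : ∃ e a b, G.IsLink e a b ∧ a ∈ S ∧ b ∉ S := by
    by_contra! hc
    exact htS (hG.twoConnOn.conn.2 (fun a ↦ a ∈ S) (fun e a b he _ _ ha ↦ hc e a b he ha) s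
      (hS.ssubset.subset hs) t ht hs)
  obtain ⟨o, ho, hob, hoa, hnb⟩ := h.exists_neighbors hn hab.left_mem hab
  have hsub : ∀ u ∈ S, u = a ∨ u = o := by
    intro u hu
    by_contra! hc
    obtain ⟨f, w, hf, hw⟩ := hS.restrict.exists_isLink_ne (v := a) (a := o) (c := u) ha hu hc.1 hc.2
    rcases hnb f w hf.1 with rfl | rfl
    exacts [hb hf.2.2, hw rfl]
  have hlink : ∀ f ∈ E(G.induce S), G.IsLink f a o := by
    rintro f ⟨u, w, hf, hu, hw⟩
    have hne := hG.ne hf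
    rcases hsub u hu with rfl | rfl <;> rcases hsub w hw with rfl | rfl
    exacts [absurd rfl hne, hf, hf.symm, absurd rfl hne]
  exact fun f hf g hg ↦ h.eq_of_parallel hn (hlink f hf) (hlink g hg)

lemma isSpadeWeight {δ : ℕ} (h : G.IsCycleOfLength δ) (hδ : 2 < δ) :
    G.IsSpadeWeight δ fun _ ↦ δ - 1 := by
  refine IsWeakSpadeWeight.isSpadeWeight (h.twoConnected (by omega)) hδ
    ⟨fun e he ↦ .inr ⟨rfl, h.contract hδ he⟩, ?_, fun S hS hnt ↦ ?_⟩
    (fun e he hd ↦ absurd hd (h.not_delete hδ he)) (fun _ _ _ ↦ rfl)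
  · rw [totalWeight_const G (h.finite (by omega)).2, h.ncard_edges, h.ncard_verts]
  · exact absurd hnt (not_nontrivial_iff.2 (h.edgeSet_induce_subsingleton hδ hS))

end IsCycleOfLength

/-! ### Bonds -/

lemma twoConnected_of_bond {G : Graph α β} {x y : α} (hne : x ≠ y) (hV : V(G) = {x, y})
    (hlink : ∀ e ∈ E(G), G.IsLink e x y) (hE : E(G).Nonempty) : G.TwoConnected := by
  obtain ⟨e, he⟩ := hE
  refine twoConnected_iff.2 ⟨fun f a b hf ↦ ?_, hV ▸ twoConnOn_pair (hlink e he) hne⟩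
  obtain ⟨rfl, rfl⟩ | ⟨rfl, rfl⟩ := hf.eq_and_eq_or_eq_and_eq (hlink f hf.edge_mem)
  exacts [hne, hne.symm]

lemma not_contract_of_pair {G : Graph α β} (hG : G.TwoConnected) {x y : α} (hV : V(G) = {x, y})
    {e : β} (he : e ∈ E(G)) : ¬ (G.contractEdge e).TwoConnected := by
  rw [contractEdge_twoConnected_iff hG (isLink_of_verts_pair hG hV he), hV]
  rintro ⟨-, ⟨z, hz⟩, -⟩
  exact hz.2 hz.1

lemma isSpadeWeight_of_bond {G : Graph α β} {δ : ℕ} {x y : α} (hG : G.TwoConnected)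
    (hV : V(G) = {x, y}) (hE : E(G).Finite) (hcard : E(G).ncard = δ) :
    G.IsSpadeWeight δ fun _ ↦ 1 where
  values _ _ := .inl rfl
  of_delete _ _ _ := rfl
  of_contract e he hc := absurd hc (not_contract_of_pair hG hV he)
  total := by
    have hne : x ≠ y := by
      rintro rfl
      have := hG.nontrivial
      simp [hV] at this
    rw [totalWeight_const G hE, hcard, hV, ncard_pair hne]
  flat S hS := by
    have h1 := hS.ssubset
    have h2 := (one_lt_ncard (hV ▸ (by simp : ({x, y} : Set α).Finite) |>.subset h1.subset)).2
      hS.restrict.nontrivial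
    have h3 := ncard_lt_ncard h1 (hV ▸ by simp)
    have h4 := ncard_insert_le x {y}
    rw [ncard_singleton, ← hV] at h4
    rw [vertexSet_induce] at h2
    omega

/-! ### Graphs with the weak weight equalities -/

/-- A graph with the weak weight equalities is a `δ`-cycle, a bond with `δ` edges, or has a
reducing flat. -/
theorem IsWeakSpadeWeight.cycle_or_bond_or_reducing {G : Graph α β} (hG : G.TwoConnected)
    (hV : V(G).Finite) (hE : E(G).Finite) {δ : ℕ} (hδ : 2 < δ) {w : β → ℕ}
    (hw : G.IsWeakSpadeWeight δ w) : G.IsCycleOfLength δ ∨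
      (∃ x y, V(G) = {x, y} ∧ E(G).ncard = δ) ∨ ∃ S x y, G.IsReducingFlat S x y := by
  have h2 := hG.two_le_ncard hV
  by_cases h3 : 2 < V(G).ncard
  swap
  · -- With two vertices, no edge can be contracted.
    obtain ⟨x, y, hne, hxy⟩ := ncard_eq_two.1 (show V(G).ncard = 2 by omega)
    refine .inr (.inl ⟨x, y, hxy, ?_⟩)
    have h1 : ∀ e ∈ E(G), w e = 1 := fun e he ↦
      (hw.values e he).elim And.left fun h ↦ absurd h.2 (not_contract_of_pair hG hxy he)
    have ht := hw.total
    rw [totalWeight_congr (w' := fun _ ↦ 1) rfl h1, totalWeight_const G hE, hxy,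
      ncard_pair hne] at ht
    omega
  by_cases hirr : ∃ S x y, G.IsReducingFlat S x y
  · exact .inr (.inr hirr)
  push Not at hirr
  have hpar : ∀ x y f g, G.IsLink f x y → G.IsLink g x y → f = g := by
    intro x y f g hf hg
    have : ¬ V(G) ⊆ {x, y} := by
      intro h
      have h1 := ncard_le_ncard h (by simp)
      have h2 := ncard_insert_le x {y}
      rw [ncard_singleton] at h2
      omega
    obtain ⟨v, hv, hv'⟩ := not_subset.1 this
    exact eq_of_parallel hG hirr ⟨hv, hv'⟩ hf hg
  obtain ⟨n, hn, hcyc⟩ := exists_isCycleOfLength hG hV h3 hpar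
    (hw.atMostTwoNeighbors hG hV hE hδ hirr h3)
  -- All weights of a cycle are `δ - 1`, which determines its length.
  have h1 : ∀ e ∈ E(G), w e = δ - 1 := fun e he ↦
    (hw.values e he).elim (fun h ↦ absurd h.2 (hcyc.not_delete hn he)) And.left
  have ht := hw.total
  rw [totalWeight_congr (w' := fun _ ↦ δ - 1) rfl h1, totalWeight_const G hE,
    hcyc.ncard_verts, hcyc.ncard_edges] at ht
  obtain ⟨a, rfl⟩ : ∃ a, δ = a + 1 := ⟨δ - 1, by omega⟩
  obtain ⟨b, rfl⟩ : ∃ b, n = b + 1 := ⟨n - 1, by omega⟩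
  simp only [Nat.add_sub_cancel] at ht
  have : a = b := by linarith
  exact .inl (this ▸ hcyc)

open Classical in
/-- The weight function on a 2-sum that is given by weight functions on the summands. -/
noncomputable def glueWeight (G₁ : Graph α β) (e₁ : β) (w₁ w₂ : β → ℕ) (e : β) : ℕ :=
  if e ∈ E(G₁) ∧ e ≠ e₁ then w₁ e else w₂ e

lemma IsTwoSum.glueWeight_left {G₁ : Graph α β} {e₁ : β} {w₁ w₂ : β → ℕ} :
    ∀ e ∈ E(G₁), e ≠ e₁ → glueWeight G₁ e₁ w₁ w₂ e = w₁ e :=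
  fun _ he hne ↦ if_pos ⟨he, hne⟩

lemma IsTwoSum.glueWeight_right {G₁ G₂ G : Graph α β} {e₁ e₂ : β} {x y : α} {w₁ w₂ : β → ℕ}
    (h : IsTwoSum G₁ G₂ e₁ e₂ x y G) :
    ∀ e ∈ E(G₂), e ≠ e₂ → glueWeight G₁ e₁ w₁ w₂ e = w₂ e :=
  fun e he hne ↦ if_neg fun h' ↦ hne (h.disj e h'.1 h'.2 he)

/-- The decomposition of a graph with the weak weight equalities along a reducing flat. -/
lemma IsReducingFlat.split {G : Graph α β} (hG : G.TwoConnected) (hV : V(G).Finite)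
    (hE : E(G).Finite) {δ : ℕ} (hδ : 2 < δ) {w : β → ℕ} (hw : G.IsWeakSpadeWeight δ w)
    {S : Set α} {x y : α} (h : G.IsReducingFlat S x y) {e₁ e₂ : β} (he₁ : e₁ ∉ E(G.induce S))
    (he₂ : e₂ ∉ E(G) \ E(G.induce S)) :
    ∃ (G₁ G₂ : Graph α β) (w₁ w₂ : β → ℕ), IsTwoSum G₁ G₂ e₁ e₂ x y G ∧
      (V(G₁).Finite ∧ V(G₂).Finite ∧ E(G₁).Finite ∧ E(G₂).Finite) ∧
      V(G₁).ncard + E(G₁).ncard < V(G).ncard + E(G).ncard ∧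
      V(G₂).ncard + E(G₂).ncard < V(G).ncard + E(G).ncard ∧
      E(G₁) = insert e₁ E(G.induce S) ∧ E(G₂) = insert e₂ (E(G) \ E(G.induce S)) ∧
      (G₁.deleteEdges {e₁}).TwoConnected ∧ (G₂.contractEdge e₂).TwoConnected ∧
      G₁.IsWeakSpadeWeight δ w₁ ∧ G₂.IsWeakSpadeWeight δ w₂ := by
  obtain ⟨G₁, G₂, hsum, hV₁, hE₁, hV₂, hE₂, hd, hc⟩ := h.exists_isTwoSum hG he₁ he₂
  have hsub := edgeSet_induce_subset G S
  have hESfin := hE.subset hsub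
  have hV₁fin : V(G₁).Finite := hV₁ ▸ hV.subset h.isGoodFlat.ssubset.subset
  have hV₂fin := hV.subset hV₂
  have hE₁fin : E(G₁).Finite := hE₁ ▸ hESfin.insert e₁
  have hE₂fin : E(G₂).Finite := hE₂ ▸ (hE.subset sdiff_subset).insert e₂
  have hE₁' : E(G₁) \ {e₁} = E(G.induce S) := by
    rw [hE₁, insert_sdiff_self_of_notMem he₁]
  obtain ⟨hw₁, hw₂⟩ := hsum.isWeakSpadeWeight hG hδ hV₁fin hV₂fin hE₁fin hE₂fin hd hc
    (hE₁' ▸ h.nontrivial) hw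
  refine ⟨G₁, G₂, _, _, hsum, ⟨hV₁fin, hV₂fin, hE₁fin, hE₂fin⟩, ?_, ?_, hE₁, hE₂, hd, hc, hw₁, hw₂⟩
  · have h1 : V(G₁).ncard < V(G).ncard := ncard_lt_ncard (hV₁ ▸ h.isGoodFlat.ssubset) hV
    have h2 : E(G.induce S).ncard < E(G).ncard := by
      refine ncard_lt_ncard ⟨hsub, fun hsup ↦ ?_⟩ hE
      obtain ⟨v, hv, hvS⟩ := not_subset.1 h.isGoodFlat.ssubset.2
      obtain ⟨e, u, he⟩ := hG.exists_isLink hv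
      obtain ⟨a, b, hab, ha, hb⟩ := hsup he.edge_mem
      rcases he.left_eq_or_eq hab with rfl | rfl
      exacts [hvS ha, hvS hb]
    have h3 := ncard_insert_le e₁ E(G.induce S)
    rw [← hE₁] at h3
    omega
  · have h1 : V(G₂).ncard ≤ V(G).ncard := ncard_le_ncard hV₂ hV
    have h2 : 1 < E(G.induce S).ncard := (one_lt_ncard hESfin).2 h.nontrivial
    have h3 := ncard_insert_le e₂ (E(G) \ E(G.induce S))
    have h4 := ncard_sdiff_add_ncard_of_subset hsub hE
    rw [← hE₂] at h3
    omega

/-- The weak weight equalities imply the weight equalities: in particular, no edge can be both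
deleted and contracted. -/
theorem IsWeakSpadeWeight.exists_isSpadeWeight {G : Graph α β} (hG : G.TwoConnected)
    (hV : V(G).Finite) (hE : E(G).Finite) {δ : ℕ} (hδ : 2 < δ) {w : β → ℕ}
    (hw : G.IsWeakSpadeWeight δ w) : ∃ w', G.IsSpadeWeight δ w' := by
  obtain ⟨n, hn⟩ : ∃ n, V(G).ncard + E(G).ncard = n := ⟨_, rfl⟩
  induction n using Nat.strong_induction_on generalizing G w with
  | _ n ih =>
  rcases hw.cycle_or_bond_or_reducing hG hV hE hδ with h | ⟨x, y, hxy, hcard⟩ | ⟨S, x, y, hS⟩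
  · exact ⟨_, h.isSpadeWeight hδ⟩
  · exact ⟨_, isSpadeWeight_of_bond hG hxy hE hcard⟩
  · -- The labels of the glued edges may be taken from the opposite sides.
    obtain ⟨e₂, he₂⟩ := hS.nontrivial.nonempty
    obtain ⟨e₁, he₁⟩ : ∃ e₁, e₁ ∉ E(G.induce S) := by
      obtain ⟨v, hv, hvS⟩ := not_subset.1 hS.isGoodFlat.ssubset.2
      obtain ⟨e, u, he⟩ := hG.exists_isLink hv
      refine ⟨e, ?_⟩
      rintro ⟨a, b, hab, ha, hb⟩
      rcases he.left_eq_or_eq hab with rfl | rfl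
      exacts [hvS ha, hvS hb]
    obtain ⟨G₁, G₂, w₁, w₂, hsum, ⟨hV₁, hV₂, hE₁, hE₂⟩, hn₁, hn₂, -, -, hd, hc, hw₁, hw₂⟩ :=
      hS.split hG hV hE hδ hw he₁ (fun h ↦ h.2 he₂)
    have hG₁ := hsum.twoConnected_left hG
    have hG₂ := hsum.symm.twoConnected_left hG
    obtain ⟨u₁, hu₁⟩ := ih _ (hn ▸ hn₁) hG₁ hV₁ hE₁ hw₁ rfl
    obtain ⟨u₂, hu₂⟩ := ih _ (hn ▸ hn₂) hG₂ hV₂ hE₂ hw₂ rfl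
    refine ⟨glueWeight G₁ e₁ u₁ u₂, hsum.isSpadeWeight hG₁ hG₂ hV₁ hV₂ hE₁ hE₂ hδ hu₁ hu₂ ?_
      IsTwoSum.glueWeight_left hsum.glueWeight_right⟩
    rw [hu₁.of_delete e₁ hsum.link₁.edge_mem hd, hu₂.of_contract e₂ hsum.link₂.edge_mem hc]
    omega

/-! ### The weight of a vertex set attached at two vertices -/

/-- If `z` separates `x` from `y` in a set `A` attached at `x` and `y`, then the part of `A` on the
side of `x` is attached at `x` and `z`, and its complement is connected. -/
lemma connOn_compl_of_separating {G : Graph α β} (hG : G.TwoConnected) {A : Set α} {x y z : α}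
    (hA : A ⊆ V(G)) (hx : x ∈ A) (hxz : x ≠ z) (hz : z ∈ A)
    (hatt : ∀ e a b, G.IsLink e a b → a ∈ A → b ∉ A → a = x ∨ a = y)
    (hconn : G.ConnOn (V(G) \ A)) {P : α → Prop}
    (hP : ∀ e a b, G.IsLink e a b → a ∈ A \ {z} → b ∈ A \ {z} → P a → P b) (hPx : P x)
    (hPy : ¬ P y) :
    (∀ e a b, G.IsLink e a b → a ∈ {a ∈ A | a = z ∨ P a} → b ∉ {a ∈ A | a = z ∨ P a} →
      a = x ∨ a = z) ∧ G.ConnOn (V(G) \ {a ∈ A | a = z ∨ P a}) := by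
  constructor
  · rintro e a b he ⟨ha, ha'⟩ hb
    by_contra! hc
    have hPa := ha'.resolve_left hc.2
    by_cases hbA : b ∈ A
    · have hbz : b ≠ z := fun h ↦ hb ⟨hbA, .inl h⟩
      exact hb ⟨hbA, .inr (hP e a b he ⟨ha, hc.2⟩ ⟨hbA, hbz⟩ hPa)⟩
    · rcases hatt e a b he ha hbA with h | rfl
      exacts [hc.1 h, hPy hPa]
  · obtain ⟨⟨o, ho⟩, hconn⟩ := hconn
    refine ⟨⟨o, ho.1, fun h ↦ ho.2 h.1⟩, fun R hR ↦ ?_⟩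
    have hR' : ∀ a ∈ V(G) \ {a ∈ A | a = z ∨ P a}, ∀ b ∈ V(G) \ {a ∈ A | a = z ∨ P a}, ∀ e,
        G.IsLink e a b → (R a ↔ R b) :=
      fun a ha b hb e he ↦ ⟨hR e a b he ha hb, hR e b a he.symm hb ha⟩
    have hout : ∀ a ∈ V(G) \ A, a ∈ V(G) \ {a ∈ A | a = z ∨ P a} :=
      fun a ha ↦ ⟨ha.1, fun h ↦ ha.2 h.1⟩
    have h1 : ∀ a ∈ V(G) \ A, (R a ↔ R o) := by
      refine fun a ha ↦ ConnOn.iff ⟨⟨o, ho⟩, hconn⟩ (fun e a b he ha hb ↦ ?_) ha ho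
      exact (hR' a (hout a ha) b (hout b hb) e he).1
    have h2 : ∀ a ∈ V(G) \ {a ∈ A | a = z ∨ P a}, (R a ↔ R o) := by
      intro a ha
      by_cases haA : a ∈ A
      swap
      · exact h1 a ⟨ha.1, haA⟩
      by_contra hRa
      -- The vertices contradicting the claim are separated from `x` by `z`.
      have haz : a ≠ z ∧ ¬ P a := not_or.1 fun h ↦ ha.2 ⟨haA, h⟩
      have := (hG.twoConnOn.conn_diff z (hA hz)).2
        (fun a ↦ a ∈ A ∧ ¬ P a ∧ ¬ (R a ↔ R o)) ?_ a ⟨hA haA, haz.1⟩ x ⟨hA hx, hxz⟩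
        ⟨haA, haz.2, hRa⟩
      · exact this.2.1 hPx
      · rintro e c d he hc hd ⟨hcA, hPc, hRc⟩
        have hcm : c ∈ V(G) \ {a ∈ A | a = z ∨ P a} := ⟨hc.1, fun h ↦ h.2.elim hc.2 hPc⟩
        by_cases hdA : d ∈ A
        · have hPd : ¬ P d := fun h ↦ hPc (hP e d c he.symm ⟨hdA, hd.2⟩ ⟨hcA, hc.2⟩ h)
          refine ⟨hdA, hPd, ?_⟩
          rwa [← hR' c hcm d ⟨hd.1, fun h ↦ h.2.elim hd.2 hPd⟩ e he]
        · exact absurd ((hR' c hcm d (hout d ⟨hd.1, hdA⟩) e he).trans (h1 d ⟨hd.1, hdA⟩)) hRc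
    exact fun a ha b hb ↦ ((h2 a ha).trans (h2 b hb).symm).1

/-- A vertex set attached at two vertices, with connected complement, has at most the weight of a
good flat of the same size, with equality only if it is 2-connected: in general it is a chain of
good flats, and every additional link of the chain lowers the weight by one. -/
lemma IsSpadeWeight.le_of_attach {G : Graph α β} (hG : G.TwoConnected) (hV : V(G).Finite)
    (hE : E(G).Finite) {δ : ℕ} (hδ : 2 < δ) {w : β → ℕ} (hw : G.IsSpadeWeight δ w) (A : Set α)
    (x y : α) (hA : A ⊆ V(G)) (hx : x ∈ A) (hy : y ∈ A) (hne : x ≠ y)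
    (hatt : ∀ e a b, G.IsLink e a b → a ∈ A → b ∉ A → a = x ∨ a = y)
    (hconn : G.ConnOn (V(G) \ A)) :
    (G.induce A).totalWeight w + 1 ≤ δ * (A.ncard - 1) ∧
      ((G.induce A).totalWeight w + 1 = δ * (A.ncard - 1) → G.TwoConnOn A) := by
  obtain ⟨n, hn⟩ : ∃ n, A.ncard = n := ⟨_, rfl⟩
  induction n using Nat.strong_induction_on generalizing A x y with
  | _ n ih =>
  by_cases h2 : G.TwoConnOn A
  · have hflat : G.IsGoodFlat A := by
      rw [isGoodFlat_iff hG]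
      obtain ⟨o, ho⟩ := hconn.1
      exact ⟨⟨hA, fun h ↦ ho.2 (h ho.1)⟩, h2, hconn⟩
    exact ⟨(hw.flat A hflat).le, fun _ ↦ h2⟩
  by_cases hin : (A \ {x, y}).Nonempty
  swap
  -- If `A` consists of two vertices, they are not adjacent, and the inequality is strict.
  · have hAxy : A = {x, y} := by
      rw [not_nonempty_iff_eq_empty, sdiff_eq_empty] at hin
      exact Subset.antisymm hin (pair_subset hx hy)
    have hE0 : E(G.induce A) = ∅ := by
      rw [eq_empty_iff_forall_notMem]
      rintro e ⟨a, b, he, ha, hb⟩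
      refine h2 ?_
      have hab := hG.ne he
      rw [hAxy] at ha hb ⊢
      rcases ha with rfl | rfl <;> rcases hb with rfl | rfl
      exacts [absurd rfl hab, twoConnOn_pair he hab, twoConnOn_pair he.symm hne, absurd rfl hab]
    rw [totalWeight, hE0, finsum_mem_empty, hAxy, ncard_pair hne]
    omega
  obtain ⟨z, ⟨hz, hzxy⟩, P, hP, hPx, hPy⟩ := exists_separating hG hA hx hy hne hatt hin h2
  have hxz : x ≠ z := fun h ↦ hzxy (.inl h.symm)
  have hyz : y ≠ z := fun h ↦ hzxy (.inr h.symm)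
  have hP' : ∀ e a b, G.IsLink e a b → a ∈ A \ {z} → b ∈ A \ {z} → ¬ P a → ¬ P b :=
    fun e a b he ha hb hPa hPb ↦ hPa (hP e b a he.symm hb ha hPb)
  obtain ⟨hatt₁, hconn₁⟩ := connOn_compl_of_separating hG hA hx hxz hz hatt hconn hP hPx hPy
  obtain ⟨hatt₂, hconn₂⟩ := connOn_compl_of_separating hG hA hy hyz hz
    (fun e a b he ha hb ↦ (hatt e a b he ha hb).symm) hconn hP' hPy (not_not.2 hPx)
  -- The two parts of `A` at the separating vertex `z` share only `z`. The sizes minus one add up,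
  -- and so do the weights, so the sum of the two inequalities leaves one unit to spare.
  set A₁ : Set α := {a ∈ A | a = z ∨ P a} with hA₁
  set A₂ : Set α := {a ∈ A | a = z ∨ ¬ P a} with hA₂
  have hfin := hV.subset hA
  have hs₁ : A₁ ⊂ A := ⟨fun a ha ↦ ha.1, fun h ↦ ((h hy).2).elim hyz hPy⟩
  have hs₂ : A₂ ⊂ A := ⟨fun a ha ↦ ha.1, fun h ↦ ((h hx).2).elim hxz (not_not.2 hPx)⟩
  have ih₁ := (ih A₁.ncard (hn ▸ ncard_lt_ncard hs₁ hfin) A₁ x z (hs₁.subset.trans hA)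
    ⟨hx, .inr hPx⟩ ⟨hz, .inl rfl⟩ hxz hatt₁ hconn₁ rfl).1
  have ih₂ := (ih A₂.ncard (hn ▸ ncard_lt_ncard hs₂ hfin) A₂ y z (hs₂.subset.trans hA)
    ⟨hy, .inr hPy⟩ ⟨hz, .inl rfl⟩ hyz hatt₂ hconn₂ rfl).1
  have hunion : A₁ ∪ A₂ = A := by
    ext a
    simp only [hA₁, hA₂, mem_union, mem_ofPred_eq]
    tauto
  have hinter : A₁ ∩ A₂ = {z} := by
    ext a
    simp only [hA₁, hA₂, mem_inter_iff, mem_ofPred_eq, mem_singleton_iff]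
    constructor
    · tauto
    · rintro rfl
      exact ⟨⟨hz, .inl rfl⟩, hz, .inl rfl⟩
  have hcard := ncard_union_add_ncard_inter A₁ A₂ (hfin.subset hs₁.subset) (hfin.subset hs₂.subset)
  rw [hunion, hinter, ncard_singleton] at hcard
  have hweight : (G.induce A).totalWeight w =
      (G.induce A₁).totalWeight w + (G.induce A₂).totalWeight w := by
    have hEeq : E(G.induce A) = E(G.induce A₁) ∪ E(G.induce A₂) := by
      ext e
      constructor
      · rintro ⟨a, b, he, ha, hb⟩
        by_cases haz : a = z
        · by_cases hPb : P b
          · exact .inl ⟨a, b, he, ⟨ha, .inl haz⟩, hb, .inr hPb⟩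
          · exact .inr ⟨a, b, he, ⟨ha, .inl haz⟩, hb, .inr hPb⟩
        · by_cases hPa : P a
          · refine .inl ⟨a, b, he, ⟨ha, .inr hPa⟩, hb, ?_⟩
            by_cases hbz : b = z
            exacts [.inl hbz, .inr (hP e a b he ⟨ha, haz⟩ ⟨hb, hbz⟩ hPa)]
          · refine .inr ⟨a, b, he, ⟨ha, .inr hPa⟩, hb, ?_⟩
            by_cases hbz : b = z
            exacts [.inl hbz, .inr (hP' e a b he ⟨ha, haz⟩ ⟨hb, hbz⟩ hPa)]
      · rintro (⟨a, b, he, ha, hb⟩ | ⟨a, b, he, ha, hb⟩)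
        exacts [⟨a, b, he, ha.1, hb.1⟩, ⟨a, b, he, ha.1, hb.1⟩]
    rw [totalWeight, hEeq, finsum_mem_union ?_ (hE.subset (edgeSet_induce_subset _ _))
      (hE.subset (edgeSet_induce_subset _ _))]
    · rfl
    · rw [Set.disjoint_left]
      rintro e ⟨a, b, he, ha, hb⟩ ⟨c, d, he', hc, hd⟩
      have hone : ∀ t, t ∈ A₁ → t ∈ A₂ → t = z := by
        intro t h1 h2
        have : t ∈ A₁ ∩ A₂ := ⟨h1, h2⟩
        rwa [hinter] at this
      have hab := hG.ne he
      obtain ⟨rfl, rfl⟩ | ⟨rfl, rfl⟩ := he.eq_and_eq_or_eq_and_eq he'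
      · exact hab ((hone a ha hc).trans (hone b hb hd).symm)
      · exact hab ((hone a ha hd).trans (hone b hb hc).symm)
  have hp₁ : 0 < A₁.ncard := (ncard_pos (hfin.subset hs₁.subset)).2 ⟨x, hx, .inr hPx⟩
  have hp₂ : 0 < A₂.ncard := (ncard_pos (hfin.subset hs₂.subset)).2 ⟨y, hy, .inr hPy⟩
  have hmul : δ * (A.ncard - 1) = δ * (A₁.ncard - 1) + δ * (A₂.ncard - 1) := by
    rw [← Nat.mul_add]
    congr 1
    omega
  omega

/-! ### Isomorphisms -/

/-- Maps `φ` on vertices and `ψ` on edges that restrict to an isomorphism from `G` to `H`. -/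
structure IsIsoMap {α' : Type*} {β' : Type*} (φ : α → α') (ψ : β → β') (G : Graph α β)
    (H : Graph α' β') : Prop where
  verts : BijOn φ V(G) V(H)
  edges : BijOn ψ E(G) E(H)
  map : ∀ e a b, G.IsLink e a b → H.IsLink (ψ e) (φ a) (φ b)

namespace IsIsoMap

variable {α' : Type*} {β' : Type*} {φ : α → α'} {ψ : β → β'} {G : Graph α β} {H : Graph α' β'}

lemma of_map (h : IsIsoMap φ ψ G H) {e : β} {a b : α} (he : e ∈ E(G)) (ha : a ∈ V(G))
    (hb : b ∈ V(G)) (hl : H.IsLink (ψ e) (φ a) (φ b)) : G.IsLink e a b := by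
  obtain ⟨c, d, hcd⟩ := exists_isLink_of_mem_edgeSet he
  obtain ⟨h1, h2⟩ | ⟨h1, h2⟩ := hl.eq_and_eq_or_eq_and_eq (h.map e c d hcd)
  · rwa [h.verts.injOn ha hcd.left_mem h1, h.verts.injOn hb hcd.right_mem h2]
  · rw [h.verts.injOn ha hcd.right_mem h1, h.verts.injOn hb hcd.left_mem h2]
    exact hcd.symm

lemma exists_of_isLink (h : IsIsoMap φ ψ G H) {e : β'} {a b : α'} (he : H.IsLink e a b) :
    ∃ e' a' b', G.IsLink e' a' b' ∧ ψ e' = e ∧ φ a' = a ∧ φ b' = b := by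
  obtain ⟨e', he', rfl⟩ := h.edges.surjOn he.edge_mem
  obtain ⟨a', ha', rfl⟩ := h.verts.surjOn he.left_mem
  obtain ⟨b', hb', rfl⟩ := h.verts.surjOn he.right_mem
  exact ⟨e', a', b', h.of_map he' ha' hb' he, rfl, rfl, rfl⟩

lemma connOn (h : IsIsoMap φ ψ G H) {X : Set α} (hX : G.ConnOn X) : H.ConnOn (φ '' X) := by
  refine ⟨hX.1.image φ, ?_⟩
  rintro P hP _ ⟨a, ha, rfl⟩ _ ⟨b, hb, rfl⟩
  exact hX.2 (fun a ↦ P (φ a)) (fun e a b he ha hb ↦ hP _ _ _ (h.map e a b he) ⟨a, ha, rfl⟩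
    ⟨b, hb, rfl⟩) a ha b hb

lemma image_diff (h : IsIsoMap φ ψ G H) {X Y : Set α} (hX : X ⊆ V(G)) (hY : Y ⊆ V(G)) :
    φ '' (X \ Y) = φ '' X \ φ '' Y := by
  refine Subset.antisymm ?_ ?_
  swap
  · rintro _ ⟨⟨a, ha, rfl⟩, hn⟩
    exact ⟨a, ⟨ha, fun h' ↦ hn ⟨a, h', rfl⟩⟩, rfl⟩
  rintro _ ⟨a, ha, rfl⟩
  refine ⟨⟨a, ha.1, rfl⟩, ?_⟩
  rintro ⟨b, hb, hab⟩
  exact ha.2 (h.verts.injOn (hY hb) (hX ha.1) hab ▸ hb)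

lemma twoConnOn (h : IsIsoMap φ ψ G H) {X : Set α} (hXV : X ⊆ V(G)) (hX : G.TwoConnOn X) :
    H.TwoConnOn (φ '' X) := by
  refine ⟨hX.nontrivial.image_of_injOn (h.verts.injOn.mono hXV), h.connOn hX.conn, ?_⟩
  rintro _ ⟨x, hx, rfl⟩
  rw [← image_singleton, ← h.image_diff hXV (singleton_subset_iff.2 (hXV hx))]
  exact h.connOn (hX.conn_diff x hx)

lemma twoConnected (h : IsIsoMap φ ψ G H) (hG : G.TwoConnected) : H.TwoConnected := by
  rw [twoConnected_iff]
  constructor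
  · intro e a b he
    obtain ⟨e', a', b', he', rfl, rfl, rfl⟩ := h.exists_of_isLink he
    exact fun heq ↦ hG.ne he' (h.verts.injOn he'.left_mem he'.right_mem heq)
  · rw [← h.verts.image_eq]
    exact h.twoConnOn subset_rfl hG.twoConnOn

lemma deleteEdges (h : IsIsoMap φ ψ G H) {e : β} (he : e ∈ E(G)) :
    IsIsoMap φ ψ (G.deleteEdges {e}) (H.deleteEdges {ψ e}) where
  verts := h.verts
  edges := by
    have := h.edges.sdiff_singleton he
    exact this
  map f a b hf := ⟨h.map f a b hf.1, fun heq ↦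
    hf.2 (h.edges.injOn hf.1.edge_mem he heq)⟩

lemma contract (h : IsIsoMap φ ψ G H) (hG : G.TwoConnected) {e : β} (he : e ∈ E(G))
    (hc : (G.contractEdge e).TwoConnected) : (H.contractEdge (ψ e)).TwoConnected := by
  obtain ⟨x, y, hxy⟩ := exists_isLink_of_mem_edgeSet he
  rw [contractEdge_twoConnected_iff hG hxy] at hc
  rw [contractEdge_twoConnected_iff (h.twoConnected hG) (h.map e x y hxy)]
  constructor
  · intro f hf
    obtain ⟨f', hf', rfl⟩ := h.edges.surjOn hf.edge_mem
    rw [hc.1 f' (h.of_map hf' hxy.left_mem hxy.right_mem hf)]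
  · have := h.connOn hc.2
    rwa [h.image_diff subset_rfl (pair_subset hxy.left_mem hxy.right_mem), image_pair,
      h.verts.image_eq] at this

lemma isGoodFlat (h : IsIsoMap φ ψ G H) (hG : G.TwoConnected) {S : Set α} (hS : G.IsGoodFlat S) :
    H.IsGoodFlat (φ '' S) := by
  have hSV := hS.ssubset.subset
  rw [isGoodFlat_iff hG] at hS
  rw [isGoodFlat_iff (h.twoConnected hG), ← h.verts.image_eq, ← h.image_diff subset_rfl hSV]
  exact ⟨h.verts.injOn.image_ssubset_image_iff hSV subset_rfl |>.2 hS.1, h.twoConnOn hSV hS.2.1,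
    h.connOn hS.2.2⟩

lemma edgeSet_induce (h : IsIsoMap φ ψ G H) {S : Set α} (hS : S ⊆ V(G)) :
    E(H.induce (φ '' S)) = ψ '' E(G.induce S) := by
  ext e
  constructor
  · rintro ⟨_, _, he, ⟨a, ha, rfl⟩, b, hb, rfl⟩
    obtain ⟨e', he', rfl⟩ := h.edges.surjOn he.edge_mem
    exact ⟨e', ⟨a, b, h.of_map he' (hS ha) (hS hb) he, ha, hb⟩, rfl⟩
  · rintro ⟨e', ⟨a, b, he, ha, hb⟩, rfl⟩
    exact ⟨_, _, h.map e' a b he, ⟨a, ha, rfl⟩, b, hb, rfl⟩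

/-- The weight equalities can be pulled back along an isomorphism. -/
lemma isSpadeWeight (h : IsIsoMap φ ψ G H) (hG : G.TwoConnected) {δ : ℕ} {w : β' → ℕ}
    (hw : H.IsSpadeWeight δ w) : G.IsSpadeWeight δ (w ∘ ψ) where
  values e he := hw.values _ (h.edges.mapsTo he)
  of_delete e he hd := hw.of_delete _ (h.edges.mapsTo he) ((h.deleteEdges he).twoConnected hd)
  of_contract e he hc := hw.of_contract _ (h.edges.mapsTo he) (h.contract hG he hc)
  total := by
    have := hw.total
    rw [totalWeight, ← h.edges.image_eq, finsum_mem_image h.edges.injOn, ← h.verts.image_eq,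
      h.verts.injOn.ncard_image] at this
    exact this
  flat S hS := by
    have := hw.flat _ (h.isGoodFlat hG hS)
    have hSV := hS.ssubset.subset
    rw [totalWeight, h.edgeSet_induce hSV, finsum_mem_image
      (h.edges.injOn.mono (edgeSet_induce_subset G S)),
      (h.verts.injOn.mono hSV).ncard_image] at this
    exact this

lemma isCycleOfLength (h : IsIsoMap φ ψ G H) {n : ℕ} (hG : G.IsCycleOfLength n) :
    H.IsCycleOfLength n := by
  obtain ⟨c, d, hc, hd, hV, hE, hl⟩ := hG
  refine ⟨φ ∘ c, ψ ∘ d, ?_, ?_, ?_, ?_, fun i ↦ h.map _ _ _ (hl i)⟩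
  · exact fun i j hij ↦ hc (h.verts.injOn (hV ▸ mem_range_self i) (hV ▸ mem_range_self j) hij)
  · exact fun i j hij ↦ hd (h.edges.injOn (hE ▸ mem_range_self i) (hE ▸ mem_range_self j) hij)
  · rw [range_comp, ← hV, h.verts.image_eq]
  · rw [range_comp, ← hE, h.edges.image_eq]

end IsIsoMap

lemma IsIsoMap.isIsomorphic {α' : Type u} {β' : Type v} {φ : α → α'} {ψ : β → β'} {G : Graph α β}
    {H : Graph α' β'} (h : IsIsoMap φ ψ G H) : G.IsIsomorphic H :=
  ⟨h.verts.equiv φ, h.edges.equiv ψ, fun e x y ↦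
    ⟨fun he ↦ h.map e x y he, fun he ↦ h.of_map e.2 x.2 y.2 he⟩⟩

lemma IsIsomorphic.symm {α' : Type u} {β' : Type v} {G : Graph α β} {H : Graph α' β'}
    (h : G.IsIsomorphic H) : H.IsIsomorphic G := by
  obtain ⟨f, g, h⟩ := h
  refine ⟨f.symm, g.symm, fun e x y ↦ ?_⟩
  rw [h, Equiv.apply_symm_apply, Equiv.apply_symm_apply, Equiv.apply_symm_apply]

lemma TwoConnected.edgeSet_nonempty {G : Graph α β} (hG : G.TwoConnected) : E(G).Nonempty := by
  obtain ⟨v, hv⟩ := hG.nontrivial.nonempty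
  obtain ⟨e, u, he⟩ := hG.exists_isLink hv
  exact ⟨e, he.edge_mem⟩

open Classical in
lemma IsIsomorphic.exists_isIsoMap {α' : Type u} {β' : Type v} {G : Graph α β} {H : Graph α' β'}
    (h : G.IsIsomorphic H) (hV : V(G).Nonempty) (hE : E(G).Nonempty) :
    ∃ (φ : α → α') (ψ : β → β'), IsIsoMap φ ψ G H := by
  obtain ⟨f, g, h⟩ := h
  obtain ⟨a₀, ha₀⟩ := hV
  obtain ⟨e₀, he₀⟩ := hE
  have hφ : ∀ a : V(G), (if ha : (a : α) ∈ V(G) then (f ⟨a, ha⟩ : α') else f ⟨a₀, ha₀⟩) = f a :=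
    fun a ↦ by simp
  have hψ : ∀ e : E(G), (if he : (e : β) ∈ E(G) then (g ⟨e, he⟩ : β') else g ⟨e₀, he₀⟩) = g e :=
    fun e ↦ by simp
  refine ⟨fun a ↦ if ha : a ∈ V(G) then f ⟨a, ha⟩ else f ⟨a₀, ha₀⟩,
    fun e ↦ if he : e ∈ E(G) then g ⟨e, he⟩ else g ⟨e₀, he₀⟩, ⟨?_, ?_, ?_⟩, ⟨?_, ?_, ?_⟩, ?_⟩
  · exact fun a ha ↦ by simp [ha]
  · intro a ha b hb hab
    have := (hφ ⟨a, ha⟩).symm.trans (hab.trans (hφ ⟨b, hb⟩))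
    simpa using f.injective (Subtype.ext this)
  · exact fun b hb ↦ ⟨f.symm ⟨b, hb⟩, (f.symm ⟨b, hb⟩).2, by simp⟩
  · exact fun e he ↦ by simp [he]
  · intro a ha b hb hab
    have := (hψ ⟨a, ha⟩).symm.trans (hab.trans (hψ ⟨b, hb⟩))
    simpa using g.injective (Subtype.ext this)
  · exact fun b hb ↦ ⟨g.symm ⟨b, hb⟩, (g.symm ⟨b, hb⟩).2, by simp⟩
  · intro e a b he
    have := (h ⟨e, he.edge_mem⟩ ⟨a, he.left_mem⟩ ⟨b, he.right_mem⟩).1 he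
    simpa [he.edge_mem, he.left_mem, he.right_mem] using this

/-! ### The 2-cycle -/

lemma isCycleOfLength_two {G : Graph α β} {x y : α} {e f : β} (hne : x ≠ y) (hef : e ≠ f)
    (hV : V(G) = {x, y}) (hE : E(G) = {e, f}) (he : G.IsLink e x y) (hf : G.IsLink f x y) :
    G.IsCycleOfLength 2 := by
  refine isCycleOfLength_of_nat (p := fun i ↦ if i = 0 then x else y)
    (q := fun i ↦ if i = 0 then e else f) two_pos ?_ ?_ ?_ ?_ ?_
  · intro i hi j hj hij
    simp only [mem_Iio] at hi hj
    interval_cases i <;> interval_cases j <;> simp_all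
  · intro i hi j hj hij
    simp only [mem_Iio] at hi hj
    interval_cases i <;> interval_cases j <;> simp_all
  · have : Iio 2 = ({0, 1} : Set ℕ) := by ext; simp; omega
    rw [this, image_pair]
    simpa using hV
  · have : Iio 2 = ({0, 1} : Set ℕ) := by ext; simp; omega
    rw [this, image_pair]
    simpa using hE
  · intro i hi
    interval_cases i
    · simpa using he
    · simpa using hf.symm

namespace IsCycleOfLength

variable {G : Graph α β}

/-- The 2-cycle, seen from one of its edges. -/
lemma exists_pair (h : G.IsCycleOfLength 2) {e : β} {x y : α} (he : G.IsLink e x y) :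
    V(G) = {x, y} ∧ ∃ f, f ≠ e ∧ E(G) = {e, f} ∧ G.IsLink f x y := by
  have hG := h.twoConnected one_lt_two
  have hV : V(G) = {x, y} := by
    symm
    refine eq_of_subset_of_ncard_le (pair_subset he.left_mem he.right_mem) ?_ (h.finite two_pos).1
    rw [ncard_pair (hG.ne he), h.ncard_verts]
  refine ⟨hV, ?_⟩
  obtain ⟨a, b, hab, hE⟩ := ncard_eq_two.1 h.ncard_edges
  have hea : e = a ∨ e = b := by simpa [hE] using he.edge_mem
  rcases hea with rfl | rfl
  · exact ⟨b, hab.symm, hE, isLink_of_verts_pair hG hV (by simp [hE])⟩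
  · exact ⟨a, hab, by rw [hE, pair_comm], isLink_of_verts_pair hG hV (by simp [hE])⟩

/-- The edges of the 2-cycle are deletable, so their weight is `1`. -/
lemma eq_one_of_isWeight (h : G.IsCycleOfLength 2) {δ : ℕ} {w : β → ℕ} (hw : G.IsWeight δ w) {e : β}
    (he : e ∈ E(G)) : w e = 1 := by
  obtain ⟨x, y, hxy⟩ := exists_isLink_of_mem_edgeSet he
  obtain ⟨hV, f, hfe, -, hf⟩ := h.exists_pair hxy
  exact hw.of_delete e he
    (deleteEdges_twoConnected_of_pair (h.twoConnected one_lt_two) hV hf hfe)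

/-- The 2-cycle has total weight `2`, so it violates the weight equalities. -/
lemma not_isSpadeWeight (h : G.IsCycleOfLength 2) {δ : ℕ} (hδ : 2 < δ) (w : β → ℕ) :
    ¬ G.IsSpadeWeight δ w := by
  intro hw
  have h1 := hw.total
  rw [totalWeight_congr (w' := fun _ ↦ 1) rfl fun e he ↦ h.eq_one_of_isWeight hw.toIsWeight he,
    totalWeight_const G (h.finite two_pos).2, h.ncard_edges, h.ncard_verts] at h1
  omega

end IsCycleOfLength

/-! ### The weight equalities of obtainable graphs -/

/-- The finite 2-connected graphs that are the 2-cycle or satisfy the weight equalities. This class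
is closed under the three constructions. -/
structure IsSpadeOrTwoCycle (G : Graph α β) (δ : ℕ) : Prop where
  finite_verts : V(G).Finite
  finite_edges : E(G).Finite
  twoConnected : G.TwoConnected
  cycle_or_spade : G.IsCycleOfLength 2 ∨ ∃ w, G.IsSpadeWeight δ w

lemma IsCycleOfLength.isSpadeOrTwoCycle {G : Graph α β} {δ : ℕ} (hδ : 2 < δ)
    (h : G.IsCycleOfLength δ) : G.IsSpadeOrTwoCycle δ where
  finite_verts := (h.finite (by omega)).1
  finite_edges := (h.finite (by omega)).2
  twoConnected := h.twoConnected (by omega)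
  cycle_or_spade := .inr ⟨_, h.isSpadeWeight hδ⟩

lemma IsIsoMap.isSpadeOrTwoCycle {α' : Type*} {β' : Type*} {φ : α → α'} {ψ : β → β'}
    {φ' : α' → α} {ψ' : β' → β} {G : Graph α β} {H : Graph α' β'} {δ : ℕ} (h : IsIsoMap φ ψ G H)
    (h' : IsIsoMap φ' ψ' H G) (hG : G.IsSpadeOrTwoCycle δ) : H.IsSpadeOrTwoCycle δ where
  finite_verts := h.verts.image_eq ▸ hG.finite_verts.image φ
  finite_edges := h.edges.image_eq ▸ hG.finite_edges.image ψ
  twoConnected := h.twoConnected hG.twoConnected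
  cycle_or_spade := hG.cycle_or_spade.imp h.isCycleOfLength fun ⟨_, hw⟩ ↦
    ⟨_, h'.isSpadeWeight (h.twoConnected hG.twoConnected) hw⟩

lemma IsIsomorphic.isSpadeOrTwoCycle {α' : Type u} {β' : Type v} {G : Graph α β} {H : Graph α' β'}
    {δ : ℕ} (h : G.IsIsomorphic H) (hG : G.IsSpadeOrTwoCycle δ) : H.IsSpadeOrTwoCycle δ := by
  obtain ⟨φ, ψ, hφ⟩ := h.exists_isIsoMap hG.twoConnected.nontrivial.nonempty
    hG.twoConnected.edgeSet_nonempty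
  have hH := hφ.twoConnected hG.twoConnected
  obtain ⟨φ', ψ', hφ'⟩ := h.symm.exists_isIsoMap hH.nontrivial.nonempty hH.edgeSet_nonempty
  exact hφ.isSpadeOrTwoCycle hφ' hG

/-- A gluing in which the glued edge is deleted is a 2-sum. -/
lemma IsGluing.exists_isTwoSum {G₁ G₂ G : Graph α β} {e₁ e₂ : β} (h : IsGluing G₁ G₂ e₁ e₂ 0 G)
    (hG₁ : G₁.TwoConnected) (hG₂ : G₂.TwoConnected) : ∃ x y, IsTwoSum G₁ G₂ e₁ e₂ x y G := by
  obtain ⟨x, y, P, h₁, h₂, hinter, hdisj, hP, -, hV, hl⟩ := h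
  obtain rfl : P = ∅ := by simpa using hP
  have hl' : ∀ e a b, G.IsLink e a b ↔
      (G₁.IsLink e a b ∧ e ≠ e₁) ∨ (G₂.IsLink e a b ∧ e ≠ e₂) := fun e a b ↦ by simp [hl]
  refine ⟨x, y, hG₁.ne h₁, h₁, h₂, hinter, fun e he _ he' ↦ (disjoint_left.1 hdisj he he').elim,
    hV, hl', fun e a b he ↦ ?_⟩
  rcases (hl' e a b).1 he with he | he
  exacts [hG₁.ne he.1, hG₂.ne he.1]

/-- A 2-sum of graphs with the weight equalities, along edges of weights `1` and `δ - 1`. -/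
lemma IsTwoSum.exists_isSpadeWeight {G₁ G₂ G : Graph α β} {e₁ e₂ : β} {x y : α} {δ : ℕ}
    (h : IsTwoSum G₁ G₂ e₁ e₂ x y G) (hδ : 2 < δ) (hG₁ : G₁.TwoConnected) (hG₂ : G₂.TwoConnected)
    (hV₁ : V(G₁).Finite) (hV₂ : V(G₂).Finite) (hE₁ : E(G₁).Finite) (hE₂ : E(G₂).Finite)
    {w₁ w₂ : β → ℕ} (hw₁ : G₁.IsSpadeWeight δ w₁) (hw₂ : G₂.IsSpadeWeight δ w₂)
    (he : w₁ e₁ + w₂ e₂ = δ) : V(G).Finite ∧ E(G).Finite ∧ G.TwoConnected ∧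
      G.IsSpadeWeight δ (glueWeight G₁ e₁ w₁ w₂) := by
  obtain ⟨f₁, hf₁, hfe₁⟩ := hw₁.exists_ne hδ hG₁ h.link₁.edge_mem
  obtain ⟨f₂, hf₂, hfe₂⟩ := hw₂.exists_ne hδ hG₂ h.link₂.edge_mem
  exact ⟨h.verts ▸ hV₁.union hV₂, h.edgeSet_eq ▸ hE₁.sdiff.union hE₂.sdiff,
    h.twoConnected hG₁ hG₂ hf₁ hfe₁ hf₂ hfe₂,
    h.isSpadeWeight hG₁ hG₂ hV₁ hV₂ hE₁ hE₂ hδ hw₁ hw₂ he IsTwoSum.glueWeight_left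
      h.glueWeight_right⟩

/-- A 2-sum with the 2-cycle does not change the other summand. -/
lemma IsTwoSum.exists_isIsoMap_of_cycle {G₁ G₂ G : Graph α β} {e₁ e₂ : β} {x y : α}
    (h : IsTwoSum G₁ G₂ e₁ e₂ x y G) (h₁ : G₁.IsCycleOfLength 2) :
    ∃ ψ ψ' : β → β, IsIsoMap id ψ G G₂ ∧ IsIsoMap id ψ' G₂ G := by
  classical
  obtain ⟨hV₁, f, hfe, hE₁, hf⟩ := h₁.exists_pair h.link₁
  have hV : V(G) = V(G₂) := by
    rw [h.verts, hV₁]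
    exact union_eq_self_of_subset_left (pair_subset h.link₂.left_mem h.link₂.right_mem)
  have hEG : E(G) = insert f (E(G₂) \ {e₂}) := by
    rw [h.edgeSet_eq, hE₁]
    ext e
    simp only [mem_union, mem_sdiff, mem_insert_iff, mem_singleton_iff]
    grind
  have hf₂ : f ∈ E(G₂) → f = e₂ := h.disj f hf.edge_mem hfe
  have he₂ := h.link₂.edge_mem
  -- The edge of the 2-cycle that survives takes the place of `e₂`.
  refine ⟨fun e ↦ if e = f then e₂ else e, fun e ↦ if e = e₂ then f else e,
    ⟨hV ▸ bijOn_id _, ⟨?_, ?_, ?_⟩, ?_⟩, ⟨hV ▸ bijOn_id _, ⟨?_, ?_, ?_⟩, ?_⟩⟩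
  · intro e he
    rw [hEG] at he
    grind
  · intro e he e' he' hee
    rw [hEG] at he he'
    simp only [mem_insert_iff, mem_sdiff, mem_singleton_iff] at he he'
    grind
  · intro e he
    by_cases hee : e = e₂
    · exact ⟨f, hEG ▸ mem_insert _ _, by simp [hee]⟩
    · refine ⟨e, hEG ▸ .inr ⟨he, hee⟩, if_neg ?_⟩
      rintro rfl
      exact hee (hf₂ he)
  · intro e a b he
    rcases (h.isLink e a b).1 he with he' | he'
    · have : e = e₁ ∨ e = f := by simpa [hE₁] using he'.1.edge_mem
      obtain rfl := this.resolve_left he'.2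
      simp only [if_true, id]
      obtain ⟨rfl, rfl⟩ | ⟨rfl, rfl⟩ := he'.1.eq_and_eq_or_eq_and_eq hf
      exacts [h.link₂, h.link₂.symm]
    · have hef : e ≠ f := fun h' ↦ he'.2 (h' ▸ hf₂ (h' ▸ he'.1.edge_mem))
      simpa [hef] using he'.1
  · intro e he
    rw [hEG]
    grind
  · intro e he e' he' hee
    grind
  · intro e he
    rw [hEG] at he
    rcases he with rfl | he
    · exact ⟨e₂, he₂, if_pos rfl⟩
    · exact ⟨e, he.1, if_neg he.2⟩
  · intro e a b he
    by_cases hee : e = e₂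
    · subst hee
      simp only [if_true, id]
      obtain ⟨rfl, rfl⟩ | ⟨rfl, rfl⟩ := he.eq_and_eq_or_eq_and_eq h.link₂
      exacts [h.of_left hf hfe, (h.of_left hf hfe).symm]
    · simpa [hee] using h.symm.of_left he hee

lemma IsSpadeOrTwoCycle.exists_isSpadeWeight {G : Graph α β} {δ : ℕ} (hδ : 2 < δ)
    (hG : G.IsSpadeOrTwoCycle δ) {e : β} (he : e ∈ E(G)) (hw : G.EdgeHasWeight δ e (δ - 1)) :
    ∃ w, G.IsSpadeWeight δ w ∧ w e = δ - 1 := by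
  obtain ⟨w, hw, hwe⟩ := hw
  rcases hG.cycle_or_spade with hc | ⟨w', hw'⟩
  · have := hc.eq_one_of_isWeight hw he
    omega
  · obtain ⟨f, hf, hfe⟩ := hw'.exists_ne hδ hG.twoConnected he
    exact ⟨w', hw', (IsWeight.unique hG.twoConnected hw'.toIsWeight hw he hf hfe).trans hwe⟩

lemma IsPathCon.isSpadeOrTwoCycle {G₁ G₂ G : Graph α β} {δ : ℕ} (hδ : 2 < δ)
    (h : IsPathCon δ G₁ G₂ G) (h₁ : G₁.IsSpadeOrTwoCycle δ) (h₂ : G₂.IsSpadeOrTwoCycle δ) :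
    G.IsSpadeOrTwoCycle δ := by
  obtain ⟨hG₁, hG₂, e₁, e₂, ⟨w₁, hw₁, hwe₁⟩, he₂, hg⟩ := h
  obtain ⟨x, y, hsum⟩ := hg.exists_isTwoSum hG₁ hG₂
  rcases h₁.cycle_or_spade with hc | ⟨w, hw⟩
  · obtain ⟨ψ, ψ', hψ, hψ'⟩ := hsum.exists_isIsoMap_of_cycle hc
    exact hψ'.isSpadeOrTwoCycle hψ h₂
  · obtain ⟨w₂, hw₂, hwe₂⟩ := h₂.exists_isSpadeWeight hδ hsum.link₂.edge_mem he₂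
    obtain ⟨f, hf, hfe⟩ := hw.exists_ne hδ hG₁ hsum.link₁.edge_mem
    have hwe := IsWeight.unique hG₁ hw.toIsWeight hw₁ hsum.link₁.edge_mem hf hfe
    obtain ⟨hV, hE, hG, hs⟩ := hsum.exists_isSpadeWeight hδ hG₁ hG₂ h₁.finite_verts h₂.finite_verts
      h₁.finite_edges h₂.finite_edges hw hw₂ (by omega)
    exact ⟨hV, hE, hG, .inr ⟨_, hs⟩⟩

/-- The `δ`-construction amounts to two 2-sums with a bond of `δ` edges between them: its edges have
weight `1`, two of them are used up, and `δ - 2` remain. -/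
lemma IsDeltaCon.isSpadeOrTwoCycle {G₁ G₂ G : Graph α β} {δ : ℕ} (hδ : 2 < δ)
    (h : IsDeltaCon δ G₁ G₂ G) (h₁ : G₁.IsSpadeOrTwoCycle δ) (h₂ : G₂.IsSpadeOrTwoCycle δ) :
    G.IsSpadeOrTwoCycle δ := by
  obtain ⟨hG₁, hG₂, e₁, e₂, he₁, he₂, x, y, P, hl₁, hl₂, hinter, hdisj, hP, hPd, hV, hl⟩ := h
  obtain ⟨w₁, hw₁, hwe₁⟩ := h₁.exists_isSpadeWeight hδ hl₁.edge_mem he₁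
  obtain ⟨w₂, hw₂, hwe₂⟩ := h₂.exists_isSpadeWeight hδ hl₂.edge_mem he₂
  have hne := hG₁.ne hl₁
  have hee : e₁ ≠ e₂ := fun h' ↦ disjoint_left.1 hdisj hl₁.edge_mem (h' ▸ hl₂.edge_mem)
  have hP₁ : ∀ e ∈ P, e ∉ E(G₁) := fun e he he' ↦ disjoint_left.1 hPd he (.inl he')
  have hP₂ : ∀ e ∈ P, e ∉ E(G₂) := fun e he he' ↦ disjoint_left.1 hPd he (.inr he')
  have hd : ∀ e ∈ E(G₁), e ∉ E(G₂) := fun _ h' ↦ disjoint_left.1 hdisj h'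
  have hPfin : P.Finite := finite_of_encard_eq_coe hP
  have hPcard : P.ncard = δ - 2 := by rw [ncard, hP]; rfl
  have hflip : ∀ a b, ((a = x ∧ b = y) ∨ (a = y ∧ b = x)) ↔ s(a, b) = s(x, y) := by
    intro a b
    rw [Sym2.eq_iff]
  -- The bond has the edges `P` and one edge for each of the two 2-sums.
  set B : Graph α β := banana x y (insert e₁ (insert e₂ P)) with hB
  have hBl : ∀ e a b, B.IsLink e a b ↔ (e = e₁ ∨ e = e₂ ∨ e ∈ P) ∧ s(a, b) = s(x, y) := by
    intro e a b
    rw [hB, banana_isLink, hflip]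
    rfl
  have hBV : V(B) = {x, y} := rfl
  have hBE : E(B) = insert e₁ (insert e₂ P) := rfl
  have hBfin : E(B).Finite := (hPfin.insert _).insert _
  have hB2 : B.TwoConnected := twoConnected_of_bond hne hBV
    (fun e he ↦ (hBl e x y).2 ⟨he, rfl⟩) ⟨e₁, .inl rfl⟩
  have hBs : B.IsSpadeWeight δ fun _ ↦ 1 := by
    refine isSpadeWeight_of_bond hB2 hBV hBfin ?_
    have h1 : e₂ ∉ P := fun h' ↦ hP₂ _ h' hl₂.edge_mem
    have h2 : e₁ ∉ insert e₂ P := by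
      rintro (h' | h')
      exacts [hee h', hP₁ _ h' hl₁.edge_mem]
    rw [hBE, ncard_insert_of_notMem h2 (hPfin.insert _), ncard_insert_of_notMem h1 hPfin, hPcard]
    omega
  obtain ⟨H, hsum₁⟩ : ∃ H, IsTwoSum G₁ B e₁ e₁ x y H := by
    refine hG₁.exists_isTwoSum hB2 hl₁ ((hBl e₁ x y).2 ⟨.inl rfl, rfl⟩)
      (inter_eq_right.2 (pair_subset hl₁.left_mem hl₁.right_mem)) fun e he hne' he' ↦ ?_
    rcases he' with rfl | rfl | he'
    exacts [rfl, (hd _ he hl₂.edge_mem).elim, (hP₁ e he' he).elim]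
  have hHV : V(H) = V(G₁) :=
    hsum₁.verts.trans (union_eq_self_of_subset_right (pair_subset hl₁.left_mem hl₁.right_mem))
  have hHl : ∀ e a b, H.IsLink e a b ↔ (G₁.IsLink e a b ∧ e ≠ e₁) ∨
      ((e = e₂ ∨ e ∈ P) ∧ s(a, b) = s(x, y)) := by
    intro e a b
    rw [hsum₁.isLink, hBl]
    refine or_congr_right ⟨?_, ?_⟩
    · rintro ⟨⟨he, h'⟩, hne'⟩
      exact ⟨he.resolve_left hne', h'⟩
    · rintro ⟨he, h'⟩
      refine ⟨⟨.inr he, h'⟩, ?_⟩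
      rintro rfl
      exact he.elim hee fun h' ↦ hP₁ _ h' hl₁.edge_mem
  obtain ⟨hHfin, hHEfin, hH2, hHs⟩ := hsum₁.exists_isSpadeWeight hδ hG₁ hB2 h₁.finite_verts
    (hBV ▸ toFinite {x, y}) h₁.finite_edges hBfin hw₁ hBs (by omega)
  have hsum₂ : IsTwoSum H G₂ e₂ e₂ x y G := by
    exact {
      ne := hne
      link₁ := (hHl e₂ x y).2 (.inr ⟨.inl rfl, rfl⟩)
      link₂ := hl₂
      inter := hHV ▸ hinter
      disj e he hne' he' := by
        obtain ⟨a, b, hab⟩ := exists_isLink_of_mem_edgeSet he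
        rcases (hHl e a b).1 hab with h' | ⟨rfl | h', -⟩
        exacts [(hd e h'.1.edge_mem he').elim, rfl, (hP₂ e h' he').elim]
      verts := hHV ▸ hV
      isLink e a b := by
        rw [hl, hHl]
        constructor
        · rintro (he | he | ⟨he, h'⟩)
          · exact .inl ⟨.inl he, fun h' ↦ hd e he.1.edge_mem (h' ▸ hl₂.edge_mem)⟩
          · exact .inr he
          · exact .inl ⟨.inr ⟨.inr he, h'⟩, fun h'' ↦ hP₂ e he (h'' ▸ hl₂.edge_mem)⟩
        · rintro (⟨he | ⟨he, h'⟩, hne'⟩ | he)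
          exacts [.inl he, .inr (.inr ⟨he.resolve_left hne', h'⟩), .inr (.inl he)]
      loopless e a b he := by
        rcases (hl e a b).1 he with he | he | he
        exacts [hG₁.ne he.1, hG₂.ne he.1, hB2.ne ((hBl e₁ a b).2 ⟨.inl rfl, he.2⟩)] }
  have hH1 : glueWeight G₁ e₁ w₁ (fun _ ↦ 1) e₂ = 1 :=
    hsum₁.glueWeight_right e₂ (.inr (.inl rfl)) hee.symm
  obtain ⟨hVfin, hEfin, hG, hs⟩ := hsum₂.exists_isSpadeWeight hδ hH2 hG₂ hHfin h₂.finite_verts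
    hHEfin h₂.finite_edges hHs hw₂ (by omega)
  exact ⟨hVfin, hEfin, hG, .inr ⟨_, hs⟩⟩

/-! ### The reverse construction -/

/-- The reverse construction splits off a `δ`-cycle: the original graph is the 2-sum of the new
graph and a `δ`-cycle, along the new edge. -/
lemma IsReverseCon.exists_isTwoSum {G G' : Graph α β} {δ : ℕ} (hδ : 2 < δ)
    (h : IsReverseCon δ G G') : ∃ (C : Graph α β) (f : β) (x y : α),
      C.IsCycleOfLength δ ∧ IsTwoSum G' C f f x y G := by
  obtain ⟨hG, p, q, f, hp, hq, -, hf, hV, hl⟩ := h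
  obtain ⟨m, rfl⟩ : ∃ m, δ = m + 1 := ⟨δ - 1, by omega⟩
  simp only [Nat.add_sub_cancel] at *
  have hpi : ∀ i ≤ m, ∀ j ≤ m, p i = p j → i = j := fun i hi j hj ↦ hp hi hj
  have hqi : ∀ i < m, ∀ j < m, q i = q j → i = j := by
    intro i hi j hj hij
    obtain ⟨h1, h2⟩ | ⟨h1, h2⟩ := (hij ▸ hq i hi).eq_and_eq_or_eq_and_eq (hq j hj)
    · exact hpi i (by omega) j (by omega) h1
    · have := hpi i (by omega) (j + 1) (by omega) h1
      have := hpi (i + 1) (by omega) j (by omega) h2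
      omega
  have hpm : ∀ i ≤ m, p i ∈ V(G) := by
    intro i hi
    rcases Nat.lt_or_ge i m with hi' | hi'
    · exact (hq i hi').left_mem
    · have := (hq (i - 1) (by omega)).right_mem
      rwa [show i - 1 + 1 = i by omega] at this
  have hne : p 0 ≠ p m := fun h' ↦ by
    have := hpi 0 (by omega) m le_rfl h'
    omega
  have hqf : ∀ i < m, q i ≠ f := fun i hi h' ↦ hf (h' ▸ (hq i hi).edge_mem)
  -- The cycle consists of the path and the new edge.
  set C : Graph α β :=
    ((G.induce (p '' Iic m)).restrict (q '' Iio m)).addEdge f (p 0) (p m) with hC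
  have hCl : ∀ e a b, C.IsLink e a b ↔ (e = f ∧ s(a, b) = s(p 0, p m)) ∨
      ∃ i < m, e = q i ∧ G.IsLink e a b := by
    intro e a b
    rw [hC, addEdge_isLink, restrict_isLink]
    refine or_congr Iff.rfl ⟨?_, ?_⟩
    · rintro ⟨-, ⟨i, hi, rfl⟩, h', -⟩
      exact ⟨i, hi, rfl, h'⟩
    · rintro ⟨i, hi, rfl, h'⟩
      refine ⟨hqf i hi, ⟨i, hi, rfl⟩, h', ?_⟩
      have h0 : p i ∈ p '' Iic m := ⟨i, hi.le, rfl⟩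
      have h1 : p (i + 1) ∈ p '' Iic m := ⟨i + 1, hi, rfl⟩
      obtain ⟨rfl, rfl⟩ | ⟨rfl, rfl⟩ := h'.eq_and_eq_or_eq_and_eq (hq i hi)
      exacts [⟨h0, h1⟩, ⟨h1, h0⟩]
  have hCV : V(C) = p '' Iic m :=
    union_eq_self_of_subset_left (pair_subset ⟨0, Nat.zero_le m, rfl⟩ ⟨m, le_refl m, rfl⟩)
  have hCE : ∀ e, e ∈ E(C) ↔ e = f ∨ ∃ i < m, e = q i := by
    intro e
    constructor
    · intro he
      obtain ⟨a, b, hab⟩ := exists_isLink_of_mem_edgeSet he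
      exact ((hCl e a b).1 hab).imp And.left fun ⟨i, hi, h', _⟩ ↦ ⟨i, hi, h'⟩
    · rintro (rfl | ⟨i, hi, rfl⟩)
      exacts [((hCl _ _ _).2 (.inl ⟨rfl, rfl⟩)).edge_mem,
        ((hCl _ _ _).2 (.inr ⟨i, hi, rfl, hq i hi⟩)).edge_mem]
  have hcyc : C.IsCycleOfLength (m + 1) := by
    refine isCycleOfLength_of_nat (p := p) (q := fun i ↦ if i < m then q i else f) (by omega)
      (fun i hi j hj ↦ hpi i (Nat.lt_succ_iff.1 hi) j (Nat.lt_succ_iff.1 hj)) ?_ ?_ ?_ ?_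
    · intro i hi j hj hij
      simp only [mem_Iio] at hi hj
      by_cases hi' : i < m <;> by_cases hj' : j < m <;>
        simp only [hi', hj', if_true, if_false] at hij
      · exact hqi i hi' j hj' hij
      · exact absurd hij (hqf i hi')
      · exact absurd hij.symm (hqf j hj')
      · omega
    · rw [hCV]
      congr 1
      ext i
      simp
    · ext e
      rw [hCE]
      constructor
      · rintro (rfl | ⟨i, hi, rfl⟩)
        exacts [⟨m, by simp, by simp⟩, ⟨i, by simp; omega, by simp [hi]⟩]
      · rintro ⟨i, hi, rfl⟩
        by_cases hi' : i < m
        · exact .inr ⟨i, hi', by simp [hi']⟩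
        · exact .inl (by simp [hi'])
    · intro i hi
      by_cases hi' : i < m
      · simp only [hi', if_true, show i + 1 ≠ m + 1 by omega, if_false]
        exact (hCl _ _ _).2 (.inr ⟨i, hi', rfl, hq i hi'⟩)
      · obtain rfl : i = m := by omega
        simp only [lt_irrefl, if_false, if_true]
        exact (hCl _ _ _).2 (.inl ⟨rfl, Sym2.eq_swap⟩)
  have hend : ∀ i ≤ m, p i ∈ V(G') ↔ i = 0 ∨ i = m := by
    intro i hi
    rw [hV]
    constructor
    · rintro ⟨-, h'⟩
      by_contra hi'
      exact h' ⟨i, ⟨by omega, by omega⟩, rfl⟩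
    · refine fun hi' ↦ ⟨hpm i hi, ?_⟩
      rintro ⟨j, ⟨hj, hj'⟩, hji⟩
      have := hpi j hj'.le i hi hji
      omega
  refine ⟨C, f, p 0, p m, hcyc, hne, (hl _ _ _).2 (.inr ⟨rfl, rfl⟩),
    (hCl _ _ _).2 (.inl ⟨rfl, rfl⟩), ?_, ?_, ?_, ?_, fun e a b he ↦ hG.ne he⟩
  · rw [hCV]
    ext v
    constructor
    · rintro ⟨hv, i, hi, rfl⟩
      rcases (hend i hi).1 hv with rfl | rfl
      exacts [.inl rfl, .inr rfl]
    · rintro (rfl | rfl)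
      exacts [⟨(hend 0 (by omega)).2 (.inl rfl), 0, Nat.zero_le m, rfl⟩,
        ⟨(hend m le_rfl).2 (.inr rfl), m, le_refl m, rfl⟩]
  · intro e he hef he'
    obtain ⟨a, b, hab⟩ := exists_isLink_of_mem_edgeSet he
    rcases (hl e a b).1 hab with h' | h'
    · obtain ⟨i, hi, rfl⟩ := ((hCE e).1 he').resolve_left hef
      exact absurd ⟨i, hi, rfl⟩ h'.2
    · exact h'.1
  · rw [hV, hCV]
    ext v
    constructor
    · intro hv
      by_cases hv' : v ∈ p '' Iic m
      · exact .inr hv'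
      · exact .inl ⟨hv, fun ⟨i, hi, h'⟩ ↦ hv' ⟨i, hi.2.le, h'⟩⟩
    · rintro (hv | ⟨i, hi, rfl⟩)
      exacts [hv.1, hpm i hi]
  · intro e a b
    rw [hl, hCl]
    constructor
    · intro he
      by_cases hee : e ∈ q '' Iio m
      · obtain ⟨i, hi, rfl⟩ := hee
        exact .inr ⟨.inr ⟨i, hi, rfl, he⟩, hqf i hi⟩
      · exact .inl ⟨.inl ⟨he, hee⟩, fun h' ↦ hf (h' ▸ he.edge_mem)⟩
    · rintro (⟨he | he, hne'⟩ | ⟨he | ⟨i, hi, -, he⟩, hne'⟩)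
      exacts [he.1, absurd he.1 hne', absurd he.1 hne', he]

/-- Splitting off a `δ`-cycle `C`. Its edges cannot be deleted, so they have weight `δ - 1`, and
this determines the total weight of the rest `G' \ f`. By the inequality for sets attached at two
vertices the rest is therefore 2-connected, and the weak weight equalities pass to `G'` unless it is
the 2-cycle. -/
lemma IsTwoSum.isSpadeOrTwoCycle_of_cycle {G G' C : Graph α β} {f : β} {x y : α} {δ : ℕ}
    (h : IsTwoSum G' C f f x y G) (hδ : 2 < δ) (hC : C.IsCycleOfLength δ)
    (hGs : G.IsSpadeOrTwoCycle δ) : G'.IsSpadeOrTwoCycle δ := by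
  classical
  have hG := hGs.twoConnected
  have hVG := hGs.finite_verts
  have hEG := hGs.finite_edges
  have hG' := h.twoConnected_left hG
  have hV' : V(G').Finite := hVG.subset h.subset_left
  have hE' : E(G').Finite := by
    refine (hEG.insert f).subset fun e he ↦ ?_
    by_cases hef : e = f
    · exact .inl hef
    · exact .inr (h.edgeSet_eq ▸ .inl ⟨he, hef⟩)
  have hVC := (hC.finite (by omega)).1
  have hEC := (hC.finite (by omega)).2
  refine ⟨hV', hE', hG', ?_⟩
  obtain ⟨w, hw⟩ : ∃ w, G.IsSpadeWeight δ w := by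
    refine hGs.cycle_or_spade.resolve_left fun h2 ↦ ?_
    have h3 := ncard_le_ncard h.symm.subset_left hVG
    rw [h2.ncard_verts, hC.ncard_verts] at h3
    omega
  -- A deletable edge of the path would also be deletable in the cycle.
  have hCw : ∀ e ∈ E(C), e ≠ f → w e = δ - 1 := by
    intro e he hef
    have heG : e ∈ E(G) := h.edgeSet_eq ▸ .inr ⟨he, hef⟩
    obtain ⟨g, hg, hge⟩ := hw.exists_ne hδ hG heG
    exact hw.of_contract e heG ((hG.delete_or_contract heG hg hge).resolve_left fun hd ↦
      hC.not_delete hδ he (h.symm.delete_left he hef hd))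
  obtain ⟨hconn, hind⟩ := h.connOn_compl_left hG (hC.contract hδ h.link₂.edge_mem)
  have hub : ∀ e ∈ E(G'), e ≠ f → w e = Function.update w f 1 e := fun e _ hef ↦ by simp [hef]
  have htot : (G.induce V(G')).totalWeight w + 1 = δ * (V(G').ncard - 1) := by
    have h1 := h.totalWeight_eq hE' hEC hub (w₂ := fun _ ↦ δ - 1) hCw
    have h2 := h.total_sub_one_mul hV' hVC δ
    have h3 := totalWeight_insert (w := Function.update w f 1) hE' h.link₁.edge_mem hind
      (w' := w) fun e he ↦ hub e (hind ▸ he).1 (hind ▸ he).2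
    have h4 := hw.total
    rw [totalWeight_const C hEC, hC.ncard_edges] at h1
    rw [hC.ncard_verts] at h2
    simp only [Function.update_self] at h1 h3
    omega
  have h2 := (hw.le_of_attach hG hVG hEG hδ V(G') x y h.subset_left h.link₁.left_mem
    h.link₁.right_mem h.ne h.attach hconn).2 htot
  have hd : (G'.deleteEdges {f}).TwoConnected := by
    rw [deleteEdges_twoConnected_iff hG']
    refine h2.mono fun e a b he ha hb ↦ ⟨e, ?_⟩
    have he' : e ∈ E(G') \ {f} := hind ▸ ⟨a, b, he, ha, hb⟩
    exact ⟨(h.isLink_iff_left he'.1 he'.2).1 he, he'.2⟩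
  by_cases hnt : (E(G') \ {f}).Nontrivial
  · exact .inr ((h.isWeakSpadeWeight hG hδ hV' hVC hE' hEC hd (hC.contract hδ h.link₂.edge_mem) hnt
      (hw.isWeakSpadeWeight hδ hG)).1.exists_isSpadeWeight hG' hV' hE' hδ)
  · left
    obtain ⟨g, hg⟩ := hd.edgeSet_nonempty
    obtain ⟨a, b, hab⟩ := exists_isLink_of_mem_edgeSet hg
    rw [not_nontrivial_iff] at hnt
    have hg' : g ∈ E(G') \ {f} := ⟨hab.1.edge_mem, hab.2⟩
    have hV2 : V(G') = {a, b} := hd.verts_eq_pair hab fun e he ↦ by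
      obtain ⟨c, d, hcd⟩ := exists_isLink_of_mem_edgeSet he
      rwa [hnt ⟨hcd.1.edge_mem, hcd.2⟩ hg']
    refine isCycleOfLength_two (hG'.ne hab.1) (fun h' ↦ hg'.2 h'.symm) hV2 ?_
      (isLink_of_verts_pair hG' hV2 h.link₁.edge_mem) hab.1
    ext e
    constructor
    · intro he
      by_cases hef : e = f
      · exact .inl hef
      · exact .inr (hnt ⟨he, hef⟩ hg')
    · rintro (rfl | rfl)
      exacts [h.link₁.edge_mem, hg'.1]

lemma IsReverseCon.isSpadeOrTwoCycle {G G' : Graph α β} {δ : ℕ} (hδ : 2 < δ)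
    (h : IsReverseCon δ G G') (hG : G.IsSpadeOrTwoCycle δ) : G'.IsSpadeOrTwoCycle δ := by
  obtain ⟨C, f, x, y, hC, hsum⟩ := h.exists_isTwoSum hδ
  exact hsum.isSpadeOrTwoCycle_of_cycle hδ hC hG

theorem Obtainable.isSpadeOrTwoCycle {δ : ℕ} (hδ : 2 < δ) {G : Graph α β} (h : G.Obtainable δ) :
    G.IsSpadeOrTwoCycle δ := by
  induction h with
  | cycle h => exact h.isSpadeOrTwoCycle hδ
  | iso _ h ih => exact h.isSpadeOrTwoCycle ih
  | pathCon _ _ h ih₁ ih₂ => exact h.isSpadeOrTwoCycle hδ ih₁ ih₂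
  | deltaCon _ _ h ih₁ ih₂ => exact h.isSpadeOrTwoCycle hδ ih₁ ih₂
  | reverseCon _ h ih => exact h.isSpadeOrTwoCycle hδ ih

/-! ### Cycles with prescribed labels -/

/-- The closed walk through `p 0, …, p (n - 1)`, with the edges `q 0, …, q (n - 1)`. -/
def cycleOf (p : ℕ → α) (q : ℕ → β) (hq : q.Injective) (n : ℕ) : Graph α β where
  vertexSet := p '' Iio n
  IsLink e a b := ∃ i < n, e = q i ∧ s(a, b) = s(p i, p (if i + 1 = n then 0 else i + 1))
  isLink_symm e _ := ⟨fun a b ⟨i, hi, he, h⟩ ↦ ⟨i, hi, he, Sym2.eq_swap.trans h⟩⟩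
  eq_or_eq_of_isLink_of_isLink := by
    rintro e a b c d ⟨i, hi, rfl, h⟩ ⟨j, hj, hij, h'⟩
    obtain rfl := hq hij
    have := h.trans h'.symm
    rw [Sym2.eq_iff] at this
    exact this.imp And.left And.left
  left_mem_of_isLink := by
    rintro e a b ⟨i, hi, -, h⟩
    rw [Sym2.eq_iff] at h
    rcases h with ⟨rfl, -⟩ | ⟨rfl, -⟩
    · exact ⟨i, hi, rfl⟩
    · refine ⟨_, ?_, rfl⟩
      simp only [mem_Iio]
      split_ifs <;> omega

lemma cycleOf_isCycleOfLength {p : ℕ → α} {q : ℕ → β} (hp : p.Injective) (hq : q.Injective) {n : ℕ}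
    (hn : 0 < n) : (cycleOf p q hq n).IsCycleOfLength n := by
  refine isCycleOfLength_of_nat hn hp.injOn hq.injOn rfl ?_ fun i hi ↦ ⟨i, hi, rfl, rfl⟩
  ext e
  constructor
  · intro he
    obtain ⟨a, b, i, hi, rfl, -⟩ := exists_isLink_of_mem_edgeSet he
    exact ⟨i, hi, rfl⟩
  · rintro ⟨i, hi, rfl⟩
    exact IsLink.edge_mem (x := p i) (y := p _) ⟨i, hi, rfl, rfl⟩

/-- Injective sequences with prescribed first terms and the remaining terms outside a finite set. -/
lemma exists_injective_sequence {γ : Type*} [Infinite γ] {A : Set γ} (hA : A.Finite) {x y : γ}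
    (hne : x ≠ y) : ∃ p : ℕ → γ, p.Injective ∧ p 0 = x ∧ p 1 = y ∧
      ∀ i, p i ∈ A → p i = x ∨ p i = y := by
  have hinf : (A ∪ {x, y})ᶜ.Infinite := (hA.union (toFinite {x, y})).infinite_compl
  set g := hinf.natEmbedding
  have hg : ∀ i, (g i : γ) ∉ A ∧ (g i : γ) ≠ x ∧ (g i : γ) ≠ y := by
    intro i
    have := (g i).2
    simp only [mem_compl_iff, mem_union, mem_insert_iff, mem_singleton_iff, not_or] at this
    exact this
  refine ⟨fun i ↦ match i with | 0 => x | 1 => y | i + 2 => g i, ?_, rfl, rfl, ?_⟩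
  · rintro (_ | _ | i) (_ | _ | j) hij
    all_goals simp only [] at hij
    exacts [rfl, absurd hij hne, absurd hij.symm (hg j).2.1, absurd hij.symm hne, rfl,
      absurd hij.symm (hg j).2.2, absurd hij (hg i).2.1, absurd hij (hg i).2.2,
      congrArg (· + 2) (g.injective (Subtype.ext hij))]
  · rintro (_ | _ | i) h
    exacts [.inl rfl, .inr rfl, absurd h (hg i).1]

/-- There is a `δ`-cycle through a prescribed edge that is otherwise disjoint from given finite
sets. -/
lemma exists_cycle_through [Infinite α] [Infinite β] {δ : ℕ} (hδ : 2 < δ) {A : Set α} {F : Set β}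
    (hA : A.Finite) (hF : F.Finite) {x y : α} (hne : x ≠ y) (f : β) :
    ∃ C : Graph α β, C.IsCycleOfLength δ ∧ C.IsLink f x y ∧ V(C) ∩ A ⊆ {x, y} ∧
      E(C) ∩ F ⊆ {f} := by
  obtain ⟨p, hp, rfl, rfl, hpA⟩ := exists_injective_sequence hA hne
  obtain ⟨f', hf'⟩ := (hF.insert f).exists_notMem
  obtain ⟨q, hq, rfl, rfl, hqF⟩ := exists_injective_sequence (hF.insert f') (x := f) (y := f')
    fun h ↦ hf' (.inl h.symm)
  refine ⟨cycleOf p q hq δ, cycleOf_isCycleOfLength hp hq (by omega),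
    ⟨0, by omega, rfl, by rw [if_neg (by omega)]⟩, ?_, ?_⟩
  · rintro _ ⟨⟨i, hi, rfl⟩, h⟩
    exact hpA i h
  · rintro e ⟨he, heF⟩
    obtain ⟨a, b, i, hi, rfl, -⟩ := exists_isLink_of_mem_edgeSet he
    exact (hqF i (.inr heF)).resolve_right fun h ↦ hf' (.inr (h ▸ heF))

/-! ### Graphs with the weight equalities are obtainable -/

/-- A `δ`-cycle can be split off a 2-sum by the reverse construction. -/
lemma IsTwoSum.isReverseCon {H C G : Graph α β} {f : β} {x y : α} {δ : ℕ}
    (h : IsTwoSum H C f f x y G) (hδ : 2 < δ) (hG : G.TwoConnected) (hC : C.IsCycleOfLength δ) :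
    IsReverseCon δ G H := by
  obtain ⟨m, rfl⟩ : ∃ m, δ = m + 1 := ⟨δ - 1, by omega⟩
  obtain ⟨c, d, hc, hd, hV, hE, hl⟩ := hC
  obtain ⟨k, rfl⟩ : f ∈ range d := hE ▸ h.link₂.edge_mem
  -- The cycle without the edge `d k` is the path `c (k + 1), c (k + 2), …, c (k + 1 + m) = c k`.
  have hrep : ∀ i : ZMod (m + 1), ∃ j ≤ m, i = k + 1 + (j : ℕ) := fun i ↦
    ⟨(i - (k + 1)).val, Nat.lt_succ_iff.1 (ZMod.val_lt _), by simp⟩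
  have hinj : ∀ i ≤ m, ∀ j ≤ m, k + 1 + ((i : ℕ) : ZMod (m + 1)) = k + 1 + (j : ℕ) → i = j := by
    intro i hi j hj h
    have := add_left_cancel h
    rwa [ZMod.natCast_eq_natCast_iff', Nat.mod_eq_of_lt (by omega), Nat.mod_eq_of_lt (by omega)]
      at this
  have hkm : k + 1 + ((m : ℕ) : ZMod (m + 1)) = k := by
    have : ((m + 1 : ℕ) : ZMod (m + 1)) = 0 := ZMod.natCast_self _
    push_cast at this
    rw [add_assoc, add_comm 1, this, add_zero]
  have hends : s(x, y) = s(c (k + 1 + ((0 : ℕ) : ZMod (m + 1))), c (k + 1 + (m : ℕ))) := by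
    rw [hkm, Nat.cast_zero, add_zero, Sym2.eq_swap (a := c (k + 1)), Sym2.eq_iff]
    exact h.link₂.eq_and_eq_or_eq_and_eq (hl k)
  have hdk : ∀ i < m, d (k + 1 + (i : ℕ)) ≠ d k := by
    intro i hi h'
    have := hinj i hi.le m le_rfl ((hd h').trans hkm.symm)
    omega
  have hmem : ∀ i ≤ m, c (k + 1 + (i : ℕ)) ∈ V(H) → i = 0 ∨ i = m := by
    intro i hi hi'
    have h1 : c (k + 1 + (i : ℕ)) ∈ ({x, y} : Set α) :=
      h.eq_or_eq hi' (hV ▸ mem_range_self _)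
    have h2 : s(x, y) = s(c (k + 1 + ((0 : ℕ) : ZMod (m + 1))), c (k + 1 + (m : ℕ))) := hends
    have h3 : c (k + 1 + (i : ℕ)) ∈ s(x, y) := by simpa using h1
    rw [h2, Sym2.mem_iff] at h3
    exact h3.imp (fun h ↦ hinj i hi 0 (by omega) (hc h)) fun h ↦ hinj i hi m le_rfl (hc h)
  have hl' : ∀ i : ℕ, C.IsLink (d (k + 1 + (i : ℕ))) (c (k + 1 + (i : ℕ)))
      (c (k + 1 + ((i + 1 : ℕ) : ZMod (m + 1)))) := by
    intro i
    rw [Nat.cast_succ, ← add_assoc]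
    exact hl _
  refine ⟨hG, fun i ↦ c (k + 1 + (i : ℕ)), fun i ↦ d (k + 1 + (i : ℕ)), d k, ?_, ?_, ?_, ?_, ?_, ?_⟩
  · exact fun i hi j hj hij ↦ hinj i hi j hj (hc hij)
  · exact fun i hi ↦ h.symm.of_left (hl' i) (hdk i hi)
  · intro i hi hi'
    simp only [Nat.add_sub_cancel] at hi'
    have hloop : G.loopSet (c (k + 1 + (i : ℕ))) = ∅ := by
      ext e
      simp only [mem_empty_iff_false, iff_false]
      exact fun he ↦ hG.ne he rfl
    have hinc : G.incidenceSet (c (k + 1 + (i : ℕ))) =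
        {d (k + 1 + ((i - 1 : ℕ) : ZMod (m + 1))), d (k + 1 + (i : ℕ))} := by
      have hprev := hl' (i - 1)
      rw [Nat.sub_add_cancel hi] at hprev
      ext e
      constructor
      · rintro ⟨u, hu⟩
        rcases (h.isLink _ _ _).1 hu with hu | hu
        · rcases hmem i hi'.le hu.1.left_mem with h' | h' <;> omega
        · obtain ⟨l, rfl⟩ : e ∈ range d := hE ▸ hu.1.edge_mem
          rcases hu.1.left_eq_or_eq (hl l) with h' | h'
          · rw [hc h']
            exact .inr rfl
          · left
            have h1 : k + 1 + ((i - 1 : ℕ) : ZMod (m + 1)) + 1 = l + 1 := by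
              rw [← hc h', add_assoc, ← Nat.cast_add_one, Nat.sub_add_cancel hi]
            rw [add_right_cancel h1]
      · rintro (rfl | rfl)
        · exact ⟨_, h.symm.of_left hprev.symm (hdk (i - 1) (by omega))⟩
        · exact ⟨_, h.symm.of_left (hl' i) (hdk i hi')⟩
    rw [vertexDegree, hloop, hinc, ncard_empty, ncard_pair]
    intro h'
    have := hinj (i - 1) (by omega) i hi'.le (hd h')
    omega
  · rw [h.edgeSet_eq]
    rintro (h' | h') <;> exact h'.2 rfl
  · ext v
    simp only [Nat.add_sub_cancel, h.verts, mem_sdiff, mem_union]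
    constructor
    · refine fun hv ↦ ⟨.inl hv, ?_⟩
      rintro ⟨i, ⟨hi, hi'⟩, rfl⟩
      rcases hmem i hi'.le hv with h' | h' <;> omega
    · rintro ⟨hv | hv, hn⟩
      · exact hv
      · rw [hV] at hv
        obtain ⟨l, rfl⟩ := hv
        obtain ⟨i, hi, rfl⟩ := hrep l
        have hi0 : i = 0 ∨ i = m := by
          by_contra hi'
          exact hn ⟨i, ⟨by omega, by omega⟩, rfl⟩
        have : c (k + 1 + (i : ℕ)) ∈ s(x, y) := by
          rw [hends, Sym2.mem_iff]
          rcases hi0 with rfl | rfl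
          exacts [.inl rfl, .inr rfl]
        rcases Sym2.mem_iff.1 this with h' | h' <;> rw [h']
        exacts [h.link₁.left_mem, h.link₁.right_mem]
  · intro e a b
    simp only [Nat.add_sub_cancel]
    rw [← hends]
    constructor
    · intro he
      by_cases hek : e = d k
      · subst hek
        refine .inr ⟨rfl, ?_⟩
        rw [Sym2.eq_iff]
        exact he.eq_and_eq_or_eq_and_eq h.link₁
      · refine .inl ⟨h.of_left he hek, ?_⟩
        rintro ⟨i, -, rfl⟩
        exact hek (h.disj _ he.edge_mem hek (hE ▸ mem_range_self _))
    · rintro (⟨he, hn⟩ | ⟨rfl, he⟩)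
      · rcases (h.isLink e a b).1 he with h' | h'
        · exact h'.1
        · obtain ⟨l, rfl⟩ : e ∈ range d := hE ▸ h'.1.edge_mem
          obtain ⟨i, hi, rfl⟩ := hrep l
          have him : i ≠ m := by
            rintro rfl
            exact h'.2 (congrArg d hkm)
          exact absurd ⟨i, by simp only [mem_Iio]; omega, rfl⟩ hn
      · rw [Sym2.eq_iff] at he
        rcases he with ⟨rfl, rfl⟩ | ⟨rfl, rfl⟩
        exacts [h.link₁, h.link₁.symm]

/-- The bond with `δ` edges: the `δ`-construction applied to two `δ`-cycles yields `δ - 2` parallel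
edges and two paths, which two reverse constructions turn into edges. -/
lemma obtainable_of_bond [Infinite α] [Infinite β] {G : Graph α β} {δ : ℕ} (hδ : 2 < δ)
    (hG : G.TwoConnected) {x y : α} (hV : V(G) = {x, y}) (hE : E(G).Finite)
    (hcard : E(G).ncard = δ) : G.Obtainable δ := by
  obtain ⟨f₁, hf₁, f₂, hf₂, hne⟩ : E(G).Nontrivial := (one_lt_ncard_iff_nontrivial_and_finite.1
    (by omega : 1 < E(G).ncard)).1
  have hl₁ : G.IsLink f₁ x y := isLink_of_verts_pair hG hV hf₁
  have hl₂ : G.IsLink f₂ x y := isLink_of_verts_pair hG hV hf₂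
  have hxy := hG.ne hl₁
  have hVfin : V(G).Finite := hV ▸ toFinite {x, y}
  obtain ⟨C₁, hC₁, hCl₁, hCV₁, hCE₁⟩ := exists_cycle_through hδ hVfin hE hxy f₁
  have hfin₁ := hC₁.finite (by omega)
  obtain ⟨C₂, hC₂, hCl₂, hCV₂, hCE₂⟩ := exists_cycle_through hδ (hVfin.union hfin₁.1)
    (hE.union hfin₁.2) hxy f₂
  have hC₁2 := hC₁.twoConnected (by omega)
  have hC₂2 := hC₂.twoConnected (by omega)
  obtain ⟨g₁, hg₁, hgf₁⟩ := (hC₁.isSpadeWeight hδ).exists_ne hδ hC₁2 hCl₁.edge_mem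
  obtain ⟨g₂, hg₂, hgf₂⟩ := (hC₂.isSpadeWeight hδ).exists_ne hδ hC₂2 hCl₂.edge_mem
  have hd₁ : ∀ e ∈ E(C₁), e ∈ E(G) → e = f₁ := fun e he he' ↦ hCE₁ ⟨he, he'⟩
  have hd₂ : ∀ e ∈ E(C₂), e ∈ E(G) ∨ e ∈ E(C₁) → e = f₂ := fun e he he' ↦ hCE₂ ⟨he, he'⟩
  have hf₂₁ : f₂ ∉ E(C₁) := fun h ↦ hne (hd₁ f₂ h hf₂).symm
  have hf₁₂ : f₁ ∉ E(C₂) := fun h ↦ hne (hd₂ f₁ h (.inl hf₁))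
  -- Each of `f₁` and `f₂` is replaced by a path of `δ - 1` edges.
  obtain ⟨G₁, hsum₁⟩ := hG.exists_isTwoSum hC₁2 hl₁ hCl₁ (Subset.antisymm
    (fun v hv ↦ hV ▸ hv.1) (pair_subset ⟨hl₁.left_mem, hCl₁.left_mem⟩
      ⟨hl₁.right_mem, hCl₁.right_mem⟩)) fun e he _ he' ↦ hd₁ e he' he
  have hG₁ := hsum₁.twoConnected hG hC₁2 hf₂ hne.symm hg₁ hgf₁
  have hl₂' : G₁.IsLink f₂ x y := hsum₁.of_left hl₂ hne.symm
  obtain ⟨G₂, hsum₂⟩ := hG₁.exists_isTwoSum hC₂2 hl₂' hCl₂ (Subset.antisymm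
    (fun v hv ↦ hCV₂ ⟨hv.2, hsum₁.verts ▸ hv.1⟩)
    (pair_subset ⟨hl₂'.left_mem, hCl₂.left_mem⟩ ⟨hl₂'.right_mem, hCl₂.right_mem⟩))
    fun e he _ he' ↦ hd₂ e he' ((hsum₁.edgeSet_eq ▸ he).imp And.left And.left)
  have hG₂ := hsum₂.twoConnected hG₁ hC₂2 (hsum₁.edgeSet_eq ▸ .inr ⟨hg₁, hgf₁⟩)
    (fun h ↦ hf₂₁ (h ▸ hg₁)) hg₂ hgf₂
  have hP : (E(G) \ {f₁, f₂}).encard = ((δ - 2 : ℕ) : ℕ∞) := by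
    rw [← hE.sdiff.cast_ncard_eq, ncard_sdiff (pair_subset hf₁ hf₂) (toFinite _), hcard,
      ncard_pair hne]
  have hdelta : IsDeltaCon δ C₁ C₂ G₂ := by
    refine ⟨hC₁2, hC₂2, f₁, f₂, ⟨_, (hC₁.isSpadeWeight hδ).toIsWeight, rfl⟩,
      ⟨_, (hC₂.isSpadeWeight hδ).toIsWeight, rfl⟩, x, y, E(G) \ {f₁, f₂}, hCl₁, hCl₂, ?_, ?_, hP,
      ?_, ?_, ?_⟩
    · exact Subset.antisymm (fun v hv ↦ hCV₂ ⟨hv.2, .inr hv.1⟩) (pair_subset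
        ⟨hCl₁.left_mem, hCl₂.left_mem⟩ ⟨hCl₁.right_mem, hCl₂.right_mem⟩)
    · exact disjoint_left.2 fun e he he' ↦ hf₂₁ (hd₂ e he' (.inr he) ▸ he)
    · refine disjoint_left.2 fun e he ↦ ?_
      rintro (he' | he')
      · exact he.2 (.inl (hd₁ e he' he.1))
      · exact he.2 (.inr (hd₂ e he' (.inl he.1)))
    · rw [hsum₂.verts, hsum₁.verts, hV, union_eq_self_of_subset_left
        (pair_subset hCl₁.left_mem hCl₁.right_mem)]
    · intro e a b
      rw [hsum₂.isLink, hsum₁.isLink]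
      constructor
      · rintro (⟨⟨he, h1⟩ | he, h2⟩ | he)
        · refine .inr (.inr ⟨⟨he.edge_mem, not_or.2 ⟨h1, h2⟩⟩, ?_⟩)
          rw [Sym2.eq_iff]
          exact he.eq_and_eq_or_eq_and_eq (isLink_of_verts_pair hG hV he.edge_mem)
        · exact .inl he
        · exact .inr (.inl he)
      · rintro (he | he | ⟨⟨he, hn⟩, h'⟩)
        · exact .inl ⟨.inr he, fun h ↦ hf₂₁ (h ▸ he.1.edge_mem)⟩
        · exact .inr he
        · have hl := isLink_of_verts_pair hG hV he
          rw [Sym2.eq_iff] at h'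
          refine .inl ⟨.inl ⟨?_, fun h ↦ hn (.inl h)⟩, fun h ↦ hn (.inr h)⟩
          rcases h' with ⟨rfl, rfl⟩ | ⟨rfl, rfl⟩
          exacts [hl, hl.symm]
  exact .reverseCon (.reverseCon (.deltaCon (.cycle hC₁) (.cycle hC₂) hdelta)
    (hsum₂.isReverseCon hδ hG₂ hC₂)) (hsum₁.isReverseCon hδ hG₁ hC₁)

/-- Over infinite types there are always unused labels for the edges along which a graph is split,
and the graph is rebuilt from its pieces by the path construction. -/
theorem IsSpadeWeight.obtainable_of_infinite [Infinite α] [Infinite β] {δ : ℕ} (hδ : 2 < δ)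
    {G : Graph α β} (hG : G.TwoConnected) (hV : V(G).Finite) (hE : E(G).Finite) {w : β → ℕ}
    (hw : G.IsSpadeWeight δ w) : G.Obtainable δ := by
  induction hn : V(G).ncard + E(G).ncard using Nat.strong_induction_on generalizing G w with
  | h n ih =>
    subst hn
    have hweak := hw.isWeakSpadeWeight hδ hG
    rcases hweak.cycle_or_bond_or_reducing hG hV hE hδ with hc | ⟨x, y, hxy, hcard⟩ | ⟨S, x, y, hS⟩
    · exact .cycle hc
    · exact obtainable_of_bond hδ hG hxy hE hcard
    · obtain ⟨e₁, he₁⟩ := hE.exists_notMem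
      obtain ⟨e₂, he₂⟩ := (hE.insert e₁).exists_notMem
      have hsub := edgeSet_induce_subset G S
      obtain ⟨G₁, G₂, w₁, w₂, hsum, ⟨hV₁, hV₂, hE₁, hE₂⟩, hlt₁, hlt₂, hEG₁, hEG₂, hd, hc, hw₁,
        hw₂⟩ := hS.split hG hV hE hδ hweak (e₁ := e₁) (e₂ := e₂) (fun h ↦ he₁ (hsub h))
          fun h ↦ he₂ (.inr h.1)
      have hG₁ := hsum.twoConnected_left hG
      have hG₂ := hsum.symm.twoConnected_left hG
      obtain ⟨w₁', hw₁'⟩ := hw₁.exists_isSpadeWeight hG₁ hV₁ hE₁ hδ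
      obtain ⟨w₂', hw₂'⟩ := hw₂.exists_isSpadeWeight hG₂ hV₂ hE₂ hδ
      refine .pathCon (ih _ hlt₁ hG₁ hV₁ hE₁ hw₁' rfl) (ih _ hlt₂ hG₂ hV₂ hE₂ hw₂' rfl)
        ⟨hG₁, hG₂, e₁, e₂, ⟨w₁', hw₁'.toIsWeight, hw₁'.of_delete _ hsum.link₁.edge_mem hd⟩,
          ⟨w₂', hw₂'.toIsWeight, hw₂'.of_contract _ hsum.link₂.edge_mem hc⟩, x, y, ∅, hsum.link₁,
          hsum.link₂, hsum.inter, ?_, by simp, empty_disjoint _, hsum.verts, ?_⟩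
      · rw [hEG₁, hEG₂, disjoint_left]
        rintro e (rfl | he) (rfl | he')
        exacts [he₂ (.inl rfl), he₁ he'.1, he₂ (.inr (hsub he)), he'.2 he]
      · intro e a b
        simp [hsum.isLink]

/-- `G` with its vertices and edges relabelled along injections. -/
def relabel {α' : Type*} {β' : Type*} (φ : α ↪ α') (ψ : β ↪ β') (G : Graph α β) : Graph α' β' where
  vertexSet := φ '' V(G)
  IsLink e a b := ∃ e' a' b', G.IsLink e' a' b' ∧ ψ e' = e ∧ φ a' = a ∧ φ b' = b
  isLink_symm e _ := ⟨fun a b ⟨e', a', b', h, he, ha, hb⟩ ↦ ⟨e', b', a', h.symm, he, hb, ha⟩⟩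
  eq_or_eq_of_isLink_of_isLink := by
    rintro _ _ _ _ _ ⟨e, a, b, h, rfl, rfl, rfl⟩ ⟨e', c, d, h', he, rfl, rfl⟩
    obtain rfl := ψ.injective he
    exact (h.left_eq_or_eq h').imp (congrArg φ) (congrArg φ)
  left_mem_of_isLink := by
    rintro _ _ _ ⟨e, a, b, h, rfl, rfl, rfl⟩
    exact ⟨a, h.left_mem, rfl⟩

lemma isIsoMap_relabel {α' : Type*} {β' : Type*} (φ : α ↪ α') (ψ : β ↪ β') (G : Graph α β) :
    IsIsoMap φ ψ G (G.relabel φ ψ) where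
  verts := φ.injective.injOn.bijOn_image
  edges := by
    refine ⟨fun e he ↦ ?_, ψ.injective.injOn, fun e he ↦ ?_⟩
    · obtain ⟨a, b, h⟩ := exists_isLink_of_mem_edgeSet he
      exact IsLink.edge_mem (x := φ a) (y := φ b) ⟨e, a, b, h, rfl, rfl, rfl⟩
    · obtain ⟨_, _, e', a, b, h, rfl, rfl, rfl⟩ := exists_isLink_of_mem_edgeSet he
      exact ⟨e', h.edge_mem, rfl⟩
  map e a b h := ⟨e, a, b, h, rfl, rfl, rfl⟩

theorem IsSpadeWeight.obtainable {δ : ℕ} (hδ : 2 < δ) {G : Graph α β} (hG : G.TwoConnected)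
    (hV : V(G).Finite) (hE : E(G).Finite) {w : β → ℕ} (hw : G.IsSpadeWeight δ w) :
    G.Obtainable δ := by
  -- The types may be too small to hold the intermediate graphs, so they are enlarged.
  set H : Graph (α ⊕ ULift.{u} ℕ) (β ⊕ ULift.{v} ℕ) := G.relabel .inl .inl
  have hiso : IsIsoMap (Function.Embedding.inl : α ↪ α ⊕ ULift.{u} ℕ)
      (Function.Embedding.inl : β ↪ β ⊕ ULift.{v} ℕ) G H := isIsoMap_relabel _ _ G
  have hH := hiso.twoConnected hG
  obtain ⟨φ, ψ, hback⟩ := hiso.isIsomorphic.symm.exists_isIsoMap hH.nontrivial.nonempty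
    hH.edgeSet_nonempty
  exact .iso ((hback.isSpadeWeight hH hw).obtainable_of_infinite hδ hH
    (hiso.verts.image_eq ▸ hV.image _) (hiso.edges.image_eq ▸ hE.image _)) hiso.isIsomorphic.symm

end Graph

theorem mainTheorem2 {α : Type u} {β : Type v} (δ : ℕ) (hδ : 2 < δ) (G : Graph α β)
    (hV : G.vertexSet.Finite) (hE : G.edgeSet.Finite) (hG : G.TwoConnected) :
    G.SatisfiesSpade δ ↔ G.Obtainable δ ∧ ¬ G.IsCycleOfLength 2 := by
  rw [Graph.satisfiesSpade_iff]
  constructor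
  · rintro ⟨w, hw⟩
    exact ⟨hw.obtainable hδ hG hV hE, fun h ↦ h.not_isSpadeWeight hδ w hw⟩
  · rintro ⟨h, h2⟩
    exact (h.isSpadeOrTwoCycle hδ).cycle_or_spade.resolve_left h2
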